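/- **Conventions.** Let $\mathbb{Z}^\times=\mathbb{Z}\setminus\{0\}$ and $P=\bigoplus_{k\in\mathbb{Z}^\times}\mathbb{Z}\epsilon_k\oplus\mathbb{Z}\Lambda_0$. For $i\in\mathbb{Z}$ let the colour-$i$ arrow of $\mathbf{B}:\ \cdots\to-2\xrightarrow{-1}-1\xrightarrow{0}1\xrightarrow{1}2\to\cdots$ run from $k$ to $l$; put $\alpha_i=\epsilon_k-\epsilon_l$, and let $h_i$ be the functional on $P$ with $\langle\epsilon_m,h_i\rangle=\delta_{mk}-\delta_{ml}$ and $\langle\Lambda_0,h_i\rangle=\delta_{i0}$. A $\mathfrak{gl}_\infty$-crystal is a set $B$ with maps $\mathrm{wt}:B\to P$, $\varepsilon_i,\varphi_i:B\to\mathbb{Z}\cup\{-\infty\}$, $\tilde e_i,\tilde f_i:B\to B\cup\{\mathbf 0\}$ ($i\in\mathbb{Z}$) such that $\varphi_i(b)=\langle\mathrm{wt}(b),h_i\rangle+\varepsilon_i(b)$; $\tilde f_ib=b'\Leftrightarrow b=\tilde e_ib'$ for $b,b'\in B$; if $\tilde e_ib\ne\mathbf 0$ (resp. $\tilde f_ib\neq\mathbf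 0$), then applying it changes $\mathrm{wt},\varepsilon_i,\varphi_i$ by $\alpha_i,-1,+1$ (resp. $-\alpha_i,+1,-1$); and $\tilde e_ib=\tilde f_ib=\mathbf 0$ if $\varphi_i(b)=-\infty$. A morphism is a map $\psi:B_1\cup\{\mathbf 0\}\to B_2\cup\{\mathbf 0\}$ fixing $\mathbf 0$, preserving $\mathrm{wt},\varepsilon_i,\varphi_i$ wherever $\psi(b)\ne\mathbf 0$, and satisfying $\psi(\tilde x_ib)=\tilde x_i\psi(b)$ ($x=e,f$) whenever $\psi(b)$ and $\psi(\tilde x_ib)$ are non-zero; it is an embedding if it is injective. On $B_1\otimes B_2$, $\mathrm{wt}(b_1\otimes b_2)=\mathrm{wt}(b_1)+\mathrm{wt}(b_2)$, $\varepsilon_i(b_1\otimes b_2)=\max(\varepsilon_i(b_1),\varepsilon_i(b_2)-\langle\mathrm{wt}(b_1),h_i\rangle)$, $\varphi_i(b_1\otimes b_2)=\max(\varphi_i(b_1)+\langle\mathrm{wt}(b_2),h_i\rangle,\varphi_i(b_2))$, $\tilde e_i$ acts on $b_1$ if $\varphi_i(b_1)\ge\varepsilon_i(b_2)$ and on $b_2$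 otherwise; $\tilde f_i$ acts on $b_1$ if $\varphi_i(b_1)>\varepsilon_i(b_2)$ and on $b_2$ otherwise. $T_\lambda=\{t_\lambda\}$ is the one-element crystal of weight $\lambda$ with $\varepsilon_i=\varphi_i=-\infty$ and all operators zero. A finite word is regarded as the tensor product of its letters, read from left to right. On the letters of the crystals below, $\varepsilon_i$ (resp. $\varphi_i$) is the number of colour-$i$ arrows coming in (resp. going out). **The crystal $\mathcal M$.** Let $\mathbf{B}_{>0}=\{1<2<\cdots\}$ with arrows $j\xrightarrow{j}j+1$ and $\mathrm{wt}(j)=\epsilon_j$, and $\mathbf{B}_{<0}^\vee=\{-1^\vee<-2^\vee<\cdots\}$ with arrows $-k^\vee\xrightarrow{-k}-(k+1)^\vee$ and $\mathrm{wt}(-k^\vee)=-\epsilon_{-k}$. Let $\mathcal M$ be the set of matrices $A=(a_{-i^\vee,j})_{i,j\ge1}$ over $\mathbb{Z}_{\ge0}$ of finite support. List the pairs $(-i^\vee,j)$, each $a_{-i^\vee,j}$ times, so that $j$ weakly increases and, for equal $j$, the first entries weakly decrease, and let $\mathbf i$ and $\mathbf j$ be the words of first and second entries; list them so that the first entries weakly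 increase and, for equal first entries, $j$ weakly decreases, and let $\mathbf k$ and $\mathbf l$ be the words of first and second entries. The maps $\varepsilon_i,\varphi_i,\tilde e_i,\tilde f_i$ of $\mathcal M$ are given by the action on $\mathbf i$ in $(\mathbf i,\mathbf j)$ if $i<0$, and by that on $\mathbf l$ in $(\mathbf k,\mathbf l)$ if $i>0$. Moreover $\mathrm{wt}(A)=\sum a_{-i^\vee,j}(\epsilon_j-\epsilon_{-i})$, $\varepsilon_0(A)=a_{-1^\vee,1}$, $\varphi_0(A)=\langle\mathrm{wt}(A),h_0\rangle+\varepsilon_0(A)$, $\tilde f_0A=A+E_{-1^\vee,1}$, and $\tilde e_0A=A-E_{-1^\vee,1}$ if $a_{-1^\vee,1}\neq0$, $\tilde e_0A=\mathbf 0$ otherwise. **The map $\kappa$.** Let $\mathcal T$ be the set of pairs $(S,T)$ of semistandard tableaux (rows weakly increasing, columns strictly increasing downwards) with entries in $\mathbf{B}_{<0}^\vee$ and $\mathbf{B}_{>0}$ respectively and of the same anti-normal shape $\nu^\pi$ (the $180^\circ$-rotation of a partition $\nu$). For a tableau $T$ of anti-normal shape, $T\leftarrow a$ is obtained by replacing the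 largest entry $a'\le a$ of the right-most column by $a$ and inserting $a'$ into the next column to the left in the same way, and so on; if there is no such entry, $a$ is put on top of the column and the procedure stops. Let $\mathbf P(w_1\cdots w_r)=(\cdots(w_1\leftarrow w_2)\cdots)\leftarrow w_r$ and $\kappa(A)=(\mathbf P(\mathbf i_{\rm rev}),\mathbf P(\mathbf l_{\rm rev}))$, where $\rm rev$ reverses a word. **The crystal $\mathbf B(n\Lambda_0)$.** Let $\mathcal F$ be the set of semi-infinite strictly increasing words $w=\cdots w_{-2}w_{-1}$ in $\mathbb{Z}^\times$ such that, for some $c\in\mathbb{Z}$, $w_i=i+c$ for $i\ll0$. Its crystal maps are given by the rule for finite words, and $\mathrm{wt}(w)=\Lambda_0+\sum_{k>0,\,k\in w}\epsilon_k-\sum_{k<0,\,k\notin w}\epsilon_k$. Let $\mathbf B(\Lambda_0)$ be the connected component of $\cdots-3\,-2\,-1$ in $\mathcal F$. For $n\ge1$, $\mathbf B(n\Lambda_0)\subset\mathcal F^{\otimes n}$ is the set of all $\mathbf w=w^{(1)}\otimes\cdots\otimes w^{(n)}$ with $w^{(i)}\in\mathbf B(\Lambda_0)$ and $w^{(i+1)}_k\le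 w^{(i)}_k$ for all $1\le i<n$, $k<0$ (semi-infinite semistandard tableaux whose columns from right to left are $w^{(1)},\dots,w^{(n)}$), with the induced crystal maps. Let $\mathbf w_{>0}$ be the subtableau of positive entries, and let $\mathbf w_{<0}^\vee$ be the tableau of anti-normal shape whose $k$th column from the right consists of the $-j^\vee$ ($j>0$) such that $-j$ does not occur in $w^{(k)}$. **Proposition.** $\mathcal M$ is a $\mathfrak{gl}_\infty$-crystal and $\kappa:\mathcal M\to\mathcal T$ is a bijection. For each $n\ge1$, $\mathbf B(n\Lambda_0)\cup\{\mathbf 0\}$ is stable under all $\tilde e_i,\tilde f_i$, both $\mathbf B(n\Lambda_0)$ and $\mathbf B(n\Lambda_0)\otimes T_{-n\Lambda_0}$ are $\mathfrak{gl}_\infty$-crystals, $(\mathbf w_{<0}^\vee,\mathbf w_{>0})\in\mathcal T$ for all $\mathbf w\in\mathbf B(n\Lambda_0)$, and the map $$\Psi_n:\mathbf B(n\Lambda_0)\otimes T_{-n\Lambda_0}\longrightarrow\mathcal M,\qquad \Psi_n(\mathbf w\otimes t_{-n\Lambda_0})=\kappa^{-1}(\mathbf w_{<0}^\vee,\mathbf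 w_{>0}),$$ is a $\mathfrak{gl}_\infty$-crystal embedding. Moreover $\operatorname{Im}\Psi_n\subset\operatorname{Im}\Psi_{n+1}$ for all $n\ge1$, and $\mathcal M=\bigcup_{n\ge1}\operatorname{Im}\Psi_n$. -/

import Mathlib

open Filter

noncomputable section

namespace GlInf

/-! ### Letters, weights, simple roots and coroots -/

/-- The index set `ℤ^×` of non-zero integers. -/
abbrev Letter := {k : ℤ // k ≠ 0}

/-- The letter `p`, for `p > 0`. -/
def posLetter (p : ℕ+) : Letter := ⟨(p : ℤ), by have := p.pos; omega⟩

/-- The letter `-p`, for `p > 0`. -/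
def negLetter (p : ℕ+) : Letter := ⟨-(p : ℤ), by have := p.pos; omega⟩

/-- The arrow of colour `i` in `⋯ → -2 → -1 → 1 → 2 → ⋯` starts at the letter `lo i`:
this is `i` for `i > 0` and `i - 1` for `i ≤ 0`. -/
def lo (i : ℤ) : Letter := ⟨if 0 < i then i else i - 1, by split <;> omega⟩

/-- The arrow of colour `i` in `⋯ → -2 → -1 → 1 → 2 → ⋯` ends at the letter `hi i`:
this is `i + 1` for `i ≥ 0` and `i` for `i < 0`. -/
def hi (i : ℤ) : Letter := ⟨if 0 ≤ i then i + 1 else i, by split <;> omega⟩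

/-- The weight lattice `P = ⨁_k ℤ ε_k ⊕ ℤ Λ₀`. -/
abbrev Weight := (Letter →₀ ℤ) × ℤ

/-- The weight `ε_k`. -/
def epsWt (k : Letter) : Weight := (Finsupp.single k 1, 0)

/-- The fundamental weight `Λ₀`. -/
def Lam0 : Weight := (0, 1)

/-- The simple root `α_i`, the difference of the `ε`'s of the two ends of the arrow `i`. -/
def simpleRoot (i : ℤ) : Weight := epsWt (lo i) - epsWt (hi i)

/-- The pairing `⟨lam, h_i⟩` with the simple coroot `h_i = E_{lo i, lo i} - E_{hi i, hi i}`.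
As `⟨Λ₀, E_{kk}⟩` is `1/2` for `k < 0` and `-1/2` for `k > 0`, `⟨Λ₀, h_i⟩ = δ_{i,0}`. -/
def pairing (lam : Weight) (i : ℤ) : ℤ :=
  lam.1 (lo i) - lam.1 (hi i) + if i = 0 then lam.2 else 0

/-! ### Crystals -/

/-- The maps of a `gl_∞`-crystal; `none` is the formal symbol `0` and `⊥` is `-∞`. -/
structure CrystalData (B : Type) where
  wt : B → Weight
  eps : ℤ → B → WithBot ℤ
  phi : ℤ → B → WithBot ℤ
  e : ℤ → B → Option B
  f : ℤ → B → Option B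

/-- The axioms of a `gl_∞`-crystal. -/
structure CrystalData.IsCrystal {B : Type} (C : CrystalData B) : Prop where
  phi_eq : ∀ i b, C.phi i b = (pairing (C.wt b) i : WithBot ℤ) + C.eps i b
  e_step : ∀ i b b', C.e i b = some b' →
    C.eps i b' = C.eps i b + ((-1 : ℤ) : WithBot ℤ) ∧
    C.phi i b' = C.phi i b + ((1 : ℤ) : WithBot ℤ) ∧
    C.wt b' = C.wt b + simpleRoot i
  f_step : ∀ i b b', C.f i b = some b' →
    C.eps i b' = C.eps i b + ((1 : ℤ) : WithBot ℤ) ∧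
    C.phi i b' = C.phi i b + ((-1 : ℤ) : WithBot ℤ) ∧
    C.wt b' = C.wt b - simpleRoot i
  f_iff_e : ∀ i b b', C.f i b = some b' ↔ C.e i b' = some b
  of_phi_bot : ∀ i b, C.phi i b = ⊥ → C.e i b = none ∧ C.f i b = none

/-- Morphisms of crystals, as maps `B₁ ∪ {0} → B₂ ∪ {0}`. -/
structure IsMorphism {B₁ B₂ : Type} (C₁ : CrystalData B₁) (C₂ : CrystalData B₂)
    (psi : Option B₁ → Option B₂) : Prop where
  map_zero : psi none = none
  map_data : ∀ b b', psi (some b) = some b' → C₂.wt b' = C₁.wt b ∧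
    ∀ i, C₂.eps i b' = C₁.eps i b ∧ C₂.phi i b' = C₁.phi i b
  map_e : ∀ i b, psi (some b) ≠ none → psi (C₁.e i b) ≠ none →
    psi (C₁.e i b) = (psi (some b)).bind (C₂.e i)
  map_f : ∀ i b, psi (some b) ≠ none → psi (C₁.f i b) ≠ none →
    psi (C₁.f i b) = (psi (some b)).bind (C₂.f i)

/-- An embedding of crystals is an injective morphism. -/
def IsEmbedding {B₁ B₂ : Type} (C₁ : CrystalData B₁) (C₂ : CrystalData B₂)
    (psi : Option B₁ → Option B₂) : Prop :=
  IsMorphism C₁ C₂ psi ∧ Function.Injective psi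

/-- The tensor product of crystals. -/
def tensor {B₁ B₂ : Type} (C₁ : CrystalData B₁) (C₂ : CrystalData B₂) :
    CrystalData (B₁ × B₂) where
  wt b := C₁.wt b.1 + C₂.wt b.2
  eps i b := max (C₁.eps i b.1) (C₂.eps i b.2 + ((-pairing (C₁.wt b.1) i : ℤ) : WithBot ℤ))
  phi i b := max (C₁.phi i b.1 + (pairing (C₂.wt b.2) i : WithBot ℤ)) (C₂.phi i b.2)
  e i b := if C₂.eps i b.2 ≤ C₁.phi i b.1 then (C₁.e i b.1).map (fun x => (x, b.2))
    else (C₂.e i b.2).map (fun y => (b.1, y))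
  f i b := if C₂.eps i b.2 < C₁.phi i b.1 then (C₁.f i b.1).map (fun x => (x, b.2))
    else (C₂.f i b.2).map (fun y => (b.1, y))

/-- The one-element crystal `T_lam`. -/
def tCrystal (lam : Weight) : CrystalData Unit where
  wt _ := lam
  eps _ _ := ⊥
  phi _ _ := ⊥
  e _ _ := none
  f _ _ := none

section Words

variable {B : Type} (C : CrystalData B)

/-- The weight of a word. -/
def wordWt : List B → Weight
  | [] => 0
  | b :: l => C.wt b + wordWt l

/-- `ε_i` of a word, by the tensor product rule. -/
def wordEps (i : ℤ) : List B → WithBot ℤ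
  | [] => 0
  | b :: l => max (C.eps i b) (wordEps i l + ((-pairing (C.wt b) i : ℤ) : WithBot ℤ))

/-- `φ_i` of a word, by the tensor product rule. -/
def wordPhi (i : ℤ) : List B → WithBot ℤ
  | [] => 0
  | b :: l => max (C.phi i b + (pairing (wordWt C l) i : WithBot ℤ)) (wordPhi i l)

/-- `e_i` on words, by the tensor product rule. -/
def wordE (i : ℤ) : List B → Option (List B)
  | [] => none
  | b :: l => if wordEps C i l ≤ C.phi i b then (C.e i b).map (fun x => x :: l)
      else (wordE i l).map (fun y => b :: y)

/-- `f_i` on words, by the tensor product rule. -/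
def wordF (i : ℤ) : List B → Option (List B)
  | [] => none
  | b :: l => if wordEps C i l < C.phi i b then (C.f i b).map (fun x => x :: l)
      else (wordF i l).map (fun y => b :: y)

/-- The crystal of finite words: `b₁ b₂ ⋯ b_r` is `b₁ ⊗ b₂ ⊗ ⋯ ⊗ b_r`, and the empty word is the
trivial element (weight `0`, `ε_i = φ_i = 0`, killed by all operators). -/
def wordCrystal : CrystalData (List B) where
  wt := wordWt C
  eps := wordEps C
  phi := wordPhi C
  e := wordE C
  f := wordF C

/-- The connected component of `b₀` in the crystal graph. -/
def CrystalData.component (b₀ : B) : Set B :=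
  {b | Relation.EqvGen (fun x y => ∃ i, C.f i x = some y) b₀ b}

open Classical in
/-- The crystal maps restricted to a subset (operators leaving the subset give `0`). -/
def CrystalData.restrict (S : Set B) : CrystalData S where
  wt b := C.wt b
  eps i b := C.eps i b
  phi i b := C.phi i b
  e i b := (C.e i b).bind (fun x => if h : x ∈ S then some ⟨x, h⟩ else none)
  f i b := (C.f i b).bind (fun x => if h : x ∈ S then some ⟨x, h⟩ else none)

end Words

/-! ### The crystals of letters -/

/-- The `gl_∞`-crystal `𝐁`: `⋯ → -2 → -1 → 1 → 2 → ⋯`. -/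
def letterCrystal : CrystalData Letter where
  wt k := epsWt k
  eps i k := if k = hi i then 1 else 0
  phi i k := if k = lo i then 1 else 0
  e i k := if k = hi i then some (lo i) else none
  f i k := if k = lo i then some (hi i) else none

/-- The `gl_{>0}`-crystal `𝐁_{>0}`: `1 → 2 → 3 → ⋯` with `p → p + 1` of colour `p`.
It is only used with colours `i > 0`. -/
def posCrystal : CrystalData ℕ+ where
  wt p := epsWt (posLetter p)
  eps i p := if 0 < i ∧ (p : ℤ) = i + 1 then 1 else 0
  phi i p := if (p : ℤ) = i then 1 else 0
  e i p := if 0 < i ∧ (p : ℤ) = i + 1 then some (p - 1) else none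
  f i p := if (p : ℤ) = i then some (p + 1) else none

/-- The `gl_{<0}`-crystal `𝐁_{<0}^∨`: `-1^∨ → -2^∨ → -3^∨ → ⋯`, where `-k^∨` is written `k : ℕ+`
and `-k^∨ → -(k+1)^∨` has colour `-k`. The linear order is `-1^∨ < -2^∨ < ⋯`, the order of `ℕ+`.
It is only used with colours `i < 0`. -/
def dualCrystal : CrystalData ℕ+ where
  wt k := -epsWt (negLetter k)
  eps i k := if i < 0 ∧ (k : ℤ) = -i + 1 then 1 else 0
  phi i k := if (k : ℤ) = -i then 1 else 0
  e i k := if i < 0 ∧ (k : ℤ) = -i + 1 then some (k - 1) else none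
  f i k := if (k : ℤ) = -i then some (k + 1) else none

/-! ### The crystal of matrices -/

/-- `ℕ × ℕ` matrices `(a_{-i^∨, j})_{i, j ≥ 1}` of finite support with entries in `ℤ_{≥ 0}`; the
entry `a_{-i^∨, j}` is `A (i, j)`. -/
abbrev Mat := ℕ+ × ℕ+ →₀ ℕ

/-- The biword `(𝐢, 𝐣) ∈ Ω` of a matrix, as its list of pairs `(i_k, j_k)`: these are weakly
increasing for the order `(i, j) < (k, l) ↔ j < l ∨ (j = l ∧ i > k)`. -/
def biword (A : Mat) : List (ℕ+ × ℕ+) :=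
  ((Finsupp.toMultiset A).map (fun p => (toLex (p.2, OrderDual.toDual p.1) : ℕ+ ×ₗ ℕ+ᵒᵈ))).sort.map
    (fun q => (OrderDual.ofDual (ofLex q).2, (ofLex q).1))

/-- The biword `(𝐤, 𝐥) ∈ Ω'` of a matrix, as its list of pairs `(k_r, l_r)`: these are weakly
increasing for the order `(i, j) <' (k, l) ↔ i < k ∨ (i = k ∧ j > l)`. -/
def biword' (A : Mat) : List (ℕ+ × ℕ+) :=
  ((Finsupp.toMultiset A).map (fun p => (toLex (p.1, OrderDual.toDual p.2) : ℕ+ ×ₗ ℕ+ᵒᵈ))).sort.map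
    (fun q => ((ofLex q).1, OrderDual.ofDual (ofLex q).2))

/-- The word `𝐢`, in the letters `-i^∨`. -/
def wordI (A : Mat) : List ℕ+ := (biword A).map Prod.fst

/-- The word `𝐣`. -/
def wordJ (A : Mat) : List ℕ+ := (biword A).map Prod.snd

/-- The word `𝐤`, in the letters `-i^∨`. -/
def wordK (A : Mat) : List ℕ+ := (biword' A).map Prod.fst

/-- The word `𝐥`. -/
def wordL (A : Mat) : List ℕ+ := (biword' A).map Prod.snd

/-- The matrix of a biword: its `(i, j)` entry is the number of occurrences of `(i, j)`. -/
def ofBiword (u v : List ℕ+) : Mat := Multiset.toFinsupp ((u.zip v : List (ℕ+ × ℕ+)) : Multiset _)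

/-- The elementary matrix `E_{-1^∨, 1}`. -/
def E11 : Mat := Finsupp.single (1, 1) 1

/-- `wt(A) = ∑ a_{-i^∨, j} (-ε_{-i} + ε_j)`. -/
def matWt (A : Mat) : Weight :=
  A.sum (fun p a => a • (-epsWt (negLetter p.1) + epsWt (posLetter p.2)))

/-- The `gl_∞`-crystal `ℳ`: for `i < 0` the operators act on `𝐢` in `(𝐢, 𝐣) ∈ Ω`, for `i > 0` on
`𝐥` in `(𝐤, 𝐥) ∈ Ω'`, and for `i = 0` they change the entry at `(-1^∨, 1)` by one. -/
def matCrystal : CrystalData Mat where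
  wt := matWt
  eps i A := if i < 0 then wordEps dualCrystal i (wordI A)
    else if 0 < i then wordEps posCrystal i (wordL A)
    else ((A (1, 1) : ℤ) : WithBot ℤ)
  phi i A := if i < 0 then wordPhi dualCrystal i (wordI A)
    else if 0 < i then wordPhi posCrystal i (wordL A)
    else (pairing (matWt A) 0 : WithBot ℤ) + ((A (1, 1) : ℤ) : WithBot ℤ)
  e i A := if i < 0 then (wordE dualCrystal i (wordI A)).map (fun u => ofBiword u (wordJ A))
    else if 0 < i then (wordE posCrystal i (wordL A)).map (fun v => ofBiword (wordK A) v)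
    else if A (1, 1) ≠ 0 then some (A - E11) else none
  f i A := if i < 0 then (wordF dualCrystal i (wordI A)).map (fun u => ofBiword u (wordJ A))
    else if 0 < i then (wordF posCrystal i (wordL A)).map (fun v => ofBiword (wordK A) v)
    else some (A + E11)

/-! ### Tableaux of anti-normal shape and the RSK map

A tableau of anti-normal shape `ν^π` is written as the list of its (non-empty) columns from right
to left, and each column as the list of its entries from bottom to top. As the columns are aligned
at the bottom, entries at the same position of two columns are in the same row. -/

/-- A tableau of anti-normal shape. -/
abbrev Tab := List (List ℕ+)

/-- Semistandard tableaux of anti-normal shape: columns strictly increase from top to bottom,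
heights weakly decrease from right to left, and rows weakly increase from left to right. -/
def IsSST (T : Tab) : Prop :=
  (∀ c ∈ T, c ≠ [] ∧ c.Pairwise (fun a b => b < a)) ∧
  T.IsChain (fun x y => y.length ≤ x.length ∧
    ∀ (p : ℕ) (hy : p < y.length) (hx : p < x.length), y[p] ≤ x[p])

/-- The set `𝒯` of pairs of semistandard tableaux of the same anti-normal shape. The first one has
entries `-k^∨`, written `k`. -/
def bitableaux : Set (Tab × Tab) :=
  {p | IsSST p.1 ∧ IsSST p.2 ∧ p.1.map List.length = p.2.map List.length}

/-- Insertion of `a` into a column (from bottom to top): `a` replaces the largest entry `≤ a`, which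
is returned; if there is none, `a` is put on top. -/
def insertColumn (a : ℕ+) : List ℕ+ → List ℕ+ × Option ℕ+
  | [] => ([a], none)
  | b :: c => if b ≤ a then (a :: c, some b)
      else (b :: (insertColumn a c).1, (insertColumn a c).2)

/-- `T ← a`: insert `a` into the right-most column, then the bumped entry into the next one, etc. -/
def insertTab : Tab → ℕ+ → Tab
  | [], a => [[a]]
  | c :: T, a => (insertColumn a c).1 ::
      match (insertColumn a c).2 with
      | none => T
      | some b => insertTab T b

/-- `𝐏(w) = (⋯((w₁ ← w₂) ← w₃)⋯) ← w_r`. -/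
def insertWord (w : List ℕ+) : Tab := w.foldl insertTab []

/-- The RSK map `κ(A) = (𝐏(A), 𝐐(A)) = (𝐏(𝐢_rev), 𝐏(𝐥_rev))`. -/
def kappa (A : Mat) : Tab × Tab :=
  (insertWord (wordI A).reverse, insertWord (wordL A).reverse)

/-! ### Semi-infinite words -/

/-- A semi-infinite word `⋯ w_{-3} w_{-2} w_{-1}`; `letter k` is `w_{-(k+1)}`. -/
@[ext] structure SemiInfWord where
  letter : ℕ → Letter
  strict : StrictAnti letter
  tail : ∃ c : ℤ, ∀ᶠ k : ℕ in atTop, (letter k : ℤ) = -((k : ℤ) + 1) + c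

/-- The set of letters of a semi-infinite word. -/
def SemiInfWord.letters (w : SemiInfWord) : Set Letter := Set.range w.letter

theorem SemiInfWord.finite_pos (w : SemiInfWord) : {p : ℕ+ | posLetter p ∈ w.letters}.Finite := by
  refine (Set.finite_Iic (Nat.toPNat' (w.letter 0 : ℤ).toNat)).subset ?_
  rintro p ⟨k, hk⟩
  have h1 : w.letter k ≤ w.letter 0 := w.strict.antitone (Nat.zero_le k)
  rw [hk] at h1
  have h2 : (p : ℤ) ≤ (w.letter 0 : ℤ) := h1
  have h3 := p.pos
  rw [Set.mem_Iic, ← PNat.coe_le_coe, Nat.toPNat'_coe]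
  split <;> omega

theorem SemiInfWord.finite_neg (w : SemiInfWord) : {p : ℕ+ | negLetter p ∉ w.letters}.Finite := by
  obtain ⟨c, hc⟩ := w.tail
  obtain ⟨K, hK⟩ := eventually_atTop.1 hc
  refine (Set.finite_Iic (Nat.toPNat' ((K : ℤ) + 1 - c).toNat)).subset ?_
  intro p hp
  by_contra hlt
  apply hp
  rw [Set.mem_Iic, not_le, ← PNat.coe_lt_coe, Nat.toPNat'_coe] at hlt
  have hb : (K : ℤ) + 1 - c < p := by
    split at hlt <;> omega
  refine ⟨((p : ℤ) - 1 + c).toNat, Subtype.ext ?_⟩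
  rw [hK _ (by omega)]
  simp only [negLetter]
  omega

open Classical in
/-- `m_k`: the multiplicity of `k` in `w` (at most one, as `w` is strictly increasing), minus one
if `k < 0`. -/
def SemiInfWord.mult (w : SemiInfWord) (k : Letter) : ℤ :=
  (if k ∈ w.letters then 1 else 0) - (if (k : ℤ) < 0 then 1 else 0)

theorem SemiInfWord.finite_mult (w : SemiInfWord) : (Function.support w.mult).Finite := by
  refine ((w.finite_pos.image posLetter).union (w.finite_neg.image negLetter)).subset ?_
  intro k hk
  have h0 := k.2
  rcases lt_or_gt_of_ne h0 with h | h
  · right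
    obtain ⟨q, hq⟩ : ∃ q : ℕ+, negLetter q = k := by
      refine ⟨Nat.toPNat' (-(k : ℤ)).toNat, Subtype.ext ?_⟩
      simp only [negLetter, Nat.toPNat'_coe]
      split <;> omega
    refine ⟨q, ?_, hq⟩
    change negLetter q ∉ w.letters
    rw [hq]
    intro hmem
    exact hk (by simp [SemiInfWord.mult, hmem, h])
  · left
    obtain ⟨q, hq⟩ : ∃ q : ℕ+, posLetter q = k := by
      refine ⟨Nat.toPNat' (k : ℤ).toNat, Subtype.ext ?_⟩
      simp only [posLetter, Nat.toPNat'_coe]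
      split <;> omega
    refine ⟨q, ?_, hq⟩
    change posLetter q ∈ w.letters
    rw [hq]
    by_contra hmem
    exact hk (by simp [SemiInfWord.mult, hmem, not_lt.2 h.le])

/-- `wt(w) = Λ₀ + ∑ m_k ε_k`. -/
def SemiInfWord.wt (w : SemiInfWord) : Weight :=
  Lam0 + (Finsupp.ofSupportFinite w.mult w.finite_mult, 0)

/-- Replace the letter `a` by `b`, where `b` does not occur and no letter is strictly between. -/
def SemiInfWord.subst (w : SemiInfWord) (a b : Letter) (hb : b ∉ w.letters)
    (hab : ∀ x : Letter, x ≠ a → x ≠ b → (x < a ↔ x < b)) : SemiInfWord where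
  letter k := if w.letter k = a then b else w.letter k
  strict := by
    intro k l hkl
    have h := w.strict hkl
    have hk : w.letter k ≠ b := fun h' => hb ⟨k, h'⟩
    have hl : w.letter l ≠ b := fun h' => hb ⟨l, h'⟩
    by_cases h1 : w.letter k = a <;> by_cases h2 : w.letter l = a
    · exact absurd (h2.trans h1.symm) h.ne
    · simp only [h1, h2, if_true, if_false]
      exact (hab _ h2 hl).1 (h1 ▸ h)
    · simp only [h1, h2, if_true, if_false]
      refine lt_of_le_of_ne (not_lt.1 fun h' => ?_) (Ne.symm hk)
      exact lt_asymm ((hab _ h1 hk).2 h') (h2 ▸ h)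
    · simpa only [h1, h2, if_false] using h
  tail := by
    obtain ⟨c, hc⟩ := w.tail
    refine ⟨c, ?_⟩
    filter_upwards [hc, eventually_gt_atTop (c - (a : ℤ)).toNat] with k hk hk'
    have hne : w.letter k ≠ a := by
      intro h
      rw [h] at hk
      omega
    rw [if_neg hne, hk]

theorem lo_hi_adj (i : ℤ) (x : Letter) (h1 : x ≠ lo i) (h2 : x ≠ hi i) : x < lo i ↔ x < hi i := by
  obtain ⟨x, hx⟩ := x
  simp only [ne_eq, Subtype.ext_iff, ← Subtype.coe_lt_coe, lo, hi] at *
  split_ifs at * <;> omega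

theorem hi_lo_adj (i : ℤ) (x : Letter) (h1 : x ≠ hi i) (h2 : x ≠ lo i) : x < hi i ↔ x < lo i :=
  (lo_hi_adj i x h2 h1).symm

open Classical in
/-- The `gl_∞`-crystal `ℱ` of semi-infinite words. The rule is that of finite words: `w` is strictly
increasing, so each of `lo i`, `hi i` occurs at most once, `lo i` to the left of `hi i`, they cancel
if both occur, and no other letter matters for the colour `i`. (See `fock_eq_word` for the
comparison with the operators on the finite words `w_{-N} ⋯ w_{-1}`.) -/
def fock : CrystalData SemiInfWord where
  wt := SemiInfWord.wt
  eps i w := if hi i ∈ w.letters ∧ lo i ∉ w.letters then 1 else 0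
  phi i w := if lo i ∈ w.letters ∧ hi i ∉ w.letters then 1 else 0
  e i w := if h : hi i ∈ w.letters ∧ lo i ∉ w.letters then
    some (w.subst (hi i) (lo i) h.2 (hi_lo_adj i)) else none
  f i w := if h : lo i ∈ w.letters ∧ hi i ∉ w.letters then
    some (w.subst (lo i) (hi i) h.2 (lo_hi_adj i)) else none

/-- The finite word `w_{-N} ⋯ w_{-1}`. -/
def SemiInfWord.truncate (w : SemiInfWord) : ℕ → List Letter
  | 0 => []
  | N + 1 => w.letter N :: w.truncate N

theorem lo_ne_hi (i : ℤ) : lo i ≠ hi i := by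
  intro h
  have := congrArg Subtype.val h
  simp only [lo, hi] at this
  split_ifs at this <;> omega

theorem lo_lt_hi (i : ℤ) : lo i < hi i := by
  rw [← Subtype.coe_lt_coe]
  simp only [lo, hi]
  split_ifs <;> omega

theorem pairing_add (x y : Weight) (i : ℤ) : pairing (x + y) i = pairing x i + pairing y i := by
  simp only [pairing, Prod.fst_add, Prod.snd_add, Finsupp.add_apply]
  split_ifs <;> ring

theorem pairing_epsWt (k : Letter) (i : ℤ) :
    pairing (epsWt k) i = (if k = lo i then 1 else 0) - (if k = hi i then 1 else 0) := by
  simp [pairing, epsWt, Finsupp.single_apply]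

theorem word_increasing (i : ℤ) (l : List Letter) (hl : l.Pairwise (· < ·)) :
    pairing (wordWt letterCrystal l) i =
      (if lo i ∈ l then 1 else 0) - (if hi i ∈ l then 1 else 0) ∧
    wordEps letterCrystal i l = (if hi i ∈ l ∧ lo i ∉ l then 1 else 0) ∧
    wordPhi letterCrystal i l = (if lo i ∈ l ∧ hi i ∉ l then 1 else 0) ∧
    wordE letterCrystal i l = (if hi i ∈ l ∧ lo i ∉ l then
      some (l.map fun x => if x = hi i then lo i else x) else none) ∧
    wordF letterCrystal i l = (if lo i ∈ l ∧ hi i ∉ l then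
      some (l.map fun x => if x = lo i then hi i else x) else none) := by
  induction l with
  | nil => simp [wordWt, wordEps, wordPhi, wordE, wordF, pairing]
  | cons b l ih =>
    obtain ⟨hb, hl'⟩ := List.pairwise_cons.1 hl
    obtain ⟨h1, h2, h3, h4, h5⟩ := ih hl'
    have hne := lo_ne_hi i
    have hlt := lo_lt_hi i
    have hbl : b ∉ l := fun h => lt_irrefl _ (hb b h)
    have id1 : ∀ x y : Letter, x ∉ l → l.map (fun z => if z = x then y else z) = l := by
      intro x y hx
      conv_rhs => rw [← List.map_id l]
      apply List.map_congr_left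
      intro z hz
      rw [if_neg (fun h : z = x => hx (h ▸ hz))]
      rfl
    have hw : pairing (wordWt letterCrystal (b :: l)) i = pairing (epsWt b) i +
        pairing (wordWt letterCrystal l) i := pairing_add _ _ _
    have k1 : letterCrystal.wt b = epsWt b := rfl
    have k2 : letterCrystal.eps i b = if b = hi i then 1 else 0 := rfl
    have k3 : letterCrystal.phi i b = if b = lo i then 1 else 0 := rfl
    have k4 : letterCrystal.e i b = if b = hi i then some (lo i) else none := rfl
    have k5 : letterCrystal.f i b = if b = lo i then some (hi i) else none := rfl
    refine ⟨?_, ?_, ?_, ?_, ?_⟩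
    · rw [hw, h1, pairing_epsWt]
      by_cases q1 : b = lo i
      · subst q1; simp [hbl, hne, hne.symm]; ring
      · by_cases q2 : b = hi i
        · subst q2; simp [hbl, hne, hne.symm]; ring
        · simp [q1, q2, Ne.symm q1, Ne.symm q2]
    all_goals
      by_cases q1 : b = lo i
      · subst q1
        by_cases m : hi i ∈ l <;>
          simp [wordEps, wordPhi, wordE, wordF, h1, h2, h3, h5, k1, k2, k3, k4, k5, hbl, m, hne,
            hne.symm, pairing_epsWt, id1] <;> rfl
      · by_cases q2 : b = hi i
        · subst q2
          have m : lo i ∉ l := fun h => lt_asymm hlt (hb _ h)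
          simp [wordEps, wordPhi, wordE, wordF, h1, h2, h3, h5, k1, k2, k3, k4, k5, hbl, m, hne,
            hne.symm, pairing_epsWt, id1]
        · by_cases m : hi i ∈ l <;> by_cases m' : lo i ∈ l <;>
          simp [wordEps, wordPhi, wordE, wordF, h1, h2, h3, h4, h5, k1, k2, k3, k4, k5, m, m', q1, q2,
            Ne.symm q1, Ne.symm q2, pairing_epsWt]

theorem SemiInfWord.mem_truncate (w : SemiInfWord) (N : ℕ) (x : Letter) :
    x ∈ w.truncate N ↔ ∃ k < N, w.letter k = x := by
  induction N with
  | zero => simp [SemiInfWord.truncate]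
  | succ N ih =>
    rw [SemiInfWord.truncate, List.mem_cons, ih]
    constructor
    · rintro (h | ⟨k, hk, h⟩)
      · exact ⟨N, Nat.lt_succ_self N, h.symm⟩
      · exact ⟨k, by omega, h⟩
    · rintro ⟨k, hk, h⟩
      rcases Nat.lt_succ_iff_lt_or_eq.1 hk with h' | h'
      · exact Or.inr ⟨k, h', h⟩
      · exact Or.inl (h' ▸ h.symm)

theorem SemiInfWord.pairwise_truncate (w : SemiInfWord) (N : ℕ) :
    (w.truncate N).Pairwise (· < ·) := by
  induction N with
  | zero => exact List.Pairwise.nil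
  | succ N ih =>
    refine List.pairwise_cons.2 ⟨fun x hx => ?_, ih⟩
    obtain ⟨k, hk, rfl⟩ := (w.mem_truncate N x).1 hx
    exact w.strict hk

theorem SemiInfWord.truncate_subst (w : SemiInfWord) (a b : Letter) (hb) (hab) (N : ℕ) :
    (w.subst a b hb hab).truncate N = (w.truncate N).map (fun x => if x = a then b else x) := by
  induction N with
  | zero => rfl
  | succ N ih => rw [SemiInfWord.truncate, ih]; rfl

theorem SemiInfWord.eventually_mem (w : SemiInfWord) (x : Letter) :
    ∀ᶠ N in atTop, (x ∈ w.truncate N ↔ x ∈ w.letters) := by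
  by_cases h : x ∈ w.letters
  · obtain ⟨k, rfl⟩ := h
    filter_upwards [eventually_gt_atTop k] with N hN
    exact iff_of_true ((w.mem_truncate N _).2 ⟨k, hN, rfl⟩) ⟨k, rfl⟩
  · refine Eventually.of_forall fun N => iff_of_false (fun h' => ?_) h
    obtain ⟨k, -, hk⟩ := (w.mem_truncate N x).1 h'
    exact h ⟨k, hk⟩

/-- The maps of `ℱ` are those of the finite words `w_{-N} ⋯ w_{-1}` for all large `N`. -/
theorem fock_eq_word (w : SemiInfWord) (i : ℤ) : ∀ᶠ N in atTop,
    wordEps letterCrystal i (w.truncate N) = fock.eps i w ∧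
    wordPhi letterCrystal i (w.truncate N) = fock.phi i w ∧
    wordE letterCrystal i (w.truncate N) = (fock.e i w).map (fun v => v.truncate N) ∧
    wordF letterCrystal i (w.truncate N) = (fock.f i w).map (fun v => v.truncate N) := by
  classical
  filter_upwards [w.eventually_mem (lo i), w.eventually_mem (hi i)] with N h1 h2
  obtain ⟨-, g2, g3, g4, g5⟩ := word_increasing i _ (w.pairwise_truncate N)
  rw [g2, g3, g4, g5]
  refine ⟨?_, ?_, ?_, ?_⟩
  · exact if_congr (by rw [h1, h2]) rfl rfl
  · exact if_congr (by rw [h1, h2]) rfl rfl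
  · by_cases h : hi i ∈ w.letters ∧ lo i ∉ w.letters
    · simp [fock, h1, h2, h, SemiInfWord.truncate_subst]
    · simp only [fock, h1, h2, h, if_false, dif_neg, not_false_eq_true, Option.map_none]
  · by_cases h : lo i ∈ w.letters ∧ hi i ∉ w.letters
    · simp [fock, h1, h2, h, SemiInfWord.truncate_subst]
    · simp only [fock, h1, h2, h, if_false, dif_neg, not_false_eq_true, Option.map_none]

/-- `H_{Λ₀} = ⋯ -3 -2 -1`. -/
def groundWord : SemiInfWord where
  letter k := ⟨-((k : ℤ) + 1), by omega⟩
  strict := by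
    intro k l h
    rw [← Subtype.coe_lt_coe]
    simp only
    omega
  tail := ⟨0, by simp⟩

/-- `𝐁(Λ₀)`, the connected component of `H_{Λ₀}` in `ℱ`. -/
def BLam0 : Set SemiInfWord := fock.component groundWord

/-- `𝐁(nΛ₀)`: semi-infinite semistandard tableaux with `n` columns of shape `(0, …, 0)`. The list
`[w⁽¹⁾, …, w⁽ⁿ⁾]` (columns from right to left) stands for `w⁽¹⁾ ⊗ ⋯ ⊗ w⁽ⁿ⁾`; rows increase
weakly from left to right, that is `w⁽ⁱ⁺¹⁾_k ≤ w⁽ⁱ⁾_k` for all `k`. -/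
def BnLam0 (n : ℕ) : Set (List SemiInfWord) :=
  {t | t.length = n ∧ (∀ w ∈ t, w ∈ BLam0) ∧
    t.IsChain (fun v w => ∀ k, w.letter k ≤ v.letter k)}

/-- The crystal `𝐁(nΛ₀)`, a subset of `ℱ^{⊗ n}`. -/
def tabCrystal (n : ℕ) : CrystalData (BnLam0 n) := (wordCrystal fock).restrict (BnLam0 n)

/-- The crystal `𝐁(nΛ₀) ⊗ T_{-nΛ₀}`. -/
def shiftedCrystal (n : ℕ) : CrystalData (BnLam0 n × Unit) :=
  tensor (tabCrystal n) (tCrystal (-(n • Lam0)))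

/-! ### The map `Ψ_n` -/

/-- The positive letters of a column, from bottom to top. -/
def SemiInfWord.posColumn (w : SemiInfWord) : List ℕ+ :=
  w.finite_pos.toFinset.sort (fun a b => b ≤ a)

/-- The column of the `-k^∨` with `-k` missing in `w`, from bottom to top. -/
def SemiInfWord.negColumn (w : SemiInfWord) : List ℕ+ :=
  w.finite_neg.toFinset.sort (fun a b => b ≤ a)

/-- The subtableau `𝐰_{>0}` of positive entries. -/
def posPart (t : List SemiInfWord) : Tab :=
  (t.map SemiInfWord.posColumn).filter (fun c => c ≠ [])

/-- The tableau `𝐰_{<0}^∨`: its `k`th column from the right holds the `-j^∨` with `-j` missing in the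
`k`th column of `𝐰`. -/
def negPart (t : List SemiInfWord) : Tab :=
  (t.map SemiInfWord.negColumn).filter (fun c => c ≠ [])

/-- `Ψ_n(𝐰 ⊗ t_{-nΛ₀}) = κ⁻¹(𝐰_{<0}^∨, 𝐰_{>0})`. -/
def Psi (n : ℕ) (b : BnLam0 n × Unit) : Mat :=
  Function.invFun kappa (negPart b.1, posPart b.1)

end GlInf

end

noncomputable section

namespace GlInf

/-! ### Crystals of a single colour -/

/-! The proof works one colour at a time. For a fixed colour every crystal in sight is seminormal,
with `ε` and `φ` in ℕ, so the tensor rule becomes truncated arithmetic (`OneColour`, `Models`).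

The matrices carry two such structures: `rowX`, acting on first entries of biletters, and `columnX`,
its transpose. Column insertion is a morphism from letter ⊗ column to column ⊗ (bumped letter or
nothing). Hence inserting a word is a morphism (`tabOf_hom`), and `pTab` and `qTab` intertwine row
and column operators with the operators on tableaux.

Bijectivity of `κ` follows from crystal theory. Row and column operators commute
(`rowX_columnX_comm`); after cutting the biword this is a statement about a 2 × 2 block. A tableau
killed by every `e` has all its columns of the form 1, …, n, so it is determined by its shape, and
also by its content. Lowering a matrix to the bottom and using commutation, row operators fix the
second tableau (`qTab_rowX`) and column operators the first. A matrix killed by all `e` in both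
directions is diagonal; there the two tableaux agree and determine the matrix. Equality of shapes,
injectivity and surjectivity all descend to this case.

On the other side, a word in `BLam0` amounts to two strict columns of equal length: the missing
negative letters and the present positive ones (`length_columns`, `exists_word`). In these terms
rowwise comparison of words is rowwise comparison of both columns (`letter_le_iff_colLe`). So a
semi-infinite tableau is a pair in `bitableaux`, padded by empty columns, and positive and negative
colours act on one member of the pair each, as `κ` requires.

The colour zero is the one link between the two members. On words it adds a letter `1` to both
columns; on matrices it raises the entry (1, 1), that is, it inserts one more `1` just before the
increasing word read from the first column of the matrix. This extra `1` travels leftwards through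
the columns and stops exactly where the signature rule lets `f` of colour zero act
(`insertLetters_one`, `zeroX_spec`, `zero_main`).

Padding by the ground word makes the images increase, and every pair of tableaux has finitely many
columns, so the images exhaust the matrices. -/

/-- The maps of a crystal for one colour, with finite `ε` and `φ`. -/
structure OneColour (B : Type*) where
  ep : B → ℕ
  ph : B → ℕ
  e : B → Option B
  f : B → Option B

namespace OneColour

variable {B B' : Type*}

/-- The axioms of a seminormal crystal for one colour. -/
structure Law (X : OneColour B) : Prop where
  f_iff_e : ∀ x y, X.f x = some y ↔ X.e y = some x
  step : ∀ x y, X.f x = some y → X.ph x = X.ph y + 1 ∧ X.ep y = X.ep x + 1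
  f_none : ∀ x, X.f x = none ↔ X.ph x = 0
  e_none : ∀ x, X.e x = none ↔ X.ep x = 0

theorem Law.exists_f {X : OneColour B} (h : X.Law) {x : B} (hx : X.ph x ≠ 0) :
    ∃ y, X.f x = some y :=
  Option.ne_none_iff_exists'.1 fun h' => hx ((h.f_none x).1 h')

theorem Law.exists_e {X : OneColour B} (h : X.Law) {x : B} (hx : X.ep x ≠ 0) :
    ∃ y, X.e x = some y :=
  Option.ne_none_iff_exists'.1 fun h' => hx ((h.e_none x).1 h')

theorem Law.ph_ne {X : OneColour B} (h : X.Law) {x y : B} (hx : X.f x = some y) : X.ph x ≠ 0 :=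
  fun h' => by rw [(h.f_none x).2 h'] at hx; cases hx

theorem Law.ep_ne {X : OneColour B} (h : X.Law) {x y : B} (hx : X.e x = some y) : X.ep x ≠ 0 :=
  fun h' => by rw [(h.e_none x).2 h'] at hx; cases hx

/-- A map commuting with all the maps of two crystals. -/
structure IsHom (X : OneColour B) (Y : OneColour B') (G : B → B') : Prop where
  ep : ∀ b, Y.ep (G b) = X.ep b
  ph : ∀ b, Y.ph (G b) = X.ph b
  f : ∀ b, Y.f (G b) = (X.f b).map G

/-- Commutation with `e` comes for free: vanishing of `e` is read off from `ep`, and a non-zero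
value is found by inverting `f`. Hence `IsHom` asks for `f` only. -/
theorem IsHom.e {X : OneColour B} {Y : OneColour B'} {G : B → B'} (h : IsHom X Y G)
    (hX : X.Law) (hY : Y.Law) (b : B) : Y.e (G b) = (X.e b).map G := by
  cases hb : X.e b with
  | none => exact (hY.e_none _).2 ((h.ep b).trans ((hX.e_none b).1 hb))
  | some b' =>
    refine (hY.f_iff_e _ _).1 ?_
    rw [h.f, (hX.f_iff_e _ _).2 hb]
    rfl

variable (X : OneColour B)

/-- `ε` of a word. -/
def wep : List B → ℕ
  | [] => 0
  | b :: l => X.ep b + (wep l - X.ph b)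

/-- `φ` of a word. -/
def wph : List B → ℕ
  | [] => 0
  | b :: l => wph l + (X.ph b - X.wep l)

/-- The operator `e` on words. -/
def wE : List B → Option (List B)
  | [] => none
  | b :: l => if X.wep l ≤ X.ph b then (X.e b).map (· :: l) else (wE l).map (b :: ·)

/-- The operator `f` on words. -/
def wF : List B → Option (List B)
  | [] => none
  | b :: l => if X.wep l < X.ph b then (X.f b).map (· :: l) else (wF l).map (b :: ·)

/-- The crystal of words. -/
def word : OneColour (List B) := ⟨X.wep, X.wph, X.wE, X.wF⟩

variable {X}

/-- Associativity of the tensor product: a word may be cut anywhere, and the pieces interact only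
through their totals. Truncated subtraction stands for the maxima in the tensor rule. -/
theorem wep_append (l m : List B) : X.wep (l ++ m) = X.wep l + (X.wep m - X.wph l) := by
  induction l with
  | nil => simp [wep, wph]
  | cons b l ih => simp only [List.cons_append, wep, wph, ih]; omega

theorem wph_append (l m : List B) : X.wph (l ++ m) = X.wph m + (X.wph l - X.wep m) := by
  induction l with
  | nil => simp [wph]
  | cons b l ih => simp only [List.cons_append, wph, ih, wep_append]; omega

theorem wF_append (l m : List B) : X.wF (l ++ m) =
    if X.wep m < X.wph l then (X.wF l).map (· ++ m) else (X.wF m).map (l ++ ·) := by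
  induction l with
  | nil => simp [wph]
  | cons b l ih =>
    simp only [List.cons_append, wF, wph, ih, wep_append]
    by_cases h1 : X.wep m < X.wph l <;> by_cases h2 : X.wep l < X.ph b <;>
      by_cases h3 : X.wep l + (X.wep m - X.wph l) < X.ph b <;>
      by_cases h4 : X.wep m < X.wph l + (X.ph b - X.wep l) <;>
      first | omega | (simp only [h1, h2, h3, h4, if_true, if_false, Option.map_map]; rfl)

/-- The strict inequality for `f` and the weak one for `e` are matched: if `f` acts on the head then
`wep l < ph b`, and after the step `wep l ≤ ph b'`, so `e` returns to the same position. -/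
theorem word_law (h : X.Law) : X.word.Law := by
  have hs : ∀ l m, X.wF l = some m → X.wph l = X.wph m + 1 ∧ X.wep m = X.wep l + 1 := by
    intro l
    induction l with
    | nil => intro m hm; cases hm
    | cons b l ih =>
      intro m hm
      simp only [wF] at hm
      split_ifs at hm with h1
      · obtain ⟨b', hb, rfl⟩ := Option.map_eq_some_iff.1 hm
        have := h.step _ _ hb
        simp only [wep, wph]; omega
      · obtain ⟨l', hl, rfl⟩ := Option.map_eq_some_iff.1 hm
        have := ih _ hl
        simp only [wep, wph]; omega
  have hfn : ∀ l, X.wF l = none ↔ X.wph l = 0 := by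
    intro l
    induction l with
    | nil => simp [wF, wph]
    | cons b l ih =>
      simp only [wF, wph]
      split_ifs with h1
      · rw [Option.map_eq_none_iff, h.f_none]; omega
      · rw [Option.map_eq_none_iff, ih]; omega
  have hen : ∀ l, X.wE l = none ↔ X.wep l = 0 := by
    intro l
    induction l with
    | nil => simp [wE, wep]
    | cons b l ih =>
      simp only [wE, wep]
      split_ifs with h1
      · rw [Option.map_eq_none_iff, h.e_none]; omega
      · rw [Option.map_eq_none_iff, ih]; omega
  have hfe : ∀ l m, X.wF l = some m → X.wE m = some l := by
    intro l
    induction l with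
    | nil => intro m hm; cases hm
    | cons b l ih =>
      intro m hm
      simp only [wF] at hm
      split_ifs at hm with h1
      · obtain ⟨b', hb, rfl⟩ := Option.map_eq_some_iff.1 hm
        have := h.step _ _ hb
        rw [wE, if_pos (by omega), (h.f_iff_e _ _).1 hb]; rfl
      · obtain ⟨l', hl, rfl⟩ := Option.map_eq_some_iff.1 hm
        have := hs _ _ hl
        rw [wE, if_neg (by omega), ih _ hl]; rfl
  have hes : ∀ l m, X.wE l = some m → X.wep l = X.wep m + 1 := by
    intro l
    induction l with
    | nil => intro m hm; cases hm
    | cons b l ih =>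
      intro m hm
      simp only [wE] at hm
      split_ifs at hm with h1
      · obtain ⟨b', hb, rfl⟩ := Option.map_eq_some_iff.1 hm
        have := h.step _ _ ((h.f_iff_e _ _).2 hb)
        simp only [wep]; omega
      · obtain ⟨l', hl, rfl⟩ := Option.map_eq_some_iff.1 hm
        have := ih _ hl
        simp only [wep]; omega
  have hef : ∀ m l, X.wE m = some l → X.wF l = some m := by
    intro m
    induction m with
    | nil => intro m hm; cases hm
    | cons b l ih =>
      intro m hm
      simp only [wE] at hm
      split_ifs at hm with h1
      · obtain ⟨b', hb, rfl⟩ := Option.map_eq_some_iff.1 hm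
        have hb' := (h.f_iff_e _ _).2 hb
        have := h.step _ _ hb'
        rw [wF, if_pos (by omega), hb']; rfl
      · obtain ⟨l', hl, rfl⟩ := Option.map_eq_some_iff.1 hm
        have := hes _ _ hl
        rw [wF, if_neg (by omega), ih _ hl]; rfl
  exact ⟨fun x y => ⟨hfe x y, hef y x⟩, hs, hfn, hen⟩

/-- Letters may go to words of varying length. This is what allows empty columns of a semi-infinite
tableau to be dropped. -/
theorem IsHom.flatMap {Y : OneColour B'} {g : B → List B'} (h : IsHom X Y.word g) :
    IsHom X.word Y.word (fun l => l.flatMap g) := by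
  have h1 : ∀ b, Y.wep (g b) = X.ep b := h.ep
  have h2 : ∀ b, Y.wph (g b) = X.ph b := h.ph
  have h3 : ∀ b, Y.wF (g b) = (X.f b).map g := h.f
  have hep : ∀ l : List B, Y.wep (l.flatMap g) = X.wep l := by
    intro l
    induction l with
    | nil => rfl
    | cons b l ih => rw [List.flatMap_cons, wep_append, ih, h1, h2]; rfl
  refine ⟨hep, fun l => ?_, fun l => ?_⟩
  · change Y.wph (l.flatMap g) = X.wph l
    induction l with
    | nil => rfl
    | cons b l ih => rw [List.flatMap_cons, wph_append, ih, h2, hep]; rfl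
  · change Y.wF (l.flatMap g) = (X.wF l).map _
    induction l with
    | nil => rfl
    | cons b l ih =>
      rw [List.flatMap_cons, wF_append, ih, h2, hep, h3, wF]
      split_ifs <;> cases X.f b <;> cases X.wF l <;> simp

theorem IsHom.map {Y : OneColour B'} {g : B → B'} (h : IsHom X Y g) :
    IsHom X.word Y.word (List.map g) := by
  have hep : ∀ l : List B, Y.wep (l.map g) = X.wep l := by
    intro l
    induction l with
    | nil => rfl
    | cons b l ih => rw [List.map_cons, wep, ih, h.ep, h.ph, wep]
  refine ⟨hep, fun l => ?_, fun l => ?_⟩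
  · change Y.wph (l.map g) = X.wph l
    induction l with
    | nil => rfl
    | cons b l ih => rw [List.map_cons, wph, ih, h.ph, hep, wph]
  · change Y.wF (l.map g) = (X.wF l).map _
    induction l with
    | nil => rfl
    | cons b l ih =>
      rw [List.map_cons, wF, ih, h.ph, hep, h.f, wF]
      split_ifs <;> simp only [Option.map_map] <;> rfl

theorem mem_of_wF {Q : B → Prop} (hQ : ∀ b b', X.f b = some b' → Q b → Q b') {l m : List B}
    (hl : X.wF l = some m) (h : ∀ b ∈ l, Q b) : ∀ b ∈ m, Q b := by
  induction l generalizing m with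
  | nil => cases hl
  | cons b l ih =>
    simp only [wF] at hl
    rw [List.forall_mem_cons] at h
    split_ifs at hl with h1
    · obtain ⟨b', hb, rfl⟩ := Option.map_eq_some_iff.1 hl
      exact List.forall_mem_cons.2 ⟨hQ _ _ hb h.1, h.2⟩
    · obtain ⟨l', hl', rfl⟩ := Option.map_eq_some_iff.1 hl
      exact List.forall_mem_cons.2 ⟨h.1, ih hl' h.2⟩

theorem mem_of_wE {Q : B → Prop} (hQ : ∀ b b', X.e b = some b' → Q b → Q b') {l m : List B}
    (hl : X.wE l = some m) (h : ∀ b ∈ l, Q b) : ∀ b ∈ m, Q b := by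
  induction l generalizing m with
  | nil => cases hl
  | cons b l ih =>
    simp only [wE] at hl
    rw [List.forall_mem_cons] at h
    split_ifs at hl with h1
    · obtain ⟨b', hb, rfl⟩ := Option.map_eq_some_iff.1 hl
      exact List.forall_mem_cons.2 ⟨hQ _ _ hb h.1, h.2⟩
    · obtain ⟨l', hl', rfl⟩ := Option.map_eq_some_iff.1 hl
      exact List.forall_mem_cons.2 ⟨h.1, ih hl' h.2⟩

/-- Serves for data which the operators do not touch: lengths of columns, second entries of
biletters, columns of the opposite sign. -/
theorem map_of_wF {γ : Type*} {g : B → γ} (hg : ∀ b b', X.f b = some b' → g b' = g b)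
    {l m : List B} (hl : X.wF l = some m) : m.map g = l.map g := by
  induction l generalizing m with
  | nil => cases hl
  | cons b l ih =>
    simp only [wF] at hl
    split_ifs at hl with h1
    · obtain ⟨b', hb, rfl⟩ := Option.map_eq_some_iff.1 hl
      simp [hg _ _ hb]
    · obtain ⟨l', hl', rfl⟩ := Option.map_eq_some_iff.1 hl
      simp [ih hl']

/-- Adjacency conditions compatible with `f` are preserved by `f`. -/
theorem isChain_of_wF {r : B → B → Prop} (h0 : ∀ v, X.ph v ≠ 0 → X.ep v = 0)
    (h1 : ∀ u v v', r u v → X.f v = some v' → X.ph u = 0 → r u v')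
    (h2 : ∀ u u' v, r u v → X.f u = some u' → r u' v) {l m : List B}
    (hl : X.wF l = some m) (h : l.IsChain r) : m.IsChain r := by
  induction l generalizing m with
  | nil => cases hl
  | cons u l ih =>
    simp only [wF] at hl
    split_ifs at hl with hu
    · obtain ⟨u', hb, rfl⟩ := Option.map_eq_some_iff.1 hl
      cases l with
      | nil => exact List.isChain_singleton _
      | cons v l =>
        rw [List.isChain_cons_cons] at h ⊢
        exact ⟨h2 _ _ _ h.1 hb, h.2⟩
    · obtain ⟨l', hl', rfl⟩ := Option.map_eq_some_iff.1 hl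
      cases l with
      | nil => cases hl'
      | cons v l =>
        rw [List.isChain_cons_cons] at h
        have ih' := ih hl' h.2
        simp only [wF, wep] at hl' hu
        split_ifs at hl' with hv
        · obtain ⟨v', hb, rfl⟩ := Option.map_eq_some_iff.1 hl'
          -- As `wep l < ph v`, the word `v :: l` has `wep` equal to `ep v`, which is 0 by `h0`.
          -- Passing over `u` then forces `ph u = 0`, the side condition of `h1`.
          have := h0 v (by omega)
          exact List.isChain_cons_cons.2 ⟨h1 _ _ _ h.1 hb (by omega), ih'⟩
        · obtain ⟨l'', -, rfl⟩ := Option.map_eq_some_iff.1 hl'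
          exact List.isChain_cons_cons.2 ⟨h.1, ih'⟩

/-- Adjacency conditions compatible with `e` are preserved by `e`. -/
theorem isChain_of_wE {r : B → B → Prop} (h0 : ∀ v, X.ph v ≠ 0 → X.ep v = 0) (hX : X.Law)
    (h1 : ∀ u u' v, r u v → X.e u = some u' → X.ep v = 0 → r u' v)
    (h2 : ∀ u v v', r u v → X.e v = some v' → r u v') {l m : List B}
    (hl : X.wE l = some m) (h : l.IsChain r) : m.IsChain r := by
  induction l generalizing m with
  | nil => cases hl
  | cons u l ih =>
    simp only [wE] at hl
    split_ifs at hl with hu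
    · obtain ⟨u', hb, rfl⟩ := Option.map_eq_some_iff.1 hl
      cases l with
      | nil => exact List.isChain_singleton _
      | cons v l =>
        rw [List.isChain_cons_cons] at h ⊢
        -- By `h0`, `ep u ≠ 0` gives `ph u = 0`; so `e` can act on `u` only if `ep v = 0`.
        have h3 := hX.ep_ne hb
        have h4 := h0 u
        simp only [wep] at hu
        exact ⟨h1 _ _ _ h.1 hb (by omega), h.2⟩
    · obtain ⟨l', hl', rfl⟩ := Option.map_eq_some_iff.1 hl
      cases l with
      | nil => cases hl'
      | cons v l =>
        rw [List.isChain_cons_cons] at h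
        have ih' := ih hl' h.2
        simp only [wE] at hl'
        split_ifs at hl' with hv
        · obtain ⟨v', hb, rfl⟩ := Option.map_eq_some_iff.1 hl'
          exact List.isChain_cons_cons.2 ⟨h2 _ _ _ h.1 hb, ih'⟩
        · obtain ⟨l'', -, rfl⟩ := Option.map_eq_some_iff.1 hl'
          exact List.isChain_cons_cons.2 ⟨h.1, ih'⟩

/-- The bracketing rule: the `ep` of `b` can only be cancelled by a `ph` on its left. -/
theorem exists_ph_of_wep_eq_zero {l m : List B} {b : B} (h : X.wep (l ++ b :: m) = 0)
    (hb : X.ep b ≠ 0) : ∃ c ∈ l, X.ph c ≠ 0 := by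
  by_contra! hc
  have h1 : X.wph l = 0 := by
    clear h
    induction l with
    | nil => rfl
    | cons c l ih =>
      rw [List.forall_mem_cons] at hc
      simp [wph, ih hc.2, hc.1]
  rw [wep_append, h1] at h
  simp only [wep] at h
  omega

end OneColour

/-- The colour-`i` part of `C` is the one-colour crystal `X`. -/
structure Models {B : Type} (C : CrystalData B) (i : ℤ) (X : OneColour B) : Prop where
  eps : ∀ b, C.eps i b = ((X.ep b : ℤ) : WithBot ℤ)
  phi : ∀ b, C.phi i b = ((X.ph b : ℤ) : WithBot ℤ)
  pair : ∀ b, pairing (C.wt b) i = X.ph b - X.ep b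
  e : ∀ b, C.e i b = X.e b
  f : ∀ b, C.f i b = X.f b

/-- The condition `pair`, that the weight is `ph - ep`, is what turns the maxima in `WithBot ℤ` into
truncated subtraction. -/
theorem Models.word {B : Type} {C : CrystalData B} {i : ℤ} {X : OneColour B} (h : Models C i X) :
    Models (wordCrystal C) i X.word := by
  have hep : ∀ l, wordEps C i l = ((X.wep l : ℤ) : WithBot ℤ) := by
    intro l
    induction l with
    | nil => rfl
    | cons b l ih =>
      rw [wordEps, ih, h.eps, h.pair, ← WithBot.coe_add, ← WithBot.coe_max, OneColour.wep]
      congr 1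
      omega
  have hpr : ∀ l, pairing (wordWt C l) i = X.wph l - X.wep l := by
    intro l
    induction l with
    | nil => simp [wordWt, pairing, OneColour.wph, OneColour.wep]
    | cons b l ih =>
      rw [wordWt, pairing_add, ih, h.pair, OneColour.wep, OneColour.wph]
      omega
  refine ⟨hep, fun l => ?_, hpr, fun l => ?_, fun l => ?_⟩
  · change wordPhi C i l = ((X.wph l : ℤ) : WithBot ℤ)
    induction l with
    | nil => rfl
    | cons b l ih =>
      rw [wordPhi, ih, h.phi, hpr, ← WithBot.coe_add, ← WithBot.coe_max, OneColour.wph]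
      congr 1
      omega
  · change wordE C i l = X.wE l
    induction l with
    | nil => rfl
    | cons b l ih =>
      rw [wordE, ih, hep, h.phi, h.e, OneColour.wE]
      simp only [WithBot.coe_le_coe, Nat.cast_le]
  · change wordF C i l = X.wF l
    induction l with
    | nil => rfl
    | cons b l ih =>
      rw [wordF, ih, hep, h.phi, h.f, OneColour.wF]
      simp only [WithBot.coe_lt_coe, Nat.cast_lt]

/-! ### Letters, columns and insertion -/

/-- The crystal of letters `⋯ → p → p + 1 → ⋯` for the colour `p`. -/
def letX (p : ℕ+) : OneColour ℕ+ where
  ep x := if x = p + 1 then 1 else 0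
  ph x := if x = p then 1 else 0
  e x := if x = p + 1 then some p else none
  f x := if x = p then some (p + 1) else none

/-- The crystal of columns for the colour `p`. -/
def colX (p : ℕ+) : OneColour (List ℕ+) where
  ep c := if p + 1 ∈ c ∧ p ∉ c then 1 else 0
  ph c := if p ∈ c ∧ p + 1 ∉ c then 1 else 0
  e c := if p + 1 ∈ c ∧ p ∉ c then some (c.map fun x => if x = p + 1 then p else x) else none
  f c := if p ∈ c ∧ p + 1 ∉ c then some (c.map fun x => if x = p then p + 1 else x) else none

theorem pnat_ne_succ (p : ℕ+) : p ≠ p + 1 := (PNat.lt_add_right p 1).ne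

theorem letX_law (p : ℕ+) : (letX p).Law := by
  have := pnat_ne_succ p
  refine ⟨fun x y => ?_, fun x y h => ?_, fun x => ?_, fun x => ?_⟩ <;> simp only [letX] at *
  · split_ifs <;> simp_all [eq_comm]
  · split_ifs at h ⊢ <;> simp_all
  · split_ifs <;> simp
  · split_ifs <;> simp

theorem map_replace_replace {α : Type*} [DecidableEq α] {a b : α} {c : List α} (h : b ∉ c) :
    (c.map fun x => if x = a then b else x).map (fun x => if x = b then a else x) = c := by
  rw [List.map_map]
  conv_rhs => rw [← List.map_id c]
  refine List.map_congr_left fun x hx => ?_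
  by_cases h1 : x = a
  · simp [h1]
  · have h2 : x ≠ b := fun h' => h (by rwa [← h'])
    simp [h1, h2]

theorem mem_map_replace {α : Type*} [DecidableEq α] {a b : α} {c : List α} {y : α} :
    y ∈ (c.map fun x => if x = a then b else x) ↔ (y = b ∧ a ∈ c) ∨ (y ∈ c ∧ y ≠ a) := by
  rw [List.mem_map]
  constructor
  · rintro ⟨x, hx, rfl⟩
    split_ifs with h
    · exact Or.inl ⟨rfl, h ▸ hx⟩
    · exact Or.inr ⟨hx, h⟩
  · rintro (⟨rfl, h⟩ | ⟨h, h'⟩)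
    · exact ⟨a, h, by simp⟩
    · exact ⟨y, h, by simp [h']⟩

theorem map_replace_of_notMem {α : Type*} [DecidableEq α] {a b : α} {c : List α} (h : a ∉ c) :
    (c.map fun x => if x = a then b else x) = c := by
  conv_rhs => rw [← List.map_id c]
  exact List.map_congr_left fun x hx => if_neg fun h' => h (by rwa [← h'])

theorem colX_law (p : ℕ+) : (colX p).Law := by
  have hp := pnat_ne_succ p
  refine ⟨fun x y => ?_, fun x y h => ?_, fun x => ?_, fun x => ?_⟩ <;> simp only [colX] at *
  · constructor
    · intro h
      split_ifs at h with h1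
      cases h
      rw [if_pos, map_replace_replace h1.2]
      rw [mem_map_replace, mem_map_replace]
      tauto
    · intro h
      split_ifs at h with h1
      cases h
      rw [if_pos, map_replace_replace h1.2]
      rw [mem_map_replace, mem_map_replace]
      tauto
  · split_ifs at h with h1
    cases h
    simp only [mem_map_replace]
    simp [h1, hp, hp.symm]
  · split_ifs <;> simp_all
  · split_ifs <;> simp_all

/-- Strictly decreasing columns. -/
abbrev DecCol (c : List ℕ+) : Prop := c.Pairwise (fun a b => b < a)

theorem DecCol.ext {c d : List ℕ+} (hc : DecCol c) (hd : DecCol d) (h : ∀ x, x ∈ c ↔ x ∈ d) :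
    c = d := by
  have hp : c.Perm d := by
    refine (List.perm_ext_iff_of_nodup ?_ ?_).2 h
    · exact hc.imp fun h => h.ne'
    · exact hd.imp fun h => h.ne'
  exact hp.eq_of_pairwise (fun a b _ _ h1 h2 => absurd h1 h2.asymm) hc hd

theorem decCol_of_f {p : ℕ+} {c d : List ℕ+} (h : (colX p).f c = some d) (hc : DecCol c) :
    DecCol d := by
  simp only [colX] at h
  split_ifs at h with h1
  cases h
  rw [DecCol, List.pairwise_map]
  refine hc.imp_of_mem fun {a b} ha hb hab => ?_
  have h3 : a ≠ p + 1 := fun h => h1.2 (h ▸ ha)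
  split_ifs with h4 h5 h5
  · exact absurd hab (by rw [h4, h5]; exact lt_irrefl _)
  · subst h4; exact lt_of_le_of_ne (PNat.add_one_le_iff.2 hab) (Ne.symm h3)
  · subst h5; exact hab.trans (PNat.lt_add_right _ 1)
  · exact hab

theorem decCol_of_e {p : ℕ+} {c d : List ℕ+} (h : (colX p).e c = some d) (hc : DecCol c) :
    DecCol d := by
  simp only [colX] at h
  split_ifs at h with h1
  cases h
  rw [DecCol, List.pairwise_map]
  refine hc.imp_of_mem fun {a b} ha hb hab => ?_
  have h3 : b ≠ p := fun h => h1.2 (h ▸ hb)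
  split_ifs with h4 h5 h5
  · exact absurd hab (by rw [h4, h5]; exact lt_irrefl _)
  · subst h4; exact (PNat.lt_add_right _ 1).trans hab
  · subst h5; exact lt_of_le_of_ne (PNat.lt_add_one_iff.1 hab) h3
  · exact hab

/-! ### Insertion into a single column -/

theorem insertColumn_of_lt {a : ℕ+} {c : List ℕ+} (h : ∀ y ∈ c, a < y) :
    insertColumn a c = (c ++ [a], none) := by
  induction c with
  | nil => rfl
  | cons b c ih =>
    rw [List.forall_mem_cons] at h
    rw [insertColumn, if_neg (not_le.2 h.1), ih h.2]; rfl

theorem insertColumn_append {a b : ℕ+} {l r : List ℕ+} (h : ∀ y ∈ l, a < y) (hb : b ≤ a) :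
    insertColumn a (l ++ b :: r) = (l ++ a :: r, some b) := by
  induction l with
  | nil => rw [List.nil_append, insertColumn, if_pos hb]; rfl
  | cons x l ih =>
    rw [List.forall_mem_cons] at h
    rw [List.cons_append, insertColumn, if_neg (not_le.2 h.1), ih h.2]; rfl

/-- Cutting the column at its first entry `≤ a` gives a closed form of `insertColumn` in each case,
used below instead of the recursion. -/
theorem insertColumn_cases (a : ℕ+) (c : List ℕ+) :
    (∀ y ∈ c, a < y) ∨ ∃ l b r, c = l ++ b :: r ∧ (∀ y ∈ l, a < y) ∧ b ≤ a := by
  induction c with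
  | nil => exact Or.inl (by simp)
  | cons x c ih =>
    by_cases h : x ≤ a
    · exact Or.inr ⟨[], x, c, rfl, by simp, h⟩
    · rw [not_le] at h
      rcases ih with ih | ⟨l, b, r, rfl, h1, h2⟩
      · exact Or.inl (List.forall_mem_cons.2 ⟨h, ih⟩)
      · exact Or.inr ⟨x :: l, b, r, rfl, List.forall_mem_cons.2 ⟨h, h1⟩, h2⟩

theorem decCol_append_iff {l r : List ℕ+} {b : ℕ+} : DecCol (l ++ b :: r) ↔
    DecCol l ∧ DecCol r ∧ (∀ y ∈ l, b < y) ∧ (∀ y ∈ r, y < b) ∧ ∀ x ∈ l, ∀ y ∈ r, y < x := by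
  rw [DecCol, List.pairwise_append, List.pairwise_cons]
  simp only [List.mem_cons, forall_eq_or_imp]
  constructor
  · rintro ⟨h1, ⟨h2, h3⟩, h4⟩
    exact ⟨h1, h3, fun y hy => (h4 y hy).1, h2, fun x hx => (h4 x hx).2⟩
  · rintro ⟨h1, h2, h3, h4, h5⟩
    exact ⟨h1, ⟨h4, h2⟩, fun x hx => ⟨h3 x hx, h5 x hx⟩⟩

theorem decCol_insertColumn (a : ℕ+) {c : List ℕ+} (hc : DecCol c) :
    DecCol (insertColumn a c).1 := by
  rcases insertColumn_cases a c with h | ⟨l, b, r, rfl, h1, h2⟩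
  · rw [insertColumn_of_lt h]
    rw [DecCol, List.pairwise_append]
    exact ⟨hc, List.pairwise_singleton _ _, by simpa using h⟩
  · rw [insertColumn_append h1 h2]
    rw [decCol_append_iff] at hc ⊢
    exact ⟨hc.1, hc.2.1, h1, fun y hy => (hc.2.2.2.1 y hy).trans_le h2, hc.2.2.2.2⟩

/-! ### Insertion commutes with the crystal operators -/

/-- Letters and the trivial element. -/
def optX (p : ℕ+) : OneColour (Option ℕ+) where
  ep x := if x = some (p + 1) then 1 else 0
  ph x := if x = some p then 1 else 0
  e x := if x = some (p + 1) then some (some p) else none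
  f x := if x = some p then some (some (p + 1)) else none

/-- The tensor product of two one-colour crystals. -/
def OneColour.tens {B B' : Type*} (X : OneColour B) (Y : OneColour B') : OneColour (B × B') where
  ep x := X.ep x.1 + (Y.ep x.2 - X.ph x.1)
  ph x := Y.ph x.2 + (X.ph x.1 - Y.ep x.2)
  e x := if Y.ep x.2 ≤ X.ph x.1 then (X.e x.1).map (·, x.2) else (Y.e x.2).map (x.1, ·)
  f x := if Y.ep x.2 < X.ph x.1 then (X.f x.1).map (·, x.2) else (Y.f x.2).map (x.1, ·)

/-- The positions of a letter with respect to an arrow `p → p + 1`. -/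
theorem letter_cases (p x : ℕ+) : (x < p ∧ x < p + 1 ∧ x ≠ p ∧ x ≠ p + 1) ∨ x = p ∨ x = p + 1 ∨
    (p < x ∧ p + 1 < x ∧ x ≠ p ∧ x ≠ p + 1) := by
  simp only [← PNat.coe_lt_coe, ← PNat.coe_inj, PNat.add_coe, PNat.one_coe, ne_eq]
  omega

/-- With `insertColumn_f`, this makes insertion a morphism from letter ⊗ column to column ⊗ (bumped
letter or nothing). Only the positions of `a` and of the bumped letter relative to `p`, `p + 1`, and
the presence of these two in the column, matter; so the check is finite. -/
theorem insertColumn_eps_phi (p a : ℕ+) {c : List ℕ+} (hc : DecCol c) :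
    ((colX p).tens (optX p)).ep (insertColumn a c) = ((letX p).tens (colX p)).ep (a, c) ∧
    ((colX p).tens (optX p)).ph (insertColumn a c) = ((letX p).tens (colX p)).ph (a, c) := by
  have hp : (p : ℕ+) < p + 1 := PNat.lt_add_right p 1
  have hp' := hp.ne
  have hp'' := hp.ne'
  rcases insertColumn_cases a c with h | ⟨l, b, r, rfl, h1, h2⟩
  · rw [insertColumn_of_lt h]
    have h3 := h p
    have h4 := h (p + 1)
    simp only [OneColour.tens, colX, optX, letX, List.mem_append, List.mem_singleton]
    clear h hc
    rcases letter_cases p a with ha | ha | ha | ha <;> grind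
  · rw [insertColumn_append h1 h2]
    rw [decCol_append_iff] at hc
    obtain ⟨-, -, h3, h4, h5⟩ := hc
    have a1 := h1 p
    have a2 := h1 (p + 1)
    have a3 := h3 p
    have a4 := h3 (p + 1)
    have a5 := h4 p
    have a6 := h4 (p + 1)
    simp only [OneColour.tens, colX, optX, letX, List.mem_append, List.mem_cons, Option.some_inj]
    clear h1 h3 h4 h5
    rcases letter_cases p a with ha | ha | ha | ha <;>
      rcases letter_cases p b with hb | hb | hb | hb <;> grind

theorem lt_of_mem_map_replace {p a : ℕ+} {l : List ℕ+} (h : ∀ y ∈ l, a < y) :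
    ∀ y ∈ l.map (fun x => if x = p then p + 1 else x), a < y := by
  intro y hy
  rcases mem_map_replace.1 hy with ⟨rfl, h'⟩ | ⟨h', -⟩
  · exact (h p h').trans (PNat.lt_add_right p 1)
  · exact h y h'

theorem insertColumn_f (p a : ℕ+) {c : List ℕ+} (hc : DecCol c) :
    ((colX p).tens (optX p)).f (insertColumn a c) =
      (((letX p).tens (colX p)).f (a, c)).map (fun x => insertColumn x.1 x.2) := by
  have hp : (p : ℕ+) < p + 1 := PNat.lt_add_right p 1
  have hp' := hp.ne
  have hp'' := hp.ne'
  rcases insertColumn_cases a c with h | ⟨l, b, r, rfl, h1, h2⟩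
  · rw [insertColumn_of_lt h]
    by_cases ha : a = p
    · subst ha
      have hac : a ∉ c := fun h' => lt_irrefl _ (h a h')
      by_cases hc1 : a + 1 ∈ c
      · simp [OneColour.tens, colX, optX, letX, hac, hc1]
      · have h3 : ∀ y ∈ c, a + 1 < y := fun y hy =>
          lt_of_le_of_ne (PNat.add_one_le_iff.2 (h y hy)) fun h' => hc1 (by rwa [h'])
        simp [OneColour.tens, colX, optX, letX, hac, hc1, hp'', map_replace_of_notMem,
          insertColumn_of_lt h3]
    · by_cases hc1 : p ∈ c ∧ p + 1 ∉ c
      · have h3 : a < p := h p hc1.1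
        have h4 : p + 1 ≠ a := (h3.trans hp).ne'
        simp [OneColour.tens, colX, optX, letX, hc1, ha, h4,
          insertColumn_of_lt (lt_of_mem_map_replace h)]
      · have h3 : ¬ (p ∈ c ++ [a] ∧ p + 1 ∉ c ++ [a]) := by
          simp only [List.mem_append, List.mem_singleton, Ne.symm ha, or_false]
          tauto
        simp [OneColour.tens, colX, optX, letX, hc1, ha, h3, -List.mem_append]
  · rw [insertColumn_append h1 h2]
    obtain ⟨-, -, h3, h4, h5⟩ := decCol_append_iff.1 hc
    by_cases ha : a = p
    · subst ha
      have e1 : a ∉ l := fun h => lt_irrefl _ (h1 a h)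
      have e2 : a ∉ r := fun h => absurd (h4 a h) (not_lt.2 h2)
      have e3 : a + 1 ∉ r := fun h => absurd ((h4 _ h).trans_le h2) (not_lt.2 hp.le)
      have e4 : a + 1 ≠ b := fun h => absurd h2 (not_le.2 (h ▸ hp))
      by_cases hl : a + 1 ∈ l
      · by_cases hb : b = a
        · subst hb
          -- Inserted and bumped letter coincide, and their successor is in the column too. After
          -- `f` the inserted letter replaces that successor instead: the column is the same, and
          -- the bumped letter has moved up by one, as `f` on the right factor prescribes.
          obtain ⟨l1, l2, rfl⟩ := List.append_of_mem hl
          have h6 : ∀ y ∈ l1, b + 1 < y := by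
            rw [List.append_assoc, List.cons_append] at hc
            exact (decCol_append_iff.1 hc).2.2.1
          have h7 := insertColumn_append (r := l2 ++ b :: r) h6 le_rfl
          simp only [OneColour.tens, colX, optX, letX]
          simp [h7]
        · simp [OneColour.tens, colX, optX, letX, e1, e2, e3, e4, hl, hb, Ne.symm hb]
      · have h6 : ∀ y ∈ l, a + 1 < y := fun y hy =>
          lt_of_le_of_ne (PNat.add_one_le_iff.2 (h1 y hy)) fun h' => hl (by rwa [h'])
        simp [OneColour.tens, colX, optX, letX, e1, e2, e3, e4, e4.symm, hl, hp'',
          map_replace_of_notMem, insertColumn_append h6 (h2.trans hp.le)]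
    · by_cases hc1 : p ∈ l ++ b :: r ∧ p + 1 ∉ l ++ b :: r
      · have hR : ((letX p).tens (colX p)).f (a, l ++ b :: r) =
            some (a, (l ++ b :: r).map fun x => if x = p then p + 1 else x) := by
          simp only [OneColour.tens, colX, letX, ha, hc1]
          simp
        rw [hR, Option.map_some]
        obtain ⟨hc1, hc2⟩ := hc1
        simp only [List.mem_append, List.mem_cons, not_or] at hc1 hc2
        obtain ⟨f1, f2, f3⟩ := hc2
        have f2' := Ne.symm f2
        by_cases m1 : p ∈ l
        · have g1 := h1 p m1
          have g2 : b ≠ p := (h2.trans_lt g1).ne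
          have g3 : p ∉ r := fun h => lt_asymm (h4 p h) (h2.trans_lt g1)
          have g4 : p + 1 ≠ a := (g1.trans hp).ne'
          simp [OneColour.tens, colX, optX, m1, f1, f2', f3, g2, g3, g4, ha,
            map_replace_of_notMem, insertColumn_append (lt_of_mem_map_replace h1) h2]
        · by_cases m2 : p = b
          · subst m2
            have g1 : p < a := lt_of_le_of_ne h2 (Ne.symm ha)
            have g2 : p ∉ r := fun h => lt_irrefl _ (h4 p h)
            have g3 : p + 1 ≤ a := PNat.add_one_le_iff.2 g1
            simp [OneColour.tens, colX, optX, m1, f3, g2, g1.ne,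
              map_replace_of_notMem, insertColumn_append h1 g3]
          · have m3 : p ∈ r := by tauto
            have g1 := h4 p m3
            have g2 : p + 1 ≠ a := fun h => by
              have := PNat.add_one_le_iff.2 g1
              exact f2 (le_antisymm this (h ▸ h2))
            simp [OneColour.tens, colX, optX, m1, f1, f2', f3, g1.ne', g2, m3, ha,
              map_replace_of_notMem, insertColumn_append h1 h2]
      · have hR : ((letX p).tens (colX p)).f (a, l ++ b :: r) = none := by
          simp only [OneColour.tens, colX, letX, ha, hc1]
          simp
        rw [hR, Option.map_none]
        -- If `p` itself were bumped by `a > p`, the column would contain `p` but not `p + 1`, and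
        -- `f` would not vanish before the insertion.
        have hL : b ≠ p := by
          rintro rfl
          refine hc1 ⟨by simp, fun h => ?_⟩
          have g1 : b < a := lt_of_le_of_ne h2 (Ne.symm ha)
          simp only [List.mem_append, List.mem_cons, hp'', false_or] at h
          rcases h with h | h
          · exact absurd (h1 _ h) (not_lt.2 (PNat.add_one_le_iff.2 g1))
          · exact absurd (h4 _ h) (not_lt.2 hp.le)
        -- If the new column alone admits `f`, then the insertion has removed a `p + 1`; this bumped
        -- letter cancels the column in the tensor product.
        have hL2 : (p ∈ l ++ a :: r ∧ p + 1 ∉ l ++ a :: r) → b = p + 1 := by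
          simp only [List.mem_append, List.mem_cons, Ne.symm ha, false_or] at hc1 ⊢
          tauto
        by_cases hL3 : p ∈ l ++ a :: r ∧ p + 1 ∉ l ++ a :: r
        · have := hL2 hL3
          subst this
          simp only [OneColour.tens, colX, optX, hL3]
          simp [hp'']
        · simp only [OneColour.tens, colX, optX, hL3]
          simp [hL]

/-- Insertion of an optional letter. -/
def insertOpt (T : Tab) : Option ℕ+ → Tab
  | none => T
  | some b => insertTab T b

theorem insertTab_cons (c : List ℕ+) (T : Tab) (a : ℕ+) :
    insertTab (c :: T) a = (insertColumn a c).1 :: insertOpt T (insertColumn a c).2 := by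
  rw [insertTab]
  cases (insertColumn a c).2 <;> rfl

theorem insertOpt_spec (p : ℕ+) (T : Tab)
    (h : ∀ a, (colX p).wep (insertTab T a) = ((letX p).tens (colX p).word).ep (a, T) ∧
      (colX p).wph (insertTab T a) = ((letX p).tens (colX p).word).ph (a, T) ∧
      (colX p).wF (insertTab T a) =
        (((letX p).tens (colX p).word).f (a, T)).map (fun x => insertTab x.2 x.1)) (o : Option ℕ+) :
    (colX p).wep (insertOpt T o) = ((optX p).tens (colX p).word).ep (o, T) ∧
      (colX p).wph (insertOpt T o) = ((optX p).tens (colX p).word).ph (o, T) ∧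
      (colX p).wF (insertOpt T o) =
        (((optX p).tens (colX p).word).f (o, T)).map (fun x => insertOpt x.2 x.1) := by
  cases o with
  | none =>
    simp [insertOpt, OneColour.tens, optX, OneColour.word, Option.map_map, Function.comp_def]
  | some b =>
    obtain ⟨h1, h2, h3⟩ := h b
    refine ⟨?_, ?_, ?_⟩
    · simpa [insertOpt, OneColour.tens, optX, letX] using h1
    · simpa [insertOpt, OneColour.tens, optX, letX] using h2
    · simp only [insertOpt]
      rw [h3]
      simp only [OneColour.tens, optX, letX, Option.some_inj]
      by_cases hb : b = p <;>
        by_cases h4 : (colX p).word.ep T < 1 <;> simp [hb, h4, Function.comp_def]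

/-- Induction on columns along letter ⊗ column ⊗ rest → column ⊗ bumped letter ⊗ rest → column ⊗
tableau: the first arrow is the single-column case, the second the induction hypothesis. -/
theorem insertTab_spec (p : ℕ+) {T : Tab} (hT : ∀ c ∈ T, DecCol c) (a : ℕ+) :
    (colX p).wep (insertTab T a) = ((letX p).tens (colX p).word).ep (a, T) ∧
      (colX p).wph (insertTab T a) = ((letX p).tens (colX p).word).ph (a, T) ∧
      (colX p).wF (insertTab T a) =
        (((letX p).tens (colX p).word).f (a, T)).map (fun x => insertTab x.2 x.1) := by
  induction T generalizing a with
  | nil =>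
    simp only [OneColour.wep, OneColour.wph, OneColour.wF, OneColour.word, OneColour.tens,
      insertTab, letX, colX]
    have hp := pnat_ne_succ p
    rcases letter_cases p a with ⟨-, -, h1, h2⟩ | h | h | ⟨-, -, h1, h2⟩
    · simp [h1, h2, h1.symm, h2.symm]
    · simp [h, hp, hp.symm, insertTab]
    · simp [h, hp, hp.symm]
    · simp [h1, h2, h1.symm, h2.symm]
  | cons c T ih =>
    rw [List.forall_mem_cons] at hT
    obtain ⟨g1, g2, g3⟩ := insertOpt_spec p T (ih hT.2) (insertColumn a c).2
    obtain ⟨k1, k2⟩ := insertColumn_eps_phi p a hT.1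
    have k3 := insertColumn_f p a hT.1
    rw [insertTab_cons]
    simp only [OneColour.wep, OneColour.wph, OneColour.wF, OneColour.word, OneColour.tens,
      g1, g2, g3] at k1 k2 k3 ⊢
    refine ⟨by omega, by omega, ?_⟩
    -- This decides whether `f` acts in the first two factors or in the rest `T`; the total `ph` of
    -- the first two is the same before and after insertion.
    by_cases hE : (colX p).wep T < (colX p).ph c + ((letX p).ph a - (colX p).ep c)
    · have k4 := congrArg (Option.map fun x => x.1 :: insertOpt T x.2) k3
      refine Eq.trans ?_ (k4.trans ?_)
      · by_cases h1 : (optX p).ep (insertColumn a c).2 + ((colX p).wep T -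
            (optX p).ph (insertColumn a c).2) < (colX p).ph (insertColumn a c).1 <;>
          by_cases h2 : (optX p).ep (insertColumn a c).2 < (colX p).ph (insertColumn a c).1 <;>
          by_cases h3 : (colX p).wep T < (optX p).ph (insertColumn a c).2 <;>
          first | omega | simp [h1, h2, h3, Function.comp_def]
      · by_cases h1 : (colX p).ep c + ((colX p).wep T - (colX p).ph c) < (letX p).ph a <;>
          by_cases h2 : (colX p).ep c < (letX p).ph a <;>
          by_cases h3 : (colX p).wep T < (colX p).ph c <;>
          first | omega | simp [h1, h2, h3, Function.comp_def, insertTab_cons]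
    · have h1 : ¬ (optX p).ep (insertColumn a c).2 + ((colX p).wep T -
            (optX p).ph (insertColumn a c).2) < (colX p).ph (insertColumn a c).1 := by omega
      have h2 : ¬ (colX p).wep T < (optX p).ph (insertColumn a c).2 := by omega
      have h3 : ¬ (colX p).ep c + ((colX p).wep T - (colX p).ph c) < (letX p).ph a := by omega
      have h4 : ¬ (colX p).wep T < (colX p).ph c := by omega
      simp [h1, h2, h3, h4, Function.comp_def, insertTab_cons]

/-- Insertion of the letters of a word from right to left. -/
def tabOf (w : List ℕ+) : Tab := w.foldr (fun a T => insertTab T a) []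

theorem insertWord_reverse (w : List ℕ+) : insertWord w.reverse = tabOf w := by
  rw [insertWord, List.foldl_reverse]; rfl

theorem decCol_insertTab {T : Tab} (hT : ∀ c ∈ T, DecCol c) (a : ℕ+) :
    ∀ c ∈ insertTab T a, DecCol c := by
  induction T generalizing a with
  | nil => simp [insertTab, DecCol]
  | cons c T ih =>
    rw [List.forall_mem_cons] at hT
    rw [insertTab_cons, List.forall_mem_cons]
    refine ⟨decCol_insertColumn a hT.1, ?_⟩
    cases (insertColumn a c).2 with
    | none => exact hT.2
    | some b => exact ih hT.2 b

theorem decCol_tabOf (w : List ℕ+) : ∀ c ∈ tabOf w, DecCol c := by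
  induction w with
  | nil => simp [tabOf]
  | cons a w ih => exact decCol_insertTab ih a

/-- The tableau of a word is a morphism of crystals. -/
theorem tabOf_hom (p : ℕ+) : OneColour.IsHom (letX p).word (colX p).word tabOf := by
  have hep : ∀ w, (colX p).wep (tabOf w) = (letX p).wep w := by
    intro w
    induction w with
    | nil => rfl
    | cons a w ih =>
      refine (insertTab_spec p (decCol_tabOf w) a).1.trans ?_
      simp only [OneColour.tens, OneColour.word, ih, OneColour.wep]
  refine ⟨hep, fun w => ?_, fun w => ?_⟩
  · change (colX p).wph (tabOf w) = (letX p).wph w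
    induction w with
    | nil => rfl
    | cons a w ih =>
      refine (insertTab_spec p (decCol_tabOf w) a).2.1.trans ?_
      simp only [OneColour.tens, OneColour.word, ih, hep, OneColour.wph]
  · change (colX p).wF (tabOf w) = ((letX p).wF w).map tabOf
    induction w with
    | nil => rfl
    | cons a w ih =>
      refine (insertTab_spec p (decCol_tabOf w) a).2.2.trans ?_
      simp only [OneColour.tens, OneColour.word, ih, hep, OneColour.wF]
      split_ifs <;> simp only [Option.map_map] <;> rfl

theorem insertTab_perm (T : Tab) (a : ℕ+) : (insertTab T a).flatten.Perm (a :: T.flatten) := by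
  induction T generalizing a with
  | nil => simp [insertTab]
  | cons c T ih =>
    rw [insertTab_cons]
    rcases insertColumn_cases a c with h | ⟨l, b, r, rfl, h1, h2⟩
    · rw [insertColumn_of_lt h]
      simp only [insertOpt, List.flatten_cons, List.append_assoc, List.singleton_append]
      exact List.perm_middle
    · rw [insertColumn_append h1 h2]
      simp only [insertOpt, List.flatten_cons]
      refine ((ih b).append_left _).trans ?_
      simp only [List.append_assoc, List.cons_append]
      refine List.perm_middle.trans (List.Perm.cons a (List.Perm.append_left _ ?_))
      exact List.perm_middle

theorem tabOf_perm (w : List ℕ+) : (tabOf w).flatten.Perm w := by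
  induction w with
  | nil => simp [tabOf]
  | cons a w ih => exact (insertTab_perm _ _).trans (ih.cons a)

/-! ### Semistandardness -/

/-- The condition on adjacent columns of a semistandard tableau. -/
def ColLe (x y : List ℕ+) : Prop := y.length ≤ x.length ∧
    ∀ (p : ℕ) (hy : p < y.length) (hx : p < x.length), y[p] ≤ x[p]

theorem isSST_iff {T : Tab} : IsSST T ↔ (∀ c ∈ T, c ≠ [] ∧ DecCol c) ∧ T.IsChain ColLe := Iff.rfl

theorem colLe_nil (x : List ℕ+) : ColLe x [] := ⟨Nat.zero_le _, fun p hp => by simp at hp⟩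

theorem not_colLe_nil (b : ℕ+) (y : List ℕ+) : ¬ ColLe [] (b :: y) := fun h => by
  simpa using h.1

theorem colLe_cons {a b : ℕ+} {x y : List ℕ+} : ColLe (a :: x) (b :: y) ↔ b ≤ a ∧ ColLe x y := by
  constructor
  · rintro ⟨h1, h2⟩
    refine ⟨h2 0 (by simp) (by simp), by simpa using h1, fun p hy hx => ?_⟩
    exact h2 (p + 1) (by simpa using hy) (by simpa using hx)
  · rintro ⟨h1, h2, h3⟩
    refine ⟨by simpa using h2, fun p hy hx => ?_⟩
    cases p with
    | zero => exact h1
    | succ p => exact h3 p (by simpa using hy) (by simpa using hx)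

/-- Insertion only enlarges an entry or adds one on top. -/
theorem colLe_insertColumn_left {a : ℕ+} {c d : List ℕ+} (h : ColLe c d) :
    ColLe (insertColumn a c).1 d := by
  induction c generalizing d with
  | nil =>
    cases d with
    | nil => exact colLe_nil _
    | cons y d => exact absurd h (not_colLe_nil _ _)
  | cons x c ih =>
    cases d with
    | nil => exact colLe_nil _
    | cons y d =>
      rw [colLe_cons] at h
      rw [insertColumn]
      split_ifs with h1
      · exact colLe_cons.2 ⟨h.1.trans h1, h.2⟩
      · exact colLe_cons.2 ⟨h.1, ih h.2⟩

theorem insertColumn_some_le {a b : ℕ+} {c : List ℕ+} (hb : (insertColumn a c).2 = some b) :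
    b ≤ a := by
  induction c with
  | nil => cases hb
  | cons x c ih =>
    rw [insertColumn] at hb
    split_ifs at hb with h1
    · cases hb; exact h1
    · exact ih hb

/-- Bumping paths go weakly down: if `b` left height k of `c`, an entry of `d` at height k is `≤ b`,
so `b` settles at height k or lower. There the new `c` has entries `≥ a ≥ b`. -/
theorem colLe_insertColumn {a : ℕ+} {c d : List ℕ+} (h : ColLe c d) {b : ℕ+}
    (hb : (insertColumn a c).2 = some b) :
    ColLe (insertColumn a c).1 (insertColumn b d).1 := by
  induction c generalizing d with
  | nil => cases hb
  | cons x c ih =>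
    have hba := insertColumn_some_le hb
    rw [insertColumn] at hb ⊢
    split_ifs at hb ⊢ with h1
    · cases hb
      cases d with
      | nil => exact colLe_cons.2 ⟨h1, colLe_nil _⟩
      | cons y d =>
        rw [colLe_cons] at h
        rw [insertColumn, if_pos h.1]
        exact colLe_cons.2 ⟨h1, h.2⟩
    · have hbx := hba.trans (not_le.1 h1).le
      cases d with
      | nil => exact colLe_cons.2 ⟨hbx, colLe_nil _⟩
      | cons y d =>
        rw [colLe_cons] at h
        rw [insertColumn]
        split_ifs with h2
        · exact colLe_cons.2 ⟨hbx, colLe_insertColumn_left h.2⟩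
        · exact colLe_cons.2 ⟨h.1, ih h.2 hb⟩

theorem insertColumn_ne_nil (a : ℕ+) (c : List ℕ+) : (insertColumn a c).1 ≠ [] := by
  cases c with
  | nil => simp [insertColumn]
  | cons x c => rw [insertColumn]; split_ifs <;> simp

theorem isSST_insertTab {T : Tab} (hT : IsSST T) (a : ℕ+) : IsSST (insertTab T a) := by
  rw [isSST_iff] at hT ⊢
  refine ⟨fun c hc => ⟨?_, decCol_insertTab (fun c hc => (hT.1 c hc).2) a c hc⟩, ?_⟩
  · replace hT := fun c hc => (hT.1 c hc).1
    induction T generalizing a with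
    | nil => rw [insertTab, List.mem_singleton] at hc; subst hc; simp
    | cons d T ih =>
      rw [List.forall_mem_cons] at hT
      rw [insertTab_cons, List.mem_cons] at hc
      rcases hc with rfl | hc
      · exact insertColumn_ne_nil _ _
      · cases hd : (insertColumn a d).2 with
        | none => rw [hd] at hc; exact hT.2 c hc
        | some b => rw [hd] at hc; exact ih b hc hT.2
  · replace hT := hT.2
    induction T generalizing a with
    | nil => exact List.isChain_singleton _
    | cons c T ih =>
      rw [insertTab_cons]
      cases hd : (insertColumn a c).2 with
      | none =>
        cases T with
        | nil => exact List.isChain_singleton _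
        | cons d T =>
          rw [List.isChain_cons_cons] at hT
          exact List.isChain_cons_cons.2 ⟨colLe_insertColumn_left hT.1, hT.2⟩
      | some b =>
        cases T with
        | nil =>
          refine List.isChain_cons_cons.2 ⟨?_, List.isChain_singleton _⟩
          exact colLe_insertColumn (colLe_nil c) hd
        | cons d T =>
          rw [List.isChain_cons_cons] at hT
          have := ih b hT.2
          rw [insertOpt]
          rw [insertTab_cons] at this ⊢
          exact List.isChain_cons_cons.2 ⟨colLe_insertColumn hT.1 hd, this⟩

theorem isSST_tabOf (w : List ℕ+) : IsSST (tabOf w) := by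
  induction w with
  | nil => exact ⟨by simp [tabOf], List.isChain_nil⟩
  | cons a w ih => exact isSST_insertTab ih a

/-! ### Highest weight tableaux -/

/-- The column `1, …, n`. -/
def initialCol : ℕ → List ℕ+
  | 0 => []
  | n + 1 => n.succPNat :: initialCol n

theorem mem_initialCol {n : ℕ} {x : ℕ+} : x ∈ initialCol n ↔ (x : ℕ) ≤ n := by
  induction n with
  | zero => simp [initialCol]
  | succ n ih =>
    rw [initialCol, List.mem_cons, ih, ← PNat.coe_inj, Nat.succPNat_coe]
    omega

/-- Vanishing of all `ep` says that with `p + 1` the column contains `p`, so its entries form an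
initial segment. -/
theorem eq_initialCol {c : List ℕ+} (hc : DecCol c) (h : ∀ p, (colX p).ep c = 0) :
    c = initialCol c.length := by
  induction c with
  | nil => rfl
  | cons x c ih =>
    rw [DecCol, List.pairwise_cons] at hc
    have h' : ∀ p : ℕ+, p + 1 ∈ x :: c → p ∈ x :: c := by
      intro p hp
      by_contra hn
      have := h p
      simp only [colX] at this
      rw [if_pos ⟨hp, hn⟩] at this
      cases this
    have hx : ∀ p : ℕ+, p + 1 ∈ c → p ∈ c := by
      intro p hp
      rcases List.mem_cons.1 (h' p (List.mem_cons_of_mem _ hp)) with rfl | h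
      · exact absurd (hc.1 _ hp) (not_lt.2 (PNat.lt_add_right _ 1).le)
      · exact h
    have hi := ih hc.2 fun p => by
      simp only [colX]
      rw [if_neg]
      rintro ⟨h1, h2⟩
      exact h2 (hx p h1)
    rw [List.length_cons, initialCol, ← hi]
    congr 1
    rw [← PNat.coe_inj, Nat.succPNat_coe]
    have h1 : ¬ (x : ℕ) ≤ c.length := by
      rw [← mem_initialCol, ← hi]
      exact fun h => lt_irrefl _ (hc.1 x h)
    by_contra hne
    obtain ⟨y, hy⟩ : ∃ y : ℕ+, x = y + 1 := PNat.exists_eq_succ_of_ne_one fun h0 => by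
      rw [h0, PNat.one_coe] at h1 hne
      omega
    subst hy
    have h2 := h' y List.mem_cons_self
    rw [List.mem_cons] at h2
    rcases h2 with h2 | h2
    · exact pnat_ne_succ y h2
    · rw [hi, mem_initialCol] at h2
      rw [PNat.add_coe, PNat.one_coe] at h1 hne
      omega

/-- All columns of a highest weight tableau are of the form `1, …, n`. -/
theorem eq_initialCol_of_highest {T : Tab} (hT : IsSST T) (h : ∀ p, (colX p).wep T = 0) :
    T = (T.map List.length).map initialCol := by
  rw [isSST_iff] at hT
  obtain ⟨h1, h2⟩ := hT
  have h1' := fun c hc => (h1 c hc).2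
  clear h1
  induction T with
  | nil => rfl
  | cons c T ih =>
    rw [List.forall_mem_cons] at h1'
    have h3 : c = initialCol c.length := eq_initialCol h1'.1 fun p => by
      have := h p
      simp only [OneColour.wep] at this
      omega
    simp only [List.map_cons]
    rw [← h3, ← ih ?_ h2.tail h1'.2]
    intro p
    have h4 := h p
    simp only [OneColour.wep] at h4
    -- The first column is 1, …, n, so it can cancel something in `T` only for the colour p = n. But
    -- for this colour nothing is there to cancel: rowwise comparison bounds all entries of `T` by
    -- n.
    by_cases hp : (p : ℕ) = c.length
    · have hle : ∀ d ∈ T, ColLe c d := by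
        have ht : IsTrans (List ℕ+) ColLe := ⟨fun x y z hxy hyz =>
          ⟨hyz.1.trans hxy.1, fun q hz hx =>
            (hyz.2 q hz (hz.trans_le hyz.1)).trans (hxy.2 q _ hx)⟩⟩
        exact (List.pairwise_cons.1 (List.isChain_iff_pairwise.1 h2)).1
      have hno : ∀ d ∈ T, (colX p).ep d = 0 := by
        intro d hd
        simp only [colX]
        rw [if_neg]
        rintro ⟨h5, -⟩
        have h6 := hle d hd
        obtain ⟨q, hq, h7⟩ := List.getElem_of_mem h5
        have hq' := hq.trans_le h6.1
        have h8 := h6.2 q hq hq'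
        have h10 : ∀ x ∈ c, (x : ℕ) ≤ c.length := fun x hx => by
          rw [h3] at hx
          exact mem_initialCol.1 hx
        have h9 := h10 _ (List.getElem_mem hq')
        rw [h7, ← PNat.coe_le_coe, PNat.add_coe, PNat.one_coe] at h8
        omega
      clear * - hno
      induction T with
      | nil => rfl
      | cons d T ih =>
        rw [List.forall_mem_cons] at hno
        simp [OneColour.wep, ih hno.2, hno.1]
    · have h5 : (colX p).ph c = 0 := by
        simp only [colX]
        rw [if_neg]
        rw [h3, mem_initialCol, mem_initialCol, PNat.add_coe, PNat.one_coe]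
        omega
      omega

theorem highest_eq_of_length {S T : Tab} (hS : IsSST S) (hT : IsSST T)
    (h1 : ∀ p, (colX p).wep S = 0) (h2 : ∀ p, (colX p).wep T = 0)
    (h : S.map List.length = T.map List.length) : S = T := by
  rw [eq_initialCol_of_highest hS h1, eq_initialCol_of_highest hT h2, h]

/-- The content of a highest weight tableau is the partition conjugate to its list of column
lengths. -/
theorem count_initialCols (l : List ℕ) (x : ℕ+) :
    (l.map initialCol).flatten.count x = l.countP (fun n => (x : ℕ) ≤ n) := by
  have h : ∀ n, (initialCol n).count x = if (x : ℕ) ≤ n then 1 else 0 := by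
    intro n
    split_ifs with hx
    · refine List.count_eq_one_of_mem ?_ (mem_initialCol.2 hx)
      clear hx
      induction n with
      | zero => exact List.nodup_nil
      | succ n ih =>
        rw [initialCol, List.nodup_cons]
        refine ⟨fun h => ?_, ih⟩
        rw [mem_initialCol, Nat.succPNat_coe] at h
        omega
    · exact List.count_eq_zero.2 fun h' => hx (mem_initialCol.1 h')
  induction l with
  | nil => rfl
  | cons n l ih =>
    rw [List.map_cons, List.flatten_cons, List.count_append, ih, h, List.countP_cons, add_comm]
    simp

/-- A partition is determined by its conjugate: differences of consecutive counts are
multiplicities. Zero parts are invisible to the counts, hence the hypotheses excluding them. -/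
theorem eq_of_countP_eq {l m : List ℕ} (hl : l.Pairwise (fun a b => b ≤ a))
    (hm : m.Pairwise (fun a b => b ≤ a)) (hl0 : 0 ∉ l) (hm0 : 0 ∉ m)
    (h : ∀ x : ℕ+, l.countP (fun n => (x : ℕ) ≤ n) = m.countP (fun n => (x : ℕ) ≤ n)) : l = m := by
  have hc : ∀ (l : List ℕ) (n : ℕ), l.countP (fun k => n ≤ k) =
      l.count n + l.countP (fun k => n + 1 ≤ k) := by
    intro l n
    induction l with
    | nil => rfl
    | cons k l ih =>
      simp only [List.countP_cons, List.count_cons, ih, decide_eq_true_eq, beq_iff_eq]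
      split_ifs <;> omega
  refine List.Perm.eq_of_pairwise (fun a b _ _ h1 h2 => le_antisymm h2 h1) hl hm ?_
  rw [List.perm_iff_count]
  intro n
  rcases Nat.eq_zero_or_pos n with rfl | hn
  · rw [List.count_eq_zero.2 hl0, List.count_eq_zero.2 hm0]
  · have h1 : l.countP (fun k => n ≤ k) = m.countP (fun k => n ≤ k) := h ⟨n, hn⟩
    have h2 : l.countP (fun k => n + 1 ≤ k) = m.countP (fun k => n + 1 ≤ k) :=
      h ⟨n + 1, n.succ_pos⟩
    have h3 := hc l n
    have h4 := hc m n
    omega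

theorem IsSST.pairwise_length {T : Tab} (hT : IsSST T) :
    (T.map List.length).Pairwise (fun a b => b ≤ a) ∧ 0 ∉ T.map List.length := by
  rw [isSST_iff] at hT
  constructor
  · rw [List.pairwise_map]
    have ht : IsTrans (List ℕ+) (fun x y => y.length ≤ x.length) := ⟨fun x y z h1 h2 => h2.trans h1⟩
    exact List.isChain_iff_pairwise.1 (hT.2.imp fun _ _ h => h.1)
  · rw [List.mem_map]
    rintro ⟨c, hc, h⟩
    exact (hT.1 c hc).1 (List.length_eq_zero_iff.1 h)

/-- Content gives the shape by conjugation, and the shape gives the tableau. -/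
theorem highest_eq_of_perm {S T : Tab} (hS : IsSST S) (hT : IsSST T)
    (h1 : ∀ p, (colX p).wep S = 0) (h2 : ∀ p, (colX p).wep T = 0)
    (h : S.flatten.Perm T.flatten) : S = T := by
  refine highest_eq_of_length hS hT h1 h2 ?_
  refine eq_of_countP_eq hS.pairwise_length.1 hT.pairwise_length.1 hS.pairwise_length.2
    hT.pairwise_length.2 fun x => ?_
  rw [← count_initialCols, ← count_initialCols, ← eq_initialCol_of_highest hS h1,
    ← eq_initialCol_of_highest hT h2, h.count_eq]

/-! ### Biwords of matrices -/

/-- The order on biletters for which biwords in `Ω` are weakly increasing. -/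
def BiLe (x y : ℕ+ × ℕ+) : Prop := x.2 < y.2 ∨ (x.2 = y.2 ∧ y.1 ≤ x.1)

theorem BiLe.antisymm {x y : ℕ+ × ℕ+} (h1 : BiLe x y) (h2 : BiLe y x) : x = y := by
  rcases h1 with h1 | ⟨h1, h1'⟩ <;> rcases h2 with h2 | ⟨h2, h2'⟩
  · exact absurd h1 h2.asymm
  · exact absurd h1 (h2 ▸ lt_irrefl _)
  · exact absurd h2 (h1 ▸ lt_irrefl _)
  · exact Prod.ext (le_antisymm h2' h1') h1

instance : IsTrans (ℕ+ × ℕ+) BiLe := ⟨by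
  rintro x y z (h1 | ⟨h1, h1'⟩) (h2 | ⟨h2, h2'⟩)
  · exact Or.inl (h1.trans h2)
  · exact Or.inl (h2 ▸ h1)
  · exact Or.inl (h1 ▸ h2)
  · exact Or.inr ⟨h1.trans h2, h2'.trans h1'⟩⟩

/-- Antisymmetry of `BiLe` makes sorted lists unique, so identities of biwords reduce to sortedness
and multisets. -/
theorem eq_of_biLe {l m : List (ℕ+ × ℕ+)} (hl : l.Pairwise BiLe) (hm : m.Pairwise BiLe)
    (h : (l : Multiset (ℕ+ × ℕ+)) = m) : l = m :=
  List.Perm.eq_of_pairwise (fun _ _ _ _ h1 h2 => h1.antisymm h2) hl hm (Multiset.coe_eq_coe.1 h)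

theorem coe_biword (A : Mat) : (biword A : Multiset (ℕ+ × ℕ+)) = Finsupp.toMultiset A := by
  rw [biword, ← Multiset.map_coe, Multiset.sort_eq, Multiset.map_map]
  conv_rhs => rw [← Multiset.map_id (Finsupp.toMultiset A)]
  rfl

theorem pairwise_biword (A : Mat) : (biword A).Pairwise BiLe := by
  rw [biword, List.pairwise_map]
  refine (Multiset.pairwise_sort _ _).imp fun {a b} h => ?_
  rcases (Prod.Lex.le_iff (x := ofLex a) (y := ofLex b)).1 h with h | h
  · exact Or.inl h
  · exact Or.inr ⟨h.1, h.2⟩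

/-- The matrix of a list of biletters. -/
def toMat (l : List (ℕ+ × ℕ+)) : Mat := Multiset.toFinsupp (l : Multiset (ℕ+ × ℕ+))

theorem toMat_biword (A : Mat) : toMat (biword A) = A := by
  rw [toMat, coe_biword, Finsupp.toMultiset_toFinsupp]

theorem biword_toMat {l : List (ℕ+ × ℕ+)} (hl : l.Pairwise BiLe) : biword (toMat l) = l :=
  eq_of_biLe (pairwise_biword _) hl (by rw [coe_biword, toMat, Multiset.toFinsupp_toMultiset])

theorem ofBiword_map (l : List (ℕ+ × ℕ+)) :
    ofBiword (l.map Prod.fst) (l.map Prod.snd) = toMat l := by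
  rw [ofBiword, ← List.unzip_fst, ← List.unzip_snd, List.zip_unzip]
  rfl

/-- The transpose of a matrix. -/
def Mat.tr (A : Mat) : Mat := Finsupp.equivMapDomain (Equiv.prodComm ℕ+ ℕ+) A

theorem Mat.tr_apply (A : Mat) (i j : ℕ+) : Mat.tr A (i, j) = A (j, i) := rfl

theorem Mat.tr_tr (A : Mat) : Mat.tr (Mat.tr A) = A := by
  ext ⟨i, j⟩
  rfl

/-- Transposition exchanges the two biwords; every statement about columns of matrices is obtained
from rows in this way. -/
theorem biword'_eq (A : Mat) : biword' A = (biword (Mat.tr A)).map Prod.swap := by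
  have hc : (biword' A : Multiset (ℕ+ × ℕ+)) = Finsupp.toMultiset A := by
    rw [biword', ← Multiset.map_coe, Multiset.sort_eq, Multiset.map_map]
    conv_rhs => rw [← Multiset.map_id (Finsupp.toMultiset A)]
    rfl
  have hp : ((biword' A).map Prod.swap).Pairwise BiLe := by
    rw [biword', List.pairwise_map, List.pairwise_map]
    refine (Multiset.pairwise_sort _ _).imp fun {a b} h => ?_
    rcases (Prod.Lex.le_iff (x := ofLex a) (y := ofLex b)).1 h with h | h
    · exact Or.inl h
    · exact Or.inr ⟨h.1, h.2⟩
  have h : (biword' A).map Prod.swap = biword (Mat.tr A) := by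
    refine eq_of_biLe hp (pairwise_biword _) ?_
    rw [← Multiset.map_coe, hc, coe_biword, Mat.tr, Finsupp.equivMapDomain_eq_mapDomain,
      Finsupp.toMultiset_map]
    rfl
  rw [← h, List.map_map, Prod.swap_swap_eq, List.map_id]

theorem wordL_eq (A : Mat) : wordL A = wordI (Mat.tr A) := by
  rw [wordL, wordI, biword'_eq, List.map_map]; rfl

theorem wordK_eq (A : Mat) : wordK A = wordJ (Mat.tr A) := by
  rw [wordK, wordJ, biword'_eq, List.map_map]; rfl

/-! ### The crystal operators on matrices -/

/-- The crystal of biletters, with operators acting on the first entries. -/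
def biX (p : ℕ+) : OneColour (ℕ+ × ℕ+) where
  ep x := (letX p).ep x.1
  ph x := (letX p).ph x.1
  e x := ((letX p).e x.1).map (·, x.2)
  f x := ((letX p).f x.1).map (·, x.2)

theorem biX_law (p : ℕ+) : (biX p).Law := by
  have h := letX_law p
  refine ⟨?_, ?_, ?_, ?_⟩
  · rintro ⟨i, j⟩ ⟨k, l⟩
    simp only [biX, Option.map_eq_some_iff, Prod.mk.injEq]
    constructor
    · rintro ⟨a, h1, rfl, rfl⟩
      exact ⟨i, (h.f_iff_e _ _).1 h1, rfl, rfl⟩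
    · rintro ⟨a, h1, rfl, rfl⟩
      exact ⟨k, (h.f_iff_e _ _).2 h1, rfl, rfl⟩
  · rintro ⟨i, j⟩ ⟨k, l⟩ h1
    simp only [biX, Option.map_eq_some_iff, Prod.mk.injEq] at h1
    obtain ⟨a, h1, rfl, rfl⟩ := h1
    exact h.step _ _ h1
  · rintro ⟨i, j⟩
    simp only [biX, Option.map_eq_none_iff]
    exact h.f_none _
  · rintro ⟨i, j⟩
    simp only [biX, Option.map_eq_none_iff]
    exact h.e_none _

theorem biX_hom (p : ℕ+) : OneColour.IsHom (biX p) (letX p) Prod.fst := by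
  refine ⟨fun _ => rfl, fun _ => rfl, fun x => ?_⟩
  simp only [biX, Option.map_map]
  exact Option.map_id'.symm

theorem biX_ep (p : ℕ+) (x : ℕ+ × ℕ+) : (biX p).ep x = if x.1 = p + 1 then 1 else 0 := rfl

theorem biX_ph (p : ℕ+) (x : ℕ+ × ℕ+) : (biX p).ph x = if x.1 = p then 1 else 0 := rfl

theorem biX_f {p : ℕ+} {x y : ℕ+ × ℕ+} (h : (biX p).f x = some y) :
    x = (p, x.2) ∧ y = (p + 1, x.2) := by
  obtain ⟨i, j⟩ := x
  simp only [biX, letX] at h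
  split_ifs at h with h1
  · cases h; exact ⟨by rw [h1], rfl⟩
  · cases h

/-- Among equal second entries the first ones weakly decrease, so raising `p` could only clash with
a left neighbour `p`. The signature rule never passes over such a neighbour: this is the condition
`ph u = 0`. -/
theorem pairwise_of_wF {p : ℕ+} {l m : List (ℕ+ × ℕ+)} (h : (biX p).wF l = some m)
    (hl : l.Pairwise BiLe) : m.Pairwise BiLe := by
  rw [← List.isChain_iff_pairwise] at hl ⊢
  refine OneColour.isChain_of_wF ?_ ?_ ?_ h hl
  · rintro ⟨i, j⟩
    simp only [biX, letX]
    split_ifs with h1 h2 <;> simp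
    subst h1
    exact pnat_ne_succ _ h2
  · rintro ⟨i, j⟩ v v' huv hv hu
    obtain ⟨h1, rfl⟩ := biX_f hv
    rw [h1] at huv
    rcases huv with huv | ⟨huv, h2⟩
    · exact Or.inl huv
    · refine Or.inr ⟨huv, PNat.add_one_le_iff.2 (lt_of_le_of_ne h2 ?_)⟩
      rintro rfl
      simp [biX, letX] at hu
  · rintro u u' ⟨k, l⟩ huv hu
    obtain ⟨h1, rfl⟩ := biX_f hu
    rw [h1] at huv
    rcases huv with huv | ⟨huv, h2⟩
    · exact Or.inl huv
    · exact Or.inr ⟨huv, le_trans h2 (PNat.lt_add_right _ 1).le⟩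

theorem pairwise_of_wE {p : ℕ+} {l m : List (ℕ+ × ℕ+)} (h : (biX p).wE l = some m)
    (hl : l.Pairwise BiLe) : m.Pairwise BiLe := by
  rw [← List.isChain_iff_pairwise] at hl ⊢
  refine OneColour.isChain_of_wE ?_ (biX_law p) ?_ ?_ h hl
  · rintro ⟨i, j⟩
    simp only [biX, letX]
    split_ifs with h1 h2 <;> simp
    subst h1
    exact pnat_ne_succ _ h2
  · rintro u u' ⟨k, l⟩ huv hu hv
    obtain ⟨h1, h1'⟩ := biX_f (((biX_law p).f_iff_e _ _).2 hu)
    rw [h1'] at huv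
    rw [h1]
    rcases huv with huv | ⟨huv, h2⟩
    · exact Or.inl huv
    · refine Or.inr ⟨huv, PNat.lt_add_one_iff.1 (lt_of_le_of_ne h2 ?_)⟩
      rintro rfl
      simp [biX, letX] at hv
  · rintro ⟨i, j⟩ v v' huv hv
    obtain ⟨h1, h1'⟩ := biX_f (((biX_law p).f_iff_e _ _).2 hv)
    rw [h1'] at huv
    rw [h1]
    rcases huv with huv | ⟨huv, h2⟩
    · exact Or.inl huv
    · exact Or.inr ⟨huv, le_trans (PNat.lt_add_right _ 1).le h2⟩

/-- The operators on matrices moving an entry between the rows `p` and `p + 1`. -/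
def rowX (p : ℕ+) : OneColour Mat where
  ep A := (biX p).wep (biword A)
  ph A := (biX p).wph (biword A)
  e A := ((biX p).wE (biword A)).map toMat
  f A := ((biX p).wF (biword A)).map toMat

theorem rowX_f_iff {p : ℕ+} {A B : Mat} :
    (rowX p).f A = some B ↔ (biX p).wF (biword A) = some (biword B) := by
  simp only [rowX, Option.map_eq_some_iff]
  constructor
  · rintro ⟨l, h1, rfl⟩
    rw [h1, biword_toMat (pairwise_of_wF h1 (pairwise_biword A))]
  · exact fun h => ⟨_, h, toMat_biword B⟩

theorem rowX_e_iff {p : ℕ+} {A B : Mat} :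
    (rowX p).e A = some B ↔ (biX p).wE (biword A) = some (biword B) := by
  simp only [rowX, Option.map_eq_some_iff]
  constructor
  · rintro ⟨l, h1, rfl⟩
    rw [h1, biword_toMat (pairwise_of_wE h1 (pairwise_biword A))]
  · exact fun h => ⟨_, h, toMat_biword B⟩

theorem rowX_law (p : ℕ+) : (rowX p).Law := by
  have h := OneColour.word_law (biX_law p)
  refine ⟨fun A B => ?_, fun A B hA => ?_, fun A => ?_, fun A => ?_⟩
  · rw [rowX_f_iff, rowX_e_iff]; exact h.f_iff_e _ _
  · exact h.step _ _ (rowX_f_iff.1 hA)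
  · simp only [rowX, Option.map_eq_none_iff]; exact h.f_none _
  · simp only [rowX, Option.map_eq_none_iff]; exact h.e_none _

/-- The operators on matrices moving an entry between the columns `q` and `q + 1`. -/
def columnX (q : ℕ+) : OneColour Mat where
  ep A := (rowX q).ep (Mat.tr A)
  ph A := (rowX q).ph (Mat.tr A)
  e A := ((rowX q).e (Mat.tr A)).map Mat.tr
  f A := ((rowX q).f (Mat.tr A)).map Mat.tr

theorem columnX_f_iff {q : ℕ+} {A B : Mat} :
    (columnX q).f A = some B ↔ (rowX q).f (Mat.tr A) = some (Mat.tr B) := by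
  simp only [columnX, Option.map_eq_some_iff]
  constructor
  · rintro ⟨C, h, rfl⟩
    rw [h, Mat.tr_tr]
  · exact fun h => ⟨_, h, Mat.tr_tr B⟩

theorem columnX_e_iff {q : ℕ+} {A B : Mat} :
    (columnX q).e A = some B ↔ (rowX q).e (Mat.tr A) = some (Mat.tr B) := by
  simp only [columnX, Option.map_eq_some_iff]
  constructor
  · rintro ⟨C, h, rfl⟩
    rw [h, Mat.tr_tr]
  · exact fun h => ⟨_, h, Mat.tr_tr B⟩

theorem columnX_law (q : ℕ+) : (columnX q).Law := by
  have h := rowX_law q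
  refine ⟨fun A B => ?_, fun A B hA => ?_, fun A => ?_, fun A => ?_⟩
  · rw [columnX_f_iff, columnX_e_iff]; exact h.f_iff_e _ _
  · exact h.step _ _ (columnX_f_iff.1 hA)
  · simp only [columnX, Option.map_eq_none_iff]; exact h.f_none _
  · simp only [columnX, Option.map_eq_none_iff]; exact h.e_none _

theorem wordI_hom (p : ℕ+) : OneColour.IsHom (rowX p) (letX p).word wordI := by
  have h := (biX_hom p).map
  refine ⟨fun A => h.ep _, fun A => h.ph _, fun A => ?_⟩
  refine (h.f _).trans ?_
  cases hA : (rowX p).f A with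
  | none =>
    have : (biX p).wF (biword A) = none := by simpa [rowX] using hA
    simp [OneColour.word, this]
  | some B =>
    rw [rowX_f_iff] at hA
    simp [OneColour.word, hA, wordI]

theorem wordL_hom (p : ℕ+) : OneColour.IsHom (columnX p) (letX p).word wordL := by
  have h := wordI_hom p
  refine ⟨fun A => ?_, fun A => ?_, fun A => ?_⟩
  · rw [wordL_eq]; exact h.ep _
  · rw [wordL_eq]; exact h.ph _
  · rw [wordL_eq, h.f]
    simp only [columnX, Option.map_map]
    congr 1
    funext B
    simp [wordL_eq, Mat.tr_tr]

/-! ### The operators on rows and columns commute -/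

/-- The second entry of the biletter on which `f` acts. -/
def actsAt (p : ℕ+) : List (ℕ+ × ℕ+) → Option ℕ+
  | [] => none
  | b :: l => if (biX p).wep l < (biX p).ph b then some b.2 else actsAt p l

theorem actsAt_append (p : ℕ+) (l m : List (ℕ+ × ℕ+)) : actsAt p (l ++ m) =
    if (biX p).wep m < (biX p).wph l then actsAt p l else actsAt p m := by
  induction l with
  | nil => simp [OneColour.wph]
  | cons b l ih =>
    simp only [List.cons_append, actsAt, OneColour.wph, ih, OneColour.wep_append]
    by_cases h1 : (biX p).wep m < (biX p).wph l <;> by_cases h2 : (biX p).wep l < (biX p).ph b <;>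
      by_cases h3 : (biX p).wep l + ((biX p).wep m - (biX p).wph l) < (biX p).ph b <;>
      by_cases h4 : (biX p).wep m < (biX p).wph l + ((biX p).ph b - (biX p).wep l) <;>
      first | omega | (simp only [h1, h2, h3, h4, if_true, if_false])

/-- Describes `f` by the column of the matrix in which it moves a unit from row `p` to row `p + 1`.
A biletter is added on both sides to avoid subtraction. -/
theorem wF_spec (p : ℕ+) (l : List (ℕ+ × ℕ+)) :
    (actsAt p l = none → (biX p).wF l = none) ∧
    ∀ j, actsAt p l = some j → ∃ m, (biX p).wF l = some m ∧
      ((p + 1, j) :: l).Perm ((p, j) :: m) := by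
  induction l with
  | nil => simp [actsAt, OneColour.wF]
  | cons b l ih =>
    simp only [actsAt, OneColour.wF]
    split_ifs with h
    · refine ⟨fun h => h.elim, ?_⟩
      rintro j ⟨⟩
      obtain ⟨b', hb⟩ := (biX_law p).exists_f (x := b) (by omega)
      obtain ⟨h1, rfl⟩ := biX_f hb
      refine ⟨_, by rw [hb]; rfl, ?_⟩
      rw [← h1]
      exact List.Perm.swap _ _ _
    · refine ⟨fun h => by rw [ih.1 h]; rfl, fun j hj => ?_⟩
      obtain ⟨m, h1, h2⟩ := ih.2 j hj
      refine ⟨b :: m, by rw [h1]; rfl, ?_⟩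
      exact (List.Perm.swap _ _ _).trans ((h2.cons b).trans (List.Perm.swap _ _ _))

/-! ### Cutting a biword at two adjacent columns -/

theorem wep_wph_of_decreasing {p : ℕ+} {l : List (ℕ+ × ℕ+)} (h : l.Pairwise fun x y => y.1 ≤ x.1) :
    (biX p).wep l = l.countP (fun x => x.1 = p + 1) ∧
      (biX p).wph l = l.countP (fun x => x.1 = p) := by
  induction l with
  | nil => exact ⟨rfl, rfl⟩
  | cons b l ih =>
    rw [List.pairwise_cons] at h
    obtain ⟨h1, h2⟩ := ih h.2
    simp only [OneColour.wep, OneColour.wph, List.countP_cons, ← h1, ← h2, biX_ep, biX_ph,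
      decide_eq_true_eq]
    have hp := pnat_ne_succ p
    by_cases hb : b.1 = p
    · have h3 : (biX p).wep l = 0 := by
        rw [h1, List.countP_eq_zero]
        intro x hx h4
        have h5 := h.1 x hx
        rw [decide_eq_true_eq] at h4
        rw [hb, h4] at h5
        exact absurd h5 (not_le.2 (PNat.lt_add_right _ 1))
      simp [hb, hp, h3]
    · by_cases hb' : b.1 = p + 1 <;> (simp [hb, hb', hp.symm]; try omega)

theorem filter_append_filter_not {α : Type*} {P : α → Prop} [DecidablePred P] {l : List α}
    (h : l.Pairwise fun x y => P y → P x) :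
    l.filter (fun x => P x) ++ l.filter (fun x => ¬ P x) = l := by
  induction l with
  | nil => rfl
  | cons x l ih =>
    rw [List.pairwise_cons] at h
    by_cases hx : P x
    · simpa [hx] using ih h.2
    · have h1 : l.filter (fun x => P x) = [] := by
        rw [List.filter_eq_nil_iff]
        intro y hy hy'
        exact hx (h.1 y hy (by simpa using hy'))
      have h2 := ih h.2
      rw [h1, List.nil_append] at h2
      rw [List.filter_cons_of_neg (by simpa using hx), List.filter_cons_of_pos (by simpa using hx),
        h1, h2, List.nil_append]

/-- A column operator of colour `q` changes only the two middle blocks. The outer ones influence the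
row operators through their totals alone. -/
theorem biword_split (A : Mat) (q : ℕ+) : biword A = (biword A).filter (fun x => x.2 < q) ++
    ((biword A).filter (fun x => x.2 = q) ++ ((biword A).filter (fun x => x.2 = q + 1) ++
      (biword A).filter (fun x => q + 1 < x.2))) := by
  have key : ∀ (r : ℕ+) (l : List (ℕ+ × ℕ+)), l.Pairwise BiLe →
      l = l.filter (fun x => x.2 < r) ++ l.filter (fun x => ¬ x.2 < r) := by
    intro r l hl
    refine (filter_append_filter_not (hl.imp fun {x y} h h' => ?_)).symm
    rcases h with h | h
    · exact h.trans h'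
    · exact h.1 ▸ h'
  have hp := pairwise_biword A
  refine (key q _ hp).trans (congrArg _ ((key (q + 1) _ (hp.filter _)).trans (congrArg₂ _ ?_
    ((key (q + 1 + 1) _ ((hp.filter _).filter _)).trans (congrArg₂ _ ?_ ?_))))) <;>
  · simp only [List.filter_filter]
    refine List.filter_congr fun x _ => ?_
    rw [Bool.eq_iff_iff]
    simp only [Bool.and_eq_true, decide_eq_true_eq, ← PNat.coe_lt_coe, ← PNat.coe_inj,
      PNat.add_coe, PNat.one_coe]
    omega

theorem filter_biword_congr {A B : Mat} {P : ℕ+ × ℕ+ → Prop} [DecidablePred P]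
    (h : ∀ x, P x → A x = B x) :
    (biword A).filter (fun x => P x) = (biword B).filter (fun x => P x) := by
  refine eq_of_biLe ((pairwise_biword A).filter _) ((pairwise_biword B).filter _) ?_
  ext x
  rw [← Multiset.filter_coe, ← Multiset.filter_coe, coe_biword, coe_biword, Multiset.count_filter,
    Multiset.count_filter, Finsupp.count_toMultiset, Finsupp.count_toMultiset]
  split_ifs with hx
  · exact h x hx
  · rfl

theorem countP_column (A : Mat) (p q : ℕ+) :
    ((biword A).filter (fun x => x.2 = q)).countP (fun x => x.1 = p) = A (p, q) := by
  rw [List.countP_filter, ← Finsupp.count_toMultiset, ← coe_biword, Multiset.count,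
    Multiset.coe_countP]
  refine List.countP_congr fun x _ => ?_
  obtain ⟨i, j⟩ := x
  simp only [Bool.and_eq_true, decide_eq_true_eq, Prod.mk.injEq]
  constructor <;> rintro ⟨rfl, rfl⟩ <;> exact ⟨rfl, rfl⟩

theorem column_wep_wph (A : Mat) (p q : ℕ+) :
    (biX p).wep ((biword A).filter (fun x => x.2 = q)) = A (p + 1, q) ∧
    (biX p).wph ((biword A).filter (fun x => x.2 = q)) = A (p, q) := by
  rw [← countP_column, ← countP_column]
  refine wep_wph_of_decreasing ?_
  have h := (pairwise_biword A).filter (fun x => x.2 = q)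
  refine h.imp_of_mem fun {x y} hx hy hxy => ?_
  rcases hxy with h1 | h1
  · have h2 := (List.mem_filter.1 hx).2
    have h3 := (List.mem_filter.1 hy).2
    rw [decide_eq_true_eq] at h2 h3
    rw [h2, h3] at h1
    exact absurd h1 (lt_irrefl _)
  · exact h1.2

theorem actsAt_mem {p j : ℕ+} {l : List (ℕ+ × ℕ+)} (h : actsAt p l = some j) :
    (∃ x ∈ l, x.2 = j) ∧ 0 < (biX p).wph l := by
  induction l with
  | nil => cases h
  | cons b l ih =>
    rw [actsAt] at h
    rw [OneColour.wph]
    split_ifs at h with h1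
    · cases h
      exact ⟨⟨b, by simp, rfl⟩, by omega⟩
    · obtain ⟨⟨x, h2, h3⟩, h4⟩ := ih h
      exact ⟨⟨x, by simp [h2], h3⟩, by omega⟩

theorem actsAt_isSome {p : ℕ+} {l : List (ℕ+ × ℕ+)} (h : 0 < (biX p).wph l) :
    ∃ j, actsAt p l = some j := by
  cases hj : actsAt p l with
  | some j => exact ⟨j, rfl⟩
  | none =>
    have := ((OneColour.word_law (biX_law p)).f_none l).1 ((wF_spec p l).1 hj)
    change (biX p).wph l = 0 at this
    omega

theorem actsAt_column (A : Mat) (p q : ℕ+) (h : 0 < A (p, q)) :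
    actsAt p ((biword A).filter (fun x => x.2 = q)) = some q := by
  obtain ⟨j, hj⟩ := actsAt_isSome (p := p) (l := (biword A).filter (fun x => x.2 = q))
    (by rw [(column_wep_wph A p q).2]; exact h)
  obtain ⟨⟨x, h1, h2⟩, -⟩ := actsAt_mem hj
  have h3 := (List.mem_filter.1 h1).2
  rw [decide_eq_true_eq] at h3
  rw [hj, ← h2, h3]

/-- Which of four factors an operator acts on, the two middle ones having `φ = a, b` and
`ε = c, d`, the first one `φ = h` and the last one `ε = e`. -/
def factorIndex (h e a b c d : ℕ) : ℕ :=
  if c + (d - a) + (e - (b + (a - d))) < h then 0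
  else if d + (e - b) < a then 1 else if e < b then 2 else 3

/-- Within one column of the matrix nothing cancels, as first entries decrease. Hence the row
operator sees just the totals of the outer blocks and the four entries in rows `p`, `p + 1` and
columns `q`, `q + 1`. -/
theorem rowX_data (p q : ℕ+) (A : Mat) {l m : List (ℕ+ × ℕ+)}
    (hl : (biword A).filter (fun x => x.2 < q) = l)
    (hm : (biword A).filter (fun x => q + 1 < x.2) = m) :
    (rowX p).ep A = (biX p).wep l + ((A (p + 1, q) + (A (p + 1, q + 1) - A (p, q)) +
      ((biX p).wep m - (A (p, q + 1) + (A (p, q) - A (p + 1, q + 1))))) - (biX p).wph l) ∧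
    (rowX p).ph A = ((biX p).wph m + (A (p, q + 1) + (A (p, q) - A (p + 1, q + 1)) -
      (biX p).wep m)) + ((biX p).wph l - (A (p + 1, q) + (A (p + 1, q + 1) - A (p, q)) +
      ((biX p).wep m - (A (p, q + 1) + (A (p, q) - A (p + 1, q + 1)))))) ∧
    (∀ k, factorIndex ((biX p).wph l) ((biX p).wep m) (A (p, q)) (A (p, q + 1)) (A (p + 1, q))
        (A (p + 1, q + 1)) = k →
      (k = 0 ∧ actsAt p (biword A) = actsAt p l) ∨ (k = 1 ∧ actsAt p (biword A) = some q) ∨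
      (k = 2 ∧ actsAt p (biword A) = some (q + 1)) ∨
      (k = 3 ∧ actsAt p (biword A) = actsAt p m)) := by
  obtain ⟨h1, h2⟩ := column_wep_wph A p q
  obtain ⟨h3, h4⟩ := column_wep_wph A p (q + 1)
  have h5 := actsAt_column A p q
  have h6 := actsAt_column A p (q + 1)
  have hs := biword_split A q
  rw [hl, hm] at hs
  set u := (biword A).filter (fun x => x.2 = q)
  set v := (biword A).filter (fun x => x.2 = q + 1)
  simp only [rowX]
  rw [hs]
  simp only [OneColour.wep_append, OneColour.wph_append, actsAt_append, h1, h2, h3, h4]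
  refine ⟨by omega, by omega, ?_⟩
  rintro k rfl
  have h7 : A (p + 1, q) + (A (p + 1, q + 1) - A (p, q)) + ((biX p).wep m - (A (p, q + 1) +
      (A (p, q) - A (p + 1, q + 1)))) = A (p + 1, q) + (A (p + 1, q + 1) + ((biX p).wep m -
      A (p, q + 1)) - A (p, q)) := by omega
  rw [factorIndex, h7]
  split_ifs with g1 g2 g3
  · exact Or.inl ⟨rfl, rfl⟩
  · exact Or.inr (Or.inl ⟨rfl, h5 (by omega)⟩)
  · exact Or.inr (Or.inr (Or.inl ⟨rfl, h6 (by omega)⟩))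
  · exact Or.inr (Or.inr (Or.inr ⟨rfl, rfl⟩))

/-- The same choice with the two middle factors grouped first: their joint `ε` is `c + (d - a)` and
their joint `φ` is `b + (a - d)`. -/
theorem factorIndex_eq (h e a b c d : ℕ) : factorIndex h e a b c d =
    if c + (d - a) + (e - (b + (a - d))) < h then 0
    else if e < b + (a - d) then (if d + (e - b) < a then 1 else 2) else 3 := by
  unfold factorIndex
  split_ifs <;> omega

/-- If the transposed operator acts in the first row of the block, then `a > d` and a unit passes
from `a` to `b`; if in the second, then `a ≤ d` and a unit passes from `c` to `d`. Either way the
joint values stay. -/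
theorem middle_invariant {h e a b c d a1 b1 c1 d1 m : ℕ}
    (hm : factorIndex h e a c b d = m)
    (h1 : (m = 1 ∧ a1 + 1 = a ∧ b1 = b + 1 ∧ c1 = c ∧ d1 = d) ∨
      (m = 2 ∧ a1 = a ∧ b1 = b ∧ c1 + 1 = c ∧ d1 = d + 1) ∨
      (m ≠ 1 ∧ m ≠ 2 ∧ a1 = a ∧ b1 = b ∧ c1 = c ∧ d1 = d)) :
    c1 + (d1 - a1) = c + (d - a) ∧ b1 + (a1 - d1) = b + (a - d) := by
  rw [factorIndex_eq] at hm
  rcases h1 with h1 | h1 | h1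
  · split_ifs at hm <;> omega
  · split_ifs at hm <;> omega
  · obtain ⟨-, -, rfl, rfl, rfl, rfl⟩ := h1
    exact ⟨rfl, rfl⟩

set_option maxHeartbeats 1000000 in
-- The choice between outer blocks and middle depends on joint values only, which the other operator
-- preserves. When both act in the middle, their inner choices persist or switch together.
theorem factorIndex_comm {h e h' e' a b c d a1 b1 c1 d1 a2 b2 c2 d2 k m : ℕ}
    (hk : factorIndex h e a b c d = k) (hm : factorIndex h' e' a c b d = m)
    (h1 : (m = 1 ∧ a1 + 1 = a ∧ b1 = b + 1 ∧ c1 = c ∧ d1 = d) ∨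
      (m = 2 ∧ a1 = a ∧ b1 = b ∧ c1 + 1 = c ∧ d1 = d + 1) ∨
      (m ≠ 1 ∧ m ≠ 2 ∧ a1 = a ∧ b1 = b ∧ c1 = c ∧ d1 = d))
    (h2 : (k = 1 ∧ a2 + 1 = a ∧ b2 = b ∧ c2 = c + 1 ∧ d2 = d) ∨
      (k = 2 ∧ a2 = a ∧ b2 + 1 = b ∧ c2 = c ∧ d2 = d + 1) ∨
      (k ≠ 1 ∧ k ≠ 2 ∧ a2 = a ∧ b2 = b ∧ c2 = c ∧ d2 = d)) :
    (factorIndex h e a1 b1 c1 d1 = k ∧ factorIndex h' e' a2 c2 b2 d2 = m) ∨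
    (m = 1 ∧ factorIndex h' e' a2 c2 b2 d2 = 2 ∧ k = 1 ∧ factorIndex h e a1 b1 c1 d1 = 2) ∨
    (m = 2 ∧ factorIndex h' e' a2 c2 b2 d2 = 1 ∧ k = 2 ∧ factorIndex h e a1 b1 c1 d1 = 1) := by
  obtain ⟨i1, i2⟩ := middle_invariant hm h1
  obtain ⟨i3, i4⟩ := middle_invariant (c := b) (b := c) (c1 := b2) (b1 := c2) hk (by
    rcases h2 with ⟨h3, h4, h5, h6, h7⟩ | ⟨h3, h4, h5, h6, h7⟩ | ⟨h2, h3, h4, h5, h6, h7⟩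
    · exact Or.inl ⟨h3, h4, h6, h5, h7⟩
    · exact Or.inr (Or.inl ⟨h3, h4, h6, h5, h7⟩)
    · exact Or.inr (Or.inr ⟨h2, h3, h4, h6, h5, h7⟩))
  rw [factorIndex_eq] at hk hm ⊢
  rw [factorIndex_eq h' e', i1, i2, i3, i4]
  by_cases g1 : c + (d - a) + (e - (b + (a - d))) < h
  · simp only [g1, if_true] at hk ⊢
    subst hk
    obtain ⟨rfl, rfl, rfl, rfl⟩ : _ ∧ _ ∧ _ := by simpa using h2
    exact Or.inl ⟨rfl, hm⟩
  by_cases g2 : e < b + (a - d)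
  swap
  · simp only [g1, g2, if_false] at hk ⊢
    subst hk
    obtain ⟨rfl, rfl, rfl, rfl⟩ : _ ∧ _ ∧ _ := by simpa using h2
    exact Or.inl ⟨rfl, hm⟩
  by_cases g3 : b + (d - a) + (e' - (c + (a - d))) < h'
  · simp only [g3, if_true] at hm ⊢
    subst hm
    obtain ⟨rfl, rfl, rfl, rfl⟩ : _ ∧ _ ∧ _ := by simpa using h1
    exact Or.inl ⟨hk, rfl⟩
  by_cases g4 : e' < c + (a - d)
  swap
  · simp only [g3, g4, if_false] at hm ⊢
    subst hm
    obtain ⟨rfl, rfl, rfl, rfl⟩ : _ ∧ _ ∧ _ := by simpa using h1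
    exact Or.inl ⟨hk, rfl⟩
  simp only [g1, g2, g3, g4, if_true, if_false] at hk hm ⊢
  clear i1 i2 i3 i4 g1 g3
  split_ifs at hk hm with g5 g6 g6 <;> subst hk hm <;>
    simp only [true_and, false_and, OfNat.one_ne_ofNat, OfNat.ofNat_ne_one, ne_eq,
      not_true, not_false_iff, or_false, false_or] at h1 h2
  · obtain ⟨rfl, rfl, rfl, rfl⟩ := h1
    obtain ⟨h3, rfl, rfl, rfl⟩ := h2
    split_ifs <;> omega
  · obtain ⟨rfl, rfl, rfl, rfl⟩ := h1
    obtain ⟨h3, rfl, rfl, rfl⟩ := h2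
    split_ifs <;> omega
  · obtain ⟨rfl, rfl, rfl, rfl⟩ := h1
    obtain ⟨h3, rfl, rfl, rfl⟩ := h2
    split_ifs <;> omega
  · obtain ⟨rfl, rfl, rfl, rfl⟩ := h1
    obtain ⟨h3, rfl, rfl, rfl⟩ := h2
    split_ifs <;> omega

/-- `B` is obtained from `A` by moving an entry from `(p, j)` to `(p + 1, j)`. -/
def RowMove (p j : ℕ+) (A B : Mat) : Prop :=
  A + Finsupp.single (p + 1, j) 1 = B + Finsupp.single (p, j) 1

/-- `B` is obtained from `A` by moving an entry from `(i, q)` to `(i, q + 1)`. -/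
def ColMove (q i : ℕ+) (A B : Mat) : Prop :=
  A + Finsupp.single (i, q + 1) 1 = B + Finsupp.single (i, q) 1

theorem rowMove_tr {p j : ℕ+} {A B : Mat} : RowMove p j (Mat.tr A) (Mat.tr B) ↔ ColMove p j A B := by
  have h : ∀ C : Mat, ∀ x y : ℕ+, Mat.tr (C + Finsupp.single (y, x) 1) =
      Mat.tr C + Finsupp.single (x, y) 1 := by
    intro C x y
    ext ⟨a, b⟩
    simp only [Mat.tr_apply, Finsupp.add_apply, Finsupp.single_apply, Prod.mk.injEq, and_comm]
  rw [RowMove, ColMove, ← h, ← h]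
  constructor
  · intro h'
    rw [← Mat.tr_tr (A + _), h', Mat.tr_tr]
  · exact fun h' => by rw [h']

theorem toMat_cons (x : ℕ+ × ℕ+) (l : List (ℕ+ × ℕ+)) :
    toMat (x :: l) = toMat l + Finsupp.single x 1 := by
  rw [toMat, toMat, ← Multiset.cons_coe, ← Multiset.singleton_add, map_add, add_comm,
    Multiset.toFinsupp_singleton]

theorem rowX_f_iff_move {p : ℕ+} {A B : Mat} : (rowX p).f A = some B ↔
    ∃ j, actsAt p (biword A) = some j ∧ RowMove p j A B := by
  have key : ∀ j, actsAt p (biword A) = some j → ∃ C, (rowX p).f A = some C ∧ RowMove p j A C := by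
    intro j hj
    obtain ⟨m, h1, h2⟩ := (wF_spec p (biword A)).2 j hj
    refine ⟨toMat m, by simp [rowX, h1], ?_⟩
    have h3 : toMat ((p + 1, j) :: biword A) = toMat ((p, j) :: m) := by
      rw [toMat, toMat, Multiset.coe_eq_coe.2 h2]
    rwa [toMat_cons, toMat_cons, toMat_biword] at h3
  constructor
  · intro h
    cases hj : actsAt p (biword A) with
    | none =>
      have := (wF_spec p _).1 hj
      rw [rowX_f_iff, this] at h
      cases h
    | some j =>
      obtain ⟨C, h1, h2⟩ := key j hj
      rw [h] at h1
      cases h1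
      exact ⟨j, rfl, h2⟩
  · rintro ⟨j, hj, h⟩
    obtain ⟨C, h1, h2⟩ := key j hj
    rw [h1]
    rw [RowMove] at h h2
    rw [h] at h2
    rw [add_right_cancel h2]

theorem columnX_f_iff_move {q : ℕ+} {A B : Mat} : (columnX q).f A = some B ↔
    ∃ i, actsAt q (biword (Mat.tr A)) = some i ∧ ColMove q i A B := by
  rw [columnX_f_iff, rowX_f_iff_move]
  simp only [rowMove_tr]

theorem ColMove.apply {q i : ℕ+} {A B : Mat} (h : ColMove q i A B) (x y : ℕ+) :
    A (x, y) + (if i = x ∧ q + 1 = y then 1 else 0) = B (x, y) + if i = x ∧ q = y then 1 else 0 := by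
  have := DFunLike.congr_fun h (x, y)
  simpa only [Finsupp.add_apply, Finsupp.single_apply, Prod.mk.injEq] using this

theorem exists_of_index {p q j : ℕ+} {l m : List (ℕ+ × ℕ+)} {t : ℕ}
    (hl : ∀ x ∈ l, x.2 < q) (hm : ∀ x ∈ m, q + 1 < x.2) {o : Option ℕ+} (ho : o = some j)
    (h : (t = 0 ∧ o = actsAt p l) ∨ (t = 1 ∧ o = some q) ∨ (t = 2 ∧ o = some (q + 1)) ∨
      (t = 3 ∧ o = actsAt p m)) :
    (t = 1 ∧ j = q) ∨ (t = 2 ∧ j = q + 1) ∨ (t ≠ 1 ∧ t ≠ 2 ∧ j ≠ q ∧ j ≠ q + 1) := by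
  subst ho
  rcases h with ⟨h1, h2⟩ | ⟨h1, h2⟩ | ⟨h1, h2⟩ | ⟨h1, h2⟩
  · obtain ⟨⟨x, h3, rfl⟩, -⟩ := actsAt_mem h2.symm
    have h4 := hl x h3
    exact Or.inr (Or.inr ⟨by omega, by omega, h4.ne, (h4.trans (PNat.lt_add_right q 1)).ne⟩)
  · cases h2; exact Or.inl ⟨h1, rfl⟩
  · cases h2; exact Or.inr (Or.inl ⟨h1, rfl⟩)
  · obtain ⟨⟨x, h3, rfl⟩, -⟩ := actsAt_mem h2.symm
    have h4 := hm x h3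
    exact Or.inr (Or.inr ⟨by omega, by omega, ((PNat.lt_add_right q 1).trans h4).ne', h4.ne'⟩)

theorem outer_filter_eq {q i : ℕ+} {A B : Mat} (h : ColMove q i A B) :
    (biword A).filter (fun x => x.2 < q) = (biword B).filter (fun x => x.2 < q) ∧
    (biword A).filter (fun x => q + 1 < x.2) = (biword B).filter (fun x => q + 1 < x.2) := by
  have hq := PNat.lt_add_right q 1
  constructor <;>
  · refine filter_biword_congr fun x hx => ?_
    obtain ⟨x, y⟩ := x
    have h1 := h.apply x y
    have h2 : q ≠ y := by
      rintro rfl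
      first | exact lt_irrefl _ hx | exact lt_asymm hx hq
    have h3 : q + 1 ≠ y := by
      rintro rfl
      first | exact lt_irrefl _ hx | exact lt_asymm hx hq
    simpa [h2, h3] using h1

theorem ColMove.values {p q i : ℕ+} {A B : Mat} (h : ColMove q i A B) {m : ℕ}
    (hm : (m = 1 ∧ i = p) ∨ (m = 2 ∧ i = p + 1) ∨ (m ≠ 1 ∧ m ≠ 2 ∧ i ≠ p ∧ i ≠ p + 1)) :
    (m = 1 ∧ B (p, q) + 1 = A (p, q) ∧ B (p, q + 1) = A (p, q + 1) + 1 ∧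
      B (p + 1, q) = A (p + 1, q) ∧ B (p + 1, q + 1) = A (p + 1, q + 1)) ∨
    (m = 2 ∧ B (p, q) = A (p, q) ∧ B (p, q + 1) = A (p, q + 1) ∧
      B (p + 1, q) + 1 = A (p + 1, q) ∧ B (p + 1, q + 1) = A (p + 1, q + 1) + 1) ∨
    (m ≠ 1 ∧ m ≠ 2 ∧ B (p, q) = A (p, q) ∧ B (p, q + 1) = A (p, q + 1) ∧
      B (p + 1, q) = A (p + 1, q) ∧ B (p + 1, q + 1) = A (p + 1, q + 1)) := by
  have hp := pnat_ne_succ p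
  have hq := pnat_ne_succ q
  have h1 := h.apply p q
  have h2 := h.apply p (q + 1)
  have h3 := h.apply (p + 1) q
  have h4 := h.apply (p + 1) (q + 1)
  rcases hm with ⟨hm, rfl⟩ | ⟨hm, rfl⟩ | ⟨hm, hm', h5, h6⟩
  · simp only [hp, hq, hq.symm, true_and, false_and, and_true, and_false, if_true, if_false] at *
    omega
  · simp only [hp.symm, hq, hq.symm, true_and, false_and, and_true, and_false, if_true,
      if_false] at *
    omega
  · simp only [h5, h6, false_and, if_false] at *
    omega

theorem eq_of_index {p q : ℕ+} {l m : List (ℕ+ × ℕ+)} {t t' : ℕ} {o o' : Option ℕ+} (ht : t = t')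
    (h : (t = 0 ∧ o = actsAt p l) ∨ (t = 1 ∧ o = some q) ∨ (t = 2 ∧ o = some (q + 1)) ∨
      (t = 3 ∧ o = actsAt p m))
    (h' : (t' = 0 ∧ o' = actsAt p l) ∨ (t' = 1 ∧ o' = some q) ∨ (t' = 2 ∧ o' = some (q + 1)) ∨
      (t' = 3 ∧ o' = actsAt p m)) : o = o' := by
  subst ht
  rcases h with ⟨h1, rfl⟩ | ⟨h1, rfl⟩ | ⟨h1, rfl⟩ | ⟨h1, rfl⟩ <;>
    rcases h' with ⟨h2, rfl⟩ | ⟨h2, rfl⟩ | ⟨h2, rfl⟩ | ⟨h2, rfl⟩ <;> first | rfl | omega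

theorem mem_filter_lt {q : ℕ+} (L : List (ℕ+ × ℕ+)) :
    ∀ x ∈ L.filter (fun x => x.2 < q), x.2 < q :=
  fun x hx => by simpa using (List.mem_filter.1 hx).2

theorem mem_filter_gt {q : ℕ+} (L : List (ℕ+ × ℕ+)) :
    ∀ x ∈ L.filter (fun x => q < x.2), q < x.2 :=
  fun x hx => by simpa using (List.mem_filter.1 hx).2

/-- By `rowX_data` these numbers involve the outer blocks and the joint values of the middle, none
of which a column move alters. -/
theorem rowX_of_columnX {p q : ℕ+} {A A' : Mat} (hA' : (columnX q).f A = some A') :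
    (rowX p).ep A' = (rowX p).ep A ∧ (rowX p).ph A' = (rowX p).ph A := by
  obtain ⟨i, hi, him⟩ := columnX_f_iff_move.1 hA'
  obtain ⟨a1, a2⟩ := outer_filter_eq him
  obtain ⟨r1, r2, -⟩ := rowX_data p q A rfl rfl
  obtain ⟨r3, r4, -⟩ := rowX_data p q A' a1.symm a2.symm
  obtain ⟨-, -, c1⟩ := rowX_data q p (Mat.tr A) rfl rfl
  simp only [Mat.tr_apply] at c1
  have hm := exists_of_index (mem_filter_lt _) (mem_filter_gt _) hi (c1 _ rfl)
  obtain ⟨i1, i2⟩ := middle_invariant rfl (him.values hm)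
  rw [r1, r2, r3, r4, i1, i2]
  exact ⟨rfl, rfl⟩

theorem columnX_of_rowX {p q : ℕ+} {A A' : Mat} (hA' : (rowX p).f A = some A') :
    (columnX q).ep A' = (columnX q).ep A ∧ (columnX q).ph A' = (columnX q).ph A :=
  rowX_of_columnX (A := Mat.tr A) (A' := Mat.tr A') (columnX_f_iff.2 (by simpa only [Mat.tr_tr]))

theorem rowX_columnX_comm {p q : ℕ+} {A B A' : Mat} (hB : (rowX p).f A = some B)
    (hA' : (columnX q).f A = some A') :
    ∃ C, (columnX q).f B = some C ∧ (rowX p).f A' = some C := by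
  obtain ⟨C, hC⟩ : ∃ C, (columnX q).f B = some C := (columnX_law q).exists_f (by
    rw [(columnX_of_rowX hB).2]; exact (columnX_law q).ph_ne hA')
  obtain ⟨D, hD⟩ : ∃ D, (rowX p).f A' = some D := (rowX_law p).exists_f (by
    rw [(rowX_of_columnX hA').2]; exact (rowX_law p).ph_ne hB)
  refine ⟨C, hC, ?_⟩
  obtain ⟨j, hj, hjm⟩ := rowX_f_iff_move.1 hB
  obtain ⟨i, hi, him⟩ := columnX_f_iff_move.1 hA'
  obtain ⟨j', hj', hjm'⟩ := rowX_f_iff_move.1 hD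
  obtain ⟨i', hi', him'⟩ := columnX_f_iff_move.1 hC
  have hjt : ColMove p j (Mat.tr A) (Mat.tr B) := rowMove_tr.1 (by rwa [Mat.tr_tr, Mat.tr_tr])
  obtain ⟨a1, a2⟩ := outer_filter_eq him
  obtain ⟨b1, b2⟩ := outer_filter_eq hjt
  obtain ⟨-, -, r1⟩ := rowX_data p q A rfl rfl
  obtain ⟨-, -, r2⟩ := rowX_data p q A' a1.symm a2.symm
  obtain ⟨-, -, c1⟩ := rowX_data q p (Mat.tr A) rfl rfl
  obtain ⟨-, -, c2⟩ := rowX_data q p (Mat.tr B) b1.symm b2.symm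
  simp only [Mat.tr_apply] at c1 c2
  have hm := exists_of_index (mem_filter_lt _) (mem_filter_gt _) hi (c1 _ rfl)
  have hk := exists_of_index (mem_filter_lt _) (mem_filter_gt _) hj (r1 _ rfl)
  have hm' := exists_of_index (mem_filter_lt _) (mem_filter_gt _) hi' (c2 _ rfl)
  have hk' := exists_of_index (mem_filter_lt _) (mem_filter_gt _) hj' (r2 _ rfl)
  have v1 := him.values hm
  have v2 := hjt.values hk
  simp only [Mat.tr_apply] at v2
  have hCD : C = D := by
    -- Either each operator acts at the same place in both orders, or both places switch. In the
    -- second case both composites carry a unit from `(p, q)` to `(p + 1, q + 1)`, by different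
    -- routes.
    have main : (i' = i ∧ j' = j) ∨ (i = p ∧ i' = p + 1 ∧ j = q ∧ j' = q + 1) ∨
        (i = p + 1 ∧ i' = p ∧ j = q + 1 ∧ j' = q) := by
      have e1 := eq_of_index (o := some j) (o' := some j') (h := hj ▸ r1 _ rfl)
        (h' := hj' ▸ r2 _ rfl)
      have e2 := eq_of_index (o := some i) (o' := some i') (h := hi ▸ c1 _ rfl)
        (h' := hi' ▸ c2 _ rfl)
      rcases factorIndex_comm rfl rfl v1 (by
        rcases v2 with ⟨w, w1, w2, w3, w4⟩ | ⟨w, w1, w2, w3, w4⟩ | ⟨w, w0, w1, w2, w3, w4⟩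
        · exact Or.inl ⟨w, w1, w3, w2, w4⟩
        · exact Or.inr (Or.inl ⟨w, w1, w3, w2, w4⟩)
        · exact Or.inr (Or.inr ⟨w, w0, w1, w3, w2, w4⟩)) with h | h | h
      · have f1 := e1 h.1.symm
        have f2 := e2 h.2.symm
        simp only [Option.some_inj] at f1 f2
        exact Or.inl ⟨f2.symm, f1.symm⟩
      · rw [h.1] at hm
        rw [h.2.1] at hm'
        rw [h.2.2.1] at hk
        rw [h.2.2.2] at hk'
        simp at hm hm' hk hk'
        exact Or.inr (Or.inl ⟨hm, hm', hk, hk'⟩)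
      · rw [h.1] at hm
        rw [h.2.1] at hm'
        rw [h.2.2.1] at hk
        rw [h.2.2.2] at hk'
        simp at hm hm' hk hk'
        exact Or.inr (Or.inr ⟨hm, hm', hk, hk'⟩)
    ext x
    have x1 := DFunLike.congr_fun hjm x
    have x2 := DFunLike.congr_fun him x
    have x3 := DFunLike.congr_fun hjm' x
    have x4 := DFunLike.congr_fun him' x
    simp only [Finsupp.add_apply] at x1 x2 x3 x4
    rcases main with ⟨rfl, rfl⟩ | ⟨rfl, rfl, rfl, rfl⟩ | ⟨rfl, rfl, rfl, rfl⟩ <;> omega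
  rw [hCD, hD]

/-! ### The bijection `κ` -/

theorem OneColour.IsHom.comp {B₁ B₂ B₃ : Type*} {X : OneColour B₁} {Y : OneColour B₂}
    {Z : OneColour B₃} {g : B₂ → B₃} {h : B₁ → B₂} (hg : OneColour.IsHom Y Z g)
    (hh : OneColour.IsHom X Y h) : OneColour.IsHom X Z (fun b => g (h b)) := by
  refine ⟨fun b => (hg.ep _).trans (hh.ep _), fun b => (hg.ph _).trans (hh.ph _), fun b => ?_⟩
  rw [hg.f, hh.f, Option.map_map]
  rfl

/-- The first tableau of a matrix. -/
def pTab (A : Mat) : Tab := tabOf (wordI A)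

/-- The second tableau of a matrix. -/
def qTab (A : Mat) : Tab := tabOf (wordL A)

theorem kappa_eq (A : Mat) : kappa A = (pTab A, qTab A) := by
  rw [kappa, insertWord_reverse, insertWord_reverse]; rfl

theorem qTab_eq (A : Mat) : qTab A = pTab (Mat.tr A) := by rw [qTab, wordL_eq, pTab]

theorem pTab_eq (A : Mat) : pTab A = qTab (Mat.tr A) := by rw [qTab_eq, Mat.tr_tr]

theorem pTab_hom (p : ℕ+) : OneColour.IsHom (rowX p) (colX p).word pTab :=
  (tabOf_hom p).comp (wordI_hom p)

theorem qTab_hom (p : ℕ+) : OneColour.IsHom (columnX p) (colX p).word qTab :=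
  (tabOf_hom p).comp (wordL_hom p)

theorem pTab_f {p : ℕ+} {A B : Mat} (h : (rowX p).f A = some B) :
    (colX p).wF (pTab A) = some (pTab B) := by
  have := (pTab_hom p).f A
  rwa [h] at this

theorem qTab_f {p : ℕ+} {A B : Mat} (h : (columnX p).f A = some B) :
    (colX p).wF (qTab A) = some (qTab B) := by
  have := (qTab_hom p).f A
  rwa [h] at this

/-! ### Induction on degree: invariance, equal shapes, injectivity -/

/-- The sum of the entries of a matrix, weighted by their positions. -/
def deg (A : Mat) : ℕ := A.sum fun x a => a * ((x.1 : ℕ) + x.2)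

theorem deg_add_single (A : Mat) (x : ℕ+ × ℕ+) :
    deg (A + Finsupp.single x 1) = deg A + ((x.1 : ℕ) + x.2) := by
  rw [deg, Finsupp.sum_add_index' (by simp) (by intros; ring), Finsupp.sum_single_index (by simp),
    one_mul]
  rfl

theorem deg_rowX {p : ℕ+} {A B : Mat} (h : (rowX p).f A = some B) : deg B = deg A + 1 := by
  obtain ⟨j, -, hm⟩ := rowX_f_iff_move.1 h
  have := congrArg deg hm
  rw [deg_add_single, deg_add_single] at this
  simp only [PNat.add_coe, PNat.one_coe] at this
  omega

theorem deg_columnX {p : ℕ+} {A B : Mat} (h : (columnX p).f A = some B) : deg B = deg A + 1 := by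
  obtain ⟨j, -, hm⟩ := columnX_f_iff_move.1 h
  have := congrArg deg hm
  rw [deg_add_single, deg_add_single] at this
  simp only [PNat.add_coe, PNat.one_coe] at this
  omega

theorem coe_wordI (A : Mat) :
    (wordI A : Multiset ℕ+) = (Finsupp.toMultiset A).map Prod.fst := by
  rw [wordI, ← Multiset.map_coe, coe_biword]

theorem coe_wordJ (A : Mat) :
    (wordJ A : Multiset ℕ+) = (Finsupp.toMultiset A).map Prod.snd := by
  rw [wordJ, ← Multiset.map_coe, coe_biword]

theorem coe_wordL (A : Mat) :
    (wordL A : Multiset ℕ+) = (Finsupp.toMultiset A).map Prod.snd := by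
  rw [wordL_eq, coe_wordI, Mat.tr, Finsupp.equivMapDomain_eq_mapDomain, ← Finsupp.toMultiset_map,
    Multiset.map_map]
  rfl

theorem wordJ_rowX {p : ℕ+} {A B : Mat} (h : (rowX p).f A = some B) : wordJ B = wordJ A :=
  OneColour.map_of_wF (X := biX p) (fun x y hxy => by rw [(biX_f hxy).2]) (rowX_f_iff.1 h)

theorem wordL_perm_of_rowX {p : ℕ+} {A B : Mat} (h : (rowX p).f A = some B) :
    (wordL B).Perm (wordL A) := by
  rw [← Multiset.coe_eq_coe, coe_wordL, coe_wordL, ← coe_wordJ, ← coe_wordJ, wordJ_rowX h]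

/-- The operators on rows do not change the second tableau. -/
theorem qTab_rowX {p : ℕ+} {A B : Mat} (h : (rowX p).f A = some B) : qTab B = qTab A := by
  induction hn : deg A using Nat.strong_induction_on generalizing A B with
  | _ n ih =>
    subst hn
    -- Lower `A` by a column operator and complete the commuting square: both second tableaux are
    -- then the image under the same `f` of one tableau, by induction.
    by_cases hA : ∃ q, (columnX q).ep A ≠ 0
    · obtain ⟨q, hq⟩ := hA
      obtain ⟨A', hA'⟩ := (columnX_law q).exists_e hq
      have h1 := ((columnX_law q).f_iff_e _ _).2 hA'
      obtain ⟨B', hB'⟩ : ∃ B', (rowX p).f A' = some B' := (rowX_law p).exists_f (by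
        rw [← (rowX_of_columnX h1).2]; exact (rowX_law p).ph_ne h)
      obtain ⟨C, hC1, hC2⟩ := rowX_columnX_comm hB' h1
      rw [h] at hC2
      cases hC2
      have h2 := ih (deg A') (by have := deg_columnX h1; omega) hB' rfl
      have h3 := qTab_f hC1
      rw [h2, qTab_f h1] at h3
      exact (Option.some_inj.1 h3).symm
    -- At the bottom both second tableaux are highest weight tableaux, and the row move keeps the
    -- multiset of second entries.
    · push Not at hA
      refine highest_eq_of_perm (isSST_tabOf _) (isSST_tabOf _) (fun q => ?_) (fun q => ?_) ?_
      · exact ((qTab_hom q).ep B).trans ((columnX_of_rowX h).1.trans (hA q))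
      · exact ((qTab_hom q).ep A).trans (hA q)
      · exact (tabOf_perm _).trans ((wordL_perm_of_rowX h).trans (tabOf_perm _).symm)

/-- The operators on columns do not change the first tableau. -/
theorem pTab_columnX {p : ℕ+} {A B : Mat} (h : (columnX p).f A = some B) : pTab B = pTab A := by
  rw [pTab_eq, pTab_eq]
  exact qTab_rowX (columnX_f_iff.1 h)

theorem length_of_wF {p : ℕ+} {S T : Tab} (h : (colX p).wF S = some T) :
    T.map List.length = S.map List.length := by
  refine OneColour.map_of_wF (X := colX p) (fun c d hcd => ?_) h
  simp only [colX] at hcd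
  split_ifs at hcd
  cases hcd
  rw [List.length_map]

/-- A biletter `(p + 1, j)` must be cancelled by some `(p, r)` to its left, and sortedness forces `r
< j`. Induction on the row concludes. -/
theorem le_of_rowHighest {A : Mat} (h : ∀ p, (rowX p).ep A = 0) {i j : ℕ+} (hij : A (i, j) ≠ 0) :
    i ≤ j := by
  have hmem : ∀ x, x ∈ biword A ↔ A x ≠ 0 := by
    intro x
    rw [← Finsupp.count_toMultiset, ← coe_biword, Multiset.count_ne_zero, Multiset.mem_coe]
  induction i using PNat.recOn generalizing j with
  | one => exact one_le
  | succ p ih =>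
    obtain ⟨l, m, hlm⟩ := List.append_of_mem ((hmem _).2 hij)
    have h1 : (biX p).wep (biword A) = 0 := h p
    rw [hlm] at h1
    obtain ⟨x, hx, hx'⟩ := OneColour.exists_ph_of_wep_eq_zero h1 (by simp [biX_ep])
    obtain ⟨k, r⟩ := x
    have hk : k = p := by
      by_contra hk
      simp [biX_ph, hk] at hx'
    subst hk
    have hp := pairwise_biword A
    rw [hlm, List.pairwise_append] at hp
    have hr : r < j := by
      rcases hp.2.2 _ hx _ List.mem_cons_self with h2 | ⟨-, h2⟩
      · exact h2
      · exact absurd h2 (not_le.2 (PNat.lt_add_right _ 1))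
    have h3 := ih ((hmem (k, r)).1 (by rw [hlm]; simp [hx]))
    exact PNat.add_one_le_iff.2 (h3.trans_lt hr)

/-- The previous bound, used for the matrix and its transpose, leaves the diagonal only. -/
theorem eq_of_highest {A : Mat} (h : ∀ p, (rowX p).ep A = 0) (h' : ∀ p, (columnX p).ep A = 0)
    {i j : ℕ+} (hij : A (i, j) ≠ 0) : i = j :=
  le_antisymm (le_of_rowHighest h hij) (le_of_rowHighest (A := Mat.tr A) h' hij)

theorem eq_of_highest_of_mem {A : Mat} (h : ∀ p, (rowX p).ep A = 0)
    (h' : ∀ p, (columnX p).ep A = 0) : ∀ x ∈ Finsupp.toMultiset A, x.1 = x.2 := by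
  rintro ⟨i, j⟩ hx
  refine eq_of_highest h h' ?_
  rwa [← Finsupp.count_toMultiset, Multiset.count_ne_zero]

/-- Operators change one tableau at a time and preserve its shape, so one may descend to a matrix
killed by all `e`. That matrix is diagonal, and its two tableaux coincide, being of highest weight
with the same content. -/
theorem length_pTab (A : Mat) : (pTab A).map List.length = (qTab A).map List.length := by
  induction hn : deg A using Nat.strong_induction_on generalizing A with
  | _ n ih =>
    subst hn
    by_cases hA : ∃ q, (columnX q).ep A ≠ 0
    · obtain ⟨q, hq⟩ := hA
      obtain ⟨A', hA'⟩ := (columnX_law q).exists_e hq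
      have h1 := ((columnX_law q).f_iff_e _ _).2 hA'
      rw [pTab_columnX h1, length_of_wF (qTab_f h1)]
      exact ih _ (by have := deg_columnX h1; omega) _ rfl
    by_cases hA' : ∃ q, (rowX q).ep A ≠ 0
    · obtain ⟨q, hq⟩ := hA'
      obtain ⟨A', hA'⟩ := (rowX_law q).exists_e hq
      have h1 := ((rowX_law q).f_iff_e _ _).2 hA'
      rw [qTab_rowX h1, length_of_wF (pTab_f h1)]
      exact ih _ (by have := deg_rowX h1; omega) _ rfl
    push Not at hA hA'
    rw [highest_eq_of_perm (S := pTab A) (T := qTab A) (isSST_tabOf _) (isSST_tabOf _)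
      (fun q => ((pTab_hom q).ep A).trans (hA' q)) (fun q => ((qTab_hom q).ep A).trans (hA q))]
    refine (tabOf_perm _).trans (List.Perm.trans ?_ (tabOf_perm _).symm)
    rw [← Multiset.coe_eq_coe, coe_wordI, coe_wordL]
    exact Multiset.map_congr rfl (eq_of_highest_of_mem hA' hA)

/-- The tableaux know all `ε`, so two matrices with the same image can be lowered in parallel until
both are diagonal. -/
theorem kappa_injective : Function.Injective kappa := by
  intro A B h
  induction hn : deg A using Nat.strong_induction_on generalizing A B with
  | _ n ih =>
    subst hn
    have hk := h
    rw [kappa_eq, kappa_eq, Prod.mk.injEq] at h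
    obtain ⟨hP, hQ⟩ := h
    have hr : ∀ q, (rowX q).ep A = (rowX q).ep B := fun q => by
      rw [← (pTab_hom q).ep, hP, (pTab_hom q).ep]
    have hc : ∀ q, (columnX q).ep A = (columnX q).ep B := fun q => by
      rw [← (qTab_hom q).ep, hQ, (qTab_hom q).ep]
    by_cases hA : ∃ q, (columnX q).ep A ≠ 0
    · obtain ⟨q, hq⟩ := hA
      obtain ⟨A', hA'⟩ := (columnX_law q).exists_e hq
      obtain ⟨B', hB'⟩ := (columnX_law q).exists_e (hc q ▸ hq)
      have h1 := ((columnX_law q).f_iff_e _ _).2 hA'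
      have h2 := ((columnX_law q).f_iff_e _ _).2 hB'
      have h3 : A' = B' := by
        refine ih _ (by have := deg_columnX h1; omega) ?_ rfl
        rw [kappa_eq, kappa_eq, ← pTab_columnX h1, ← pTab_columnX h2, hP]
        congr 1
        have h4 := (qTab_hom q).e (columnX_law q) (OneColour.word_law (colX_law q)) A
        have h5 := (qTab_hom q).e (columnX_law q) (OneColour.word_law (colX_law q)) B
        rw [hQ, h5, hA', hB'] at h4
        exact (Option.some_inj.1 h4).symm
      subst h3
      rw [h1] at h2
      exact Option.some_inj.1 h2
    by_cases hA' : ∃ q, (rowX q).ep A ≠ 0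
    · obtain ⟨q, hq⟩ := hA'
      obtain ⟨A', hA'⟩ := (rowX_law q).exists_e hq
      obtain ⟨B', hB'⟩ := (rowX_law q).exists_e (hr q ▸ hq)
      have h1 := ((rowX_law q).f_iff_e _ _).2 hA'
      have h2 := ((rowX_law q).f_iff_e _ _).2 hB'
      have h3 : A' = B' := by
        refine ih _ (by have := deg_rowX h1; omega) ?_ rfl
        rw [kappa_eq, kappa_eq, ← qTab_rowX h1, ← qTab_rowX h2, hQ]
        congr 1
        have h4 := (pTab_hom q).e (rowX_law q) (OneColour.word_law (colX_law q)) A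
        have h5 := (pTab_hom q).e (rowX_law q) (OneColour.word_law (colX_law q)) B
        rw [hP, h5, hA', hB'] at h4
        exact (Option.some_inj.1 h4).symm
      subst h3
      rw [h1] at h2
      exact Option.some_inj.1 h2
    push Not at hA hA'
    -- A diagonal matrix is recovered from the content of its first tableau.
    have key : ∀ C : Mat, (∀ x ∈ Finsupp.toMultiset C, x.1 = x.2) →
        Finsupp.toMultiset C = ((pTab C).flatten : Multiset ℕ+).map fun i => (i, i) := by
      intro C hC
      rw [pTab, Multiset.coe_eq_coe.2 (tabOf_perm (wordI C)), coe_wordI, Multiset.map_map]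
      conv_lhs => rw [← Multiset.map_id (Finsupp.toMultiset C)]
      exact Multiset.map_congr rfl fun x hx => Prod.ext rfl (hC x hx).symm
    have h1 := key A (eq_of_highest_of_mem hA' hA)
    rw [hP, ← key B (eq_of_highest_of_mem (fun q => by rw [← hr, hA'])
      (fun q => by rw [← hc, hA]))] at h1
    rw [← Finsupp.toMultiset_toFinsupp A, h1, Finsupp.toMultiset_toFinsupp]

theorem kappa_mem (A : Mat) : kappa A ∈ bitableaux := by
  rw [kappa_eq]
  exact ⟨isSST_tabOf _, isSST_tabOf _, length_pTab A⟩

/-! ### Surjectivity -/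

theorem OneColour.sum_lt_of_wE {B : Type*} {X : OneColour B} {w : B → ℕ}
    (hw : ∀ b b', X.e b = some b' → w b' < w b) {l m : List B} (h : X.wE l = some m) :
    (m.map w).sum < (l.map w).sum := by
  induction l generalizing m with
  | nil => cases h
  | cons b l ih =>
    simp only [OneColour.wE] at h
    split_ifs at h with h1
    · obtain ⟨b', hb, rfl⟩ := Option.map_eq_some_iff.1 h
      simpa using hw _ _ hb
    · obtain ⟨l', hl, rfl⟩ := Option.map_eq_some_iff.1 h
      simpa using ih hl

/-- The sum of the entries of a column. -/
def colSum (c : List ℕ+) : ℕ := (c.map fun x : ℕ+ => (x : ℕ)).sum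

theorem colSum_lt {p : ℕ+} {c d : List ℕ+} (h : (colX p).e c = some d) : colSum d < colSum c := by
  simp only [colX] at h
  split_ifs at h with h1
  cases h
  rw [colSum, colSum, List.map_map]
  refine List.sum_lt_sum _ _ (fun x _ => ?_) ⟨p + 1, h1.1, ?_⟩
  · simp only [Function.comp_apply]
    split_ifs with hx
    · rw [hx, PNat.add_coe]; omega
    · exact le_rfl
  · simp

theorem isSST_of_wE {p : ℕ+} {S T : Tab} (h : (colX p).wE S = some T) (hS : IsSST S) :
    IsSST T := by
  rw [isSST_iff] at hS ⊢
  have hne : ∀ c ∈ T, c ≠ [] := OneColour.mem_of_wE (fun c d hcd hc => by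
    simp only [colX] at hcd
    split_ifs at hcd
    cases hcd
    simpa using hc) h (fun c hc => (hS.1 c hc).1)
  have hdec : ∀ c ∈ T, DecCol c := OneColour.mem_of_wE (fun c d => decCol_of_e) h
    (fun c hc => (hS.1 c hc).2)
  refine ⟨fun c hc => ⟨hne c hc, hdec c hc⟩, ?_⟩
  have hch : S.IsChain (fun u v => DecCol u ∧ DecCol v ∧ ColLe u v) := by
    refine (List.IsChain.imp_of_mem_imp ?_ hS.2)
    exact fun u v hu hv huv => ⟨(hS.1 u hu).2, (hS.1 v hv).2, huv⟩
  refine (OneColour.isChain_of_wE ?_ (colX_law p) ?_ ?_ h hch).imp fun u v huv => huv.2.2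
  · intro v
    simp only [colX]
    split_ifs <;> simp_all
  · rintro u u' v ⟨hu, hv, huv⟩ he hep
    refine ⟨decCol_of_e he hu, hv, ?_⟩
    have hep' : ¬ (p + 1 ∈ v ∧ p ∉ v) := fun h' => by simp [colX, h'] at hep
    simp only [colX] at he
    split_ifs at he with h1
    cases he
    refine ⟨by simpa using huv.1, fun k hk hk' => ?_⟩
    rw [List.length_map] at hk'
    have h2 := huv.2 k hk hk'
    rw [List.getElem_map]
    split_ifs with h3
    · rw [h3] at h2
      -- The danger is a `p + 1` of `v` in the row where `u` loses its own. As `ep v = 0`, `v` then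
      -- has a `p` higher up, at height `m`; squeezed between it and `p + 1`, the entry of `u` there
      -- is `p`, which `u` does not contain.
      refine PNat.lt_add_one_iff.1 (lt_of_le_of_ne h2 fun h4 => hep' ⟨h4 ▸ List.getElem_mem hk, ?_⟩)
      intro hpv
      obtain ⟨m, hm, hm'⟩ := List.getElem_of_mem hpv
      have hkm : k < m := by
        by_contra hkm
        rcases eq_or_lt_of_le (not_lt.1 hkm) with rfl | hlt
        · rw [hm'] at h4; exact pnat_ne_succ p h4
        · have := List.pairwise_iff_getElem.1 hv m k hm hk hlt
          rw [hm', h4] at this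
          exact absurd this (PNat.lt_add_right p 1).asymm
      have hm2 : m < u.length := hm.trans_le huv.1
      have h5 := huv.2 m hm hm2
      have h6 := List.pairwise_iff_getElem.1 hu k m hk' hm2 hkm
      rw [hm'] at h5
      rw [h3] at h6
      exact h1.2 (le_antisymm h5 (PNat.lt_add_one_iff.1 h6) ▸ List.getElem_mem hm2)
    · exact h2
  · rintro u v v' ⟨hu, hv, huv⟩ he
    refine ⟨hu, decCol_of_e he hv, ?_⟩
    simp only [colX] at he
    split_ifs at he with h1
    cases he
    refine ⟨by simpa using huv.1, fun k hk hk' => ?_⟩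
    rw [List.length_map] at hk
    have h2 := huv.2 k hk hk'
    rw [List.getElem_map]
    split_ifs with h3
    · exact le_trans (by rw [h3]; exact (PNat.lt_add_right p 1).le) h2
    · exact h2

theorem length_of_wE {p : ℕ+} {S T : Tab} (h : (colX p).wE S = some T) :
    T.map List.length = S.map List.length :=
  (length_of_wF ((OneColour.word_law (colX_law p)).f_iff_e _ _ |>.2 h)).symm

theorem wep_eq_zero {B : Type*} {X : OneColour B} {l : List B} (h : ∀ b ∈ l, X.ep b = 0) :
    X.wep l = 0 := by
  induction l with
  | nil => rfl
  | cons b l ih =>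
    rw [List.forall_mem_cons] at h
    simp [OneColour.wep, h.1, ih h.2]

/-- The diagonal matrix of a multiset. -/
def diagMat (s : Multiset ℕ+) : Mat := Multiset.toFinsupp (s.map fun i => (i, i))

theorem diagMat_apply (s : Multiset ℕ+) (i j : ℕ+) :
    diagMat s (i, j) = if i = j then s.count i else 0 := by
  rw [diagMat, Multiset.toFinsupp_apply]
  split_ifs with h
  · subst h
    exact Multiset.count_map_eq_count' (fun i => (i, i)) s (fun a b h => congrArg Prod.fst h) i
  · rw [Multiset.count_eq_zero, Multiset.mem_map]
    rintro ⟨k, -, hk⟩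
    cases hk
    exact h rfl

theorem tr_diagMat (s : Multiset ℕ+) : Mat.tr (diagMat s) = diagMat s := by
  ext ⟨i, j⟩
  rw [Mat.tr_apply, diagMat_apply, diagMat_apply]
  by_cases h : i = j
  · subst h; rfl
  · rw [if_neg h, if_neg (Ne.symm h)]

/-- The multiplicities in a highest weight tableau weakly decrease, which makes the diagonal matrix
row-highest. Its first tableau is then the highest weight tableau of the given content. -/
theorem pTab_diagMat {S : Tab} (hS : IsSST S) (h : ∀ p, (colX p).wep S = 0) :
    pTab (diagMat S.flatten) = S := by
  refine highest_eq_of_perm (isSST_tabOf _) hS (fun p => ((pTab_hom p).ep _).trans ?_) h ?_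
  · have hmem : ∀ x ∈ biword (diagMat S.flatten), x.1 = x.2 := by
      rintro ⟨i, j⟩ hx
      by_contra hij
      have := diagMat_apply S.flatten i j
      rw [if_neg hij, ← Finsupp.count_toMultiset, ← coe_biword, Multiset.count_eq_zero] at this
      exact this hx
    -- Cutting along the diagonal, with `q = p`: the outer blocks contain no first entry `p + 1`, so
    -- only the two diagonal multiplicities are compared.
    have h1 := (rowX_data p p (diagMat S.flatten) rfl rfl).1
    have h2 : (biX p).wep ((biword (diagMat S.flatten)).filter (fun x => x.2 < p)) = 0 := by
      refine wep_eq_zero fun x hx => ?_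
      obtain ⟨hx1, hx2⟩ := List.mem_filter.1 hx
      rw [decide_eq_true_eq, ← hmem x hx1] at hx2
      rw [biX_ep, if_neg]
      rintro hx3
      rw [hx3] at hx2
      exact absurd hx2 (PNat.lt_add_right p 1).asymm
    have h3 : (biX p).wep ((biword (diagMat S.flatten)).filter (fun x => p + 1 < x.2)) = 0 := by
      refine wep_eq_zero fun x hx => ?_
      obtain ⟨hx1, hx2⟩ := List.mem_filter.1 hx
      rw [decide_eq_true_eq, ← hmem x hx1] at hx2
      rw [biX_ep, if_neg hx2.ne']
    have h4 : S.flatten.count (p + 1) ≤ S.flatten.count p := by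
      rw [eq_initialCol_of_highest hS h, count_initialCols, count_initialCols]
      refine List.countP_mono_left fun n _ hn => ?_
      rw [decide_eq_true_eq] at hn ⊢
      rw [PNat.add_coe] at hn
      omega
    rw [h1, h2, h3, diagMat_apply, diagMat_apply, diagMat_apply, diagMat_apply,
      if_neg (pnat_ne_succ p).symm, if_pos rfl, if_pos rfl, if_neg (pnat_ne_succ p),
      Multiset.coe_count, Multiset.coe_count]
    omega
  · refine (tabOf_perm _).trans ?_
    rw [← Multiset.coe_eq_coe, coe_wordI, diagMat, Multiset.toFinsupp_toMultiset, Multiset.map_map]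
    exact Multiset.map_id _

/-- Lower both tableaux to highest weight; being of equal shape they become equal, and a diagonal
matrix maps to them. On the way back each `f` on a tableau lifts to the matrix, because `ph` agrees
and the other tableau is unaffected. -/
theorem exists_kappa {S T : Tab} (h : (S, T) ∈ bitableaux) : ∃ A, kappa A = (S, T) := by
  induction hn : (S.map colSum).sum + (T.map colSum).sum using Nat.strong_induction_on
    generalizing S T with
  | _ n ih =>
    subst hn
    obtain ⟨hS, hT, hST⟩ := h
    dsimp only at hS hT hST
    by_cases hA : ∃ q, (colX q).wep S ≠ 0
    · obtain ⟨q, hq⟩ := hA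
      obtain ⟨S', hS'⟩ := (OneColour.word_law (colX_law q)).exists_e hq
      obtain ⟨A, hA⟩ := ih _ (by
        have := OneColour.sum_lt_of_wE (fun c d => colSum_lt) hS'
        exact Nat.add_lt_add_right this _)
        (S := S') (T := T) ⟨isSST_of_wE hS' hS, hT, (length_of_wE hS').trans hST⟩ rfl
      have h1 := (OneColour.word_law (colX_law q)).f_iff_e _ _ |>.2 hS'
      rw [kappa_eq, Prod.mk.injEq] at hA
      obtain ⟨B, hB⟩ : ∃ B, (rowX q).f A = some B := (rowX_law q).exists_f (by
        rw [← (pTab_hom q).ph, hA.1]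
        exact (OneColour.word_law (colX_law q)).ph_ne h1)
      refine ⟨B, ?_⟩
      rw [kappa_eq, qTab_rowX hB, hA.2]
      have h2 := pTab_f hB
      rw [hA.1] at h2
      rw [← Option.some_inj.1 (h2.symm.trans h1)]
    by_cases hA' : ∃ q, (colX q).wep T ≠ 0
    · obtain ⟨q, hq⟩ := hA'
      obtain ⟨T', hT'⟩ := (OneColour.word_law (colX_law q)).exists_e hq
      obtain ⟨A, hA⟩ := ih _ (by
        have := OneColour.sum_lt_of_wE (fun c d => colSum_lt) hT'
        exact Nat.add_lt_add_left this _)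
        (S := S) (T := T') ⟨hS, isSST_of_wE hT' hT, hST.trans (length_of_wE hT').symm⟩ rfl
      have h1 := (OneColour.word_law (colX_law q)).f_iff_e _ _ |>.2 hT'
      rw [kappa_eq, Prod.mk.injEq] at hA
      obtain ⟨B, hB⟩ : ∃ B, (columnX q).f A = some B := (columnX_law q).exists_f (by
        rw [← (qTab_hom q).ph, hA.2]
        exact (OneColour.word_law (colX_law q)).ph_ne h1)
      refine ⟨B, ?_⟩
      rw [kappa_eq, pTab_columnX hB, hA.1]
      have h2 := qTab_f hB
      rw [hA.2] at h2
      rw [← Option.some_inj.1 (h2.symm.trans h1)]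
    push Not at hA hA'
    obtain rfl := highest_eq_of_length hS hT hA hA' hST
    refine ⟨diagMat S.flatten, ?_⟩
    rw [kappa_eq, qTab_eq, tr_diagMat, pTab_diagMat hS hA]

theorem kappa_bijOn : Set.BijOn kappa Set.univ bitableaux := by
  refine ⟨fun A _ => kappa_mem A, kappa_injective.injOn, ?_⟩
  rintro ⟨S, T⟩ h
  obtain ⟨A, hA⟩ := exists_kappa h
  exact ⟨A, trivial, hA⟩

/-! ### The colour zero -/

/-- The `k`th column from the right, empty if there is none. -/
def colAt (T : Tab) (k : ℕ) : List ℕ+ := T.getD k []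

theorem colAt_tail (T : Tab) (k : ℕ) : colAt T.tail k = colAt T (k + 1) := by
  cases T <;> rfl

theorem colAt_insertTab_zero (T : Tab) (a : ℕ+) :
    colAt (insertTab T a) 0 = (insertColumn a (colAt T 0)).1 := by
  cases T with
  | nil => rfl
  | cons c T => rw [insertTab_cons]; rfl

theorem colAt_insertTab_succ (T : Tab) (a : ℕ+) (k : ℕ) :
    colAt (insertTab T a) (k + 1) = colAt (insertOpt T.tail (insertColumn a (colAt T 0)).2) k := by
  cases T with
  | nil => rfl
  | cons c T => rw [insertTab_cons]; rfl

/-- Successive insertion of letters into a column; the second component is the word of the letters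
which are replaced. -/
def insertLetters : List ℕ+ → List ℕ+ → List ℕ+ × List ℕ+
  | [], c => (c, [])
  | a :: x, c => ((insertLetters x (insertColumn a c).1).1,
      (insertColumn a c).2.toList ++ (insertLetters x (insertColumn a c).1).2)

/-- A word may be inserted column by column: all of it passes through the right-most column before
the bumped letters meet the next. -/
theorem foldl_insertTab_cons (x c : List ℕ+) (T : Tab) : x.foldl insertTab (c :: T) =
    (insertLetters x c).1 :: (insertLetters x c).2.foldl insertTab T := by
  induction x generalizing c T with
  | nil => rfl
  | cons a x ih =>
    rw [List.foldl_cons, insertTab_cons, ih, insertLetters, List.foldl_append]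
    cases (insertColumn a c).2 <;> rfl

theorem foldl_insertTab_nil {x : List ℕ+} (hx : x ≠ []) :
    x.foldl insertTab [] = x.foldl insertTab [[]] := by
  cases x with
  | nil => exact absurd rfl hx
  | cons a x => rfl

theorem colAt_foldl_zero (x : List ℕ+) (T : Tab) :
    colAt (x.foldl insertTab T) 0 = (insertLetters x (colAt T 0)).1 := by
  cases T with
  | cons c T => rw [foldl_insertTab_cons]; rfl
  | nil =>
    by_cases hx : x = []
    · subst hx; rfl
    · rw [foldl_insertTab_nil hx, foldl_insertTab_cons]; rfl

theorem colAt_foldl_succ (x : List ℕ+) (T : Tab) (k : ℕ) : colAt (x.foldl insertTab T) (k + 1) =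
    colAt ((insertLetters x (colAt T 0)).2.foldl insertTab T.tail) k := by
  cases T with
  | cons c T => rw [foldl_insertTab_cons]; rfl
  | nil =>
    by_cases hx : x = []
    · subst hx; rfl
    · rw [foldl_insertTab_nil hx, foldl_insertTab_cons]; rfl

theorem decCol_insertLetters (x : List ℕ+) {c : List ℕ+} (hc : DecCol c) :
    DecCol (insertLetters x c).1 := by
  induction x generalizing c with
  | nil => exact hc
  | cons a x ih => exact ih (decCol_insertColumn a hc)

theorem insertColumn_count (a b : ℕ+) (c : List ℕ+) :
    (insertColumn a c).1.count b + (insertColumn a c).2.toList.count b =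
      c.count b + [a].count b := by
  rcases insertColumn_cases a c with h | ⟨l, d, r, rfl, h1, h2⟩
  · rw [insertColumn_of_lt h]; simp
  · rw [insertColumn_append h1 h2]
    simp only [List.count_append, List.count_cons, List.count_nil, Option.toList_some]
    omega

theorem insertLetters_count (b : ℕ+) (x c : List ℕ+) :
    (insertLetters x c).1.count b + (insertLetters x c).2.count b = c.count b + x.count b := by
  induction x generalizing c with
  | nil => simp [insertLetters]
  | cons a x ih =>
    have h1 := ih (insertColumn a c).1
    have h2 := insertColumn_count a b c
    rw [List.count_singleton] at h2
    simp only [insertLetters, List.count_append, List.count_cons]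
    omega

/-- If a column has a letter `≤ a`, then inserting `a` replaces a letter. -/
theorem insertColumn_of_exists {a b : ℕ+} {c : List ℕ+} (hc : DecCol c) (hb : b ∈ c) (hba : b ≤ a) :
    ∃ d, b ≤ d ∧ (insertColumn a c).2 = some d ∧ a ∈ (insertColumn a c).1 ∧
      (insertColumn a c).1.length = c.length ∧
      ∀ c', insertColumn a (c ++ c') = ((insertColumn a c).1 ++ c', some d) := by
  rcases insertColumn_cases a c with h | ⟨l, d, r, rfl, h1, h2⟩
  · exact absurd (h b hb) (not_lt.2 hba)
  · refine ⟨d, ?_, ?_⟩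
    · simp only [List.mem_append, List.mem_cons] at hb
      rcases hb with hb | hb | hb
      · exact absurd (h1 b hb) (not_lt.2 hba)
      · exact hb.le
      · exact ((decCol_append_iff.1 hc).2.2.2.1 b hb).le
    · rw [insertColumn_append h1 h2]
      refine ⟨rfl, by simp, by simp, fun c' => ?_⟩
      rw [List.append_assoc, List.cons_append, insertColumn_append h1 h2]
      simp

/-- Each inserted letter serves as the entry `≤` the next one, so every insertion replaces
something. Hence the height is constant, the replaced letters increase, and whatever lies on top,
`c'`, is never reached. -/
theorem insertLetters_of_exists {b : ℕ+} {x c : List ℕ+} (hc : DecCol c) (hb : b ∈ c)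
    (hx : x.Pairwise (· ≤ ·)) (hbx : ∀ a ∈ x, b ≤ a) :
    (insertLetters x c).1.length = c.length ∧ (∀ y ∈ (insertLetters x c).2, b ≤ y) ∧
      (insertLetters x c).2.Pairwise (· ≤ ·) ∧
      ∀ c', insertLetters x (c ++ c') = ((insertLetters x c).1 ++ c', (insertLetters x c).2) := by
  induction x generalizing b c with
  | nil => exact ⟨rfl, by simp [insertLetters], List.Pairwise.nil, fun c' => rfl⟩
  | cons a x ih =>
    rw [List.pairwise_cons] at hx
    rw [List.forall_mem_cons] at hbx
    obtain ⟨d, h1, h2, h3, h4, h5⟩ := insertColumn_of_exists hc hb hbx.1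
    obtain ⟨i1, i2, i3, i4⟩ := ih (decCol_insertColumn a hc) h3 hx.2 hx.1
    have hda : d ≤ a := insertColumn_some_le h2
    simp only [insertLetters, h2, Option.toList_some, List.singleton_append]
    refine ⟨i1.trans h4, ?_, ?_, fun c' => ?_⟩
    · rw [List.forall_mem_cons]
      exact ⟨h1, fun y hy => hbx.1.trans (i2 y hy)⟩
    · rw [List.pairwise_cons]
      exact ⟨fun y hy => hda.trans (i2 y hy), i3⟩
    · rw [h5]
      dsimp only
      rw [i4]
      simp

/-- Only the first letter can fail to replace an entry; once inserted, it provides an entry for all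
the others. -/
theorem insertLetters_sorted {x c : List ℕ+} (hc : DecCol c) (hx : x.Pairwise (· ≤ ·)) :
    (insertLetters x c).2.Pairwise (· ≤ ·) := by
  cases x with
  | nil => exact List.Pairwise.nil
  | cons a x =>
    by_cases h : ∃ b ∈ c, b ≤ a
    · obtain ⟨b, hb, hba⟩ := h
      refine (insertLetters_of_exists hc hb hx ?_).2.2.1
      rw [List.forall_mem_cons]
      exact ⟨hba, fun y hy => hba.trans ((List.pairwise_cons.1 hx).1 y hy)⟩
    · push Not at h
      have h1 := decCol_insertColumn a hc
      rw [insertColumn_of_lt h] at h1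
      simp only [insertLetters, insertColumn_of_lt h, Option.toList_none, List.nil_append]
      exact (insertLetters_of_exists h1 (b := a) (by simp) (List.pairwise_cons.1 hx).2
        (List.pairwise_cons.1 hx).1).2.2.1

theorem DecCol.count_one {c : List ℕ+} (hc : DecCol c) (b : ℕ+) :
    c.count b = if b ∈ c then 1 else 0 := by
  split_ifs with h
  · exact List.count_eq_one_of_mem (hc.imp fun h => h.ne') h
  · exact List.count_eq_zero.2 h

theorem insertColumn_one_of_mem {c : List ℕ+} (hc : DecCol c) (h : 1 ∈ c) :
    insertColumn 1 c = (c, some 1) := by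
  obtain ⟨l, r, rfl⟩ := List.append_of_mem h
  exact insertColumn_append (decCol_append_iff.1 hc).2.2.1 le_rfl

theorem insertColumn_one_of_notMem {c : List ℕ+} (h : 1 ∉ c) :
    insertColumn 1 c = (c ++ [1], none) :=
  insertColumn_of_lt fun _ hy => lt_of_le_of_ne one_le fun h' => h (h' ▸ hy)

/-- The effect of one more letter `1` on the insertion of a word into a column. -/
theorem insertLetters_one {x c : List ℕ+} (hc : DecCol c) (hx : x.Pairwise (· ≤ ·)) :
    ((insertLetters x c).1.length = c.length ∧ 1 ∉ (insertLetters x c).1 ∧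
      x.count 1 = 0 ∧ (insertLetters x c).2.count 1 = 0 ∧
      insertLetters (1 :: x) c = ((insertLetters x c).1 ++ [1], (insertLetters x c).2)) ∨
    (((insertLetters x c).1.length = c.length ∨ (insertLetters x c).1.length = c.length + 1) ∧
      x.count 1 + (if (insertLetters x c).1.length = c.length then 1 else 0) =
        (insertLetters x c).2.count 1 + (if 1 ∈ (insertLetters x c).1 then 1 else 0) ∧
      insertLetters (1 :: x) c = ((insertLetters x c).1, 1 :: (insertLetters x c).2)) := by
  have hcount := insertLetters_count 1 x c
  rw [(decCol_insertLetters x hc).count_one, hc.count_one] at hcount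
  by_cases h1 : 1 ∈ c
  · right
    have h2 := (insertLetters_of_exists hc h1 hx fun _ _ => one_le).1
    refine ⟨Or.inl h2, ?_, ?_⟩
    · rw [if_pos h2]
      rw [if_pos h1] at hcount
      omega
    · simp [insertLetters, insertColumn_one_of_mem hc h1]
  rw [if_neg h1] at hcount
  have hc1 : DecCol (c ++ [1]) := by
    have := decCol_insertColumn 1 hc
    rwa [insertColumn_one_of_notMem h1] at this
  have h1' : ∀ y ∈ c, 1 < y := fun _ hy => lt_of_le_of_ne one_le fun h' => h1 (h' ▸ hy)
  cases x with
  | nil =>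
    left
    simp [insertLetters, insertColumn_one_of_notMem h1, h1]
  | cons a x =>
    have hx' := List.pairwise_cons.1 hx
    by_cases ha : a = 1
    · subst ha
      right
      have h2 := (insertLetters_of_exists hc1 (b := 1) (by simp) hx'.2 fun _ _ => one_le).1
      have h3 : insertLetters (1 :: x) c = insertLetters x (c ++ [1]) := by
        simp [insertLetters, insertColumn_one_of_notMem h1]
      have h4 : (insertLetters (1 :: x) c).1.length = c.length + 1 := by
        rw [h3, h2]; simp
      refine ⟨Or.inr h4, ?_, ?_⟩
      · rw [if_neg (by omega)]
        omega
      · rw [insertLetters, insertColumn_one_of_notMem h1]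
        simp only [Option.toList_none, List.nil_append]
        rw [insertLetters, insertColumn_one_of_mem hc1 (by simp), h3]
        simp
    · have ha1 : 1 < a := lt_of_le_of_ne (one_le) (Ne.symm ha)
      have hx1 : (a :: x).count 1 = 0 := by
        rw [List.count_eq_zero]
        intro h
        rcases List.mem_cons.1 h with h | h
        · exact ha h.symm
        · exact absurd (hx'.1 1 h) (not_le.2 ha1)
      rw [hx1] at hcount
      have hs : 1 ∉ (insertLetters (a :: x) c).1 := by
        intro h
        rw [if_pos h] at hcount
        omega
      by_cases h : ∃ b ∈ c, b ≤ a
      · left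
        obtain ⟨b, hb, hba⟩ := h
        obtain ⟨k1, -, -, k2⟩ := insertLetters_of_exists hc hb hx (by
          rw [List.forall_mem_cons]
          exact ⟨hba, fun y hy => hba.trans (hx'.1 y hy)⟩)
        refine ⟨k1, hs, hx1, by omega, ?_⟩
        rw [← k2, insertLetters, insertColumn_one_of_notMem h1]
        simp
      -- Without the extra letter, `a` would go on top. With a `1` on top, `a` replaces it: the
      -- column is the same and the `1` moves on.
      · right
        push Not at h
        have h2 := decCol_insertColumn a hc
        rw [insertColumn_of_lt h] at h2
        have h3 : insertLetters (a :: x) c = insertLetters x (c ++ [a]) := by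
          simp [insertLetters, insertColumn_of_lt h]
        have h4 : (insertLetters (a :: x) c).1.length = c.length + 1 := by
          rw [h3, (insertLetters_of_exists h2 (b := a) (by simp) hx'.2 hx'.1).1]
          simp
        refine ⟨Or.inr h4, ?_, ?_⟩
        · rw [if_neg (by omega), if_neg hs]
          omega
        · rw [insertLetters, insertColumn_one_of_notMem h1]
          simp only [Option.toList_none, List.nil_append]
          rw [insertLetters, insertColumn_append h ha1.le, h3]
          simp

/-- The crystal of pairs of columns for the colour zero. -/
def zeroX : OneColour (List ℕ+ × List ℕ+) where
  ep c := if 1 ∈ c.1 ∧ 1 ∈ c.2 then 1 else 0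
  ph c := if 1 ∉ c.1 ∧ 1 ∉ c.2 then 1 else 0
  e c := if 1 ∈ c.1 ∧ 1 ∈ c.2 then some (c.1.dropLast, c.2.dropLast) else none
  f c := if 1 ∉ c.1 ∧ 1 ∉ c.2 then some (c.1 ++ [1], c.2 ++ [1]) else none

/-- A `1` in a second column records that the first column has grown during the insertion of `x`.
Followed from right to left, an extra `1` passes through columns by `insertLetters_one` until one
retains it; this is the factor chosen by the signature rule. -/
theorem zeroX_spec (l : List (List ℕ+ × List ℕ+)) {C : Tab} (hC : ∀ k, DecCol (colAt C k))
    {x : List ℕ+} (hx : x.Pairwise (· ≤ ·))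
    (h1 : ∀ k, colAt (l.map Prod.fst) k = colAt (x.foldl insertTab C) k)
    (h2 : ∀ k, 1 ∈ colAt (l.map Prod.snd) k ↔
      (colAt (l.map Prod.fst) k).length = (colAt C k).length + 1) :
    zeroX.wep l = x.count 1 ∧ ∀ l', zeroX.wF l = some l' →
      ∀ k, colAt (l'.map Prod.fst) k = colAt ((1 :: x).foldl insertTab C) k := by
  induction l generalizing C x with
  | nil =>
    have hx0 : x = [] := by
      cases x with
      | nil => rfl
      | cons a x =>
        have h3 := h1 0
        rw [List.foldl_cons] at h3
        have h4 : ∀ (x : List ℕ+) (c : List ℕ+), c ≠ [] → (insertLetters x c).1 ≠ [] := by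
          intro x
          induction x with
          | nil => exact fun c hc => hc
          | cons a x ih => exact fun c _ => ih _ (insertColumn_ne_nil a c)
        rw [colAt_foldl_zero, colAt_insertTab_zero] at h3
        exact absurd h3.symm (h4 _ _ (insertColumn_ne_nil _ _))
    subst hx0
    exact ⟨rfl, fun l' h => by cases h⟩
  | cons b l ih =>
    obtain ⟨s, r⟩ := b
    have hs : s = (insertLetters x (colAt C 0)).1 := by
      have := h1 0
      rwa [colAt_foldl_zero] at this
    have hr : 1 ∈ r ↔ s.length = (colAt C 0).length + 1 := h2 0
    obtain ⟨i1, i2⟩ := ih (C := C.tail) (fun k => by rw [colAt_tail]; exact hC _)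
      (insertLetters_sorted (hC 0) hx)
      (fun k => by rw [← colAt_foldl_succ, ← h1]; rfl)
      (fun k => by rw [colAt_tail]; exact h2 (k + 1))
    have hcase := insertLetters_one (hC 0) hx
    rw [← hs] at hcase
    rw [OneColour.wep, i1]
    rcases hcase with ⟨g1, g2, g3, g4, g5⟩ | ⟨g1, g2, g3⟩
    · have hr' : 1 ∉ r := by rw [hr]; omega
      refine ⟨by simp [zeroX, g2, hr', g3, g4], ?_⟩
      intro l' hl' k
      have hl2 : zeroX.wep l < zeroX.ph (s, r) := by rw [i1, g4]; simp [zeroX, g2, hr']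
      have hf : zeroX.f (s, r) = some (s ++ [1], r ++ [1]) := by simp [zeroX, g2, hr']
      rw [OneColour.wF, if_pos hl2, hf] at hl'
      cases hl'
      cases k with
      | zero => rw [colAt_foldl_zero, g5]; rfl
      | succ k =>
        rw [colAt_foldl_succ, g5]
        dsimp only
        rw [← colAt_foldl_succ, ← h1]; rfl
    -- The extra `1` passes on. The balance of ones in `g2` reproduces the recursion for `wep`; if
    -- both columns lack a `1`, it shows that some `1` was passed on, which cancels the factor.
    · have key : zeroX.ep (s, r) + ((insertLetters x (colAt C 0)).2.count 1 - zeroX.ph (s, r)) =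
          x.count 1 ∧ ¬ (insertLetters x (colAt C 0)).2.count 1 < zeroX.ph (s, r) := by
        by_cases hs1 : 1 ∈ s <;> by_cases hr1 : 1 ∈ r <;>
          simp only [hs1, hr1, zeroX, if_true, if_false, not_true, not_false_iff, and_true,
            and_false, and_self, true_iff, false_iff] at g2 hr ⊢ <;>
          split_ifs at g2 <;> omega
      refine ⟨key.1, fun l' hl' k => ?_⟩
      rw [OneColour.wF, i1, if_neg key.2] at hl'
      obtain ⟨l'', hl'', rfl⟩ := Option.map_eq_some_iff.1 hl'
      cases k with
      | zero => rw [colAt_foldl_zero, g3]; rfl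
      | succ k => rw [colAt_foldl_succ, g3]; exact i2 _ hl'' _

/-! ### Deleting the smallest letter -/

/-- The letters of a word different from `1`. -/
def noOne (w : List ℕ+) : List ℕ+ := w.filter (fun x => x ≠ 1)

theorem mem_noOne {w : List ℕ+} {x : ℕ+} : x ∈ noOne w ↔ x ∈ w ∧ x ≠ 1 := by
  simp [noOne]

theorem noOne_append (v w : List ℕ+) : noOne (v ++ w) = noOne v ++ noOne w := List.filter_append _ _

theorem noOne_cons_of_ne {a : ℕ+} (h : a ≠ 1) (w : List ℕ+) : noOne (a :: w) = a :: noOne w := by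
  simp [noOne, h]

theorem noOne_cons_one (w : List ℕ+) : noOne (1 :: w) = noOne w := by
  simp [noOne]

theorem DecCol.length_eq {c : List ℕ+} (hc : DecCol c) :
    c.length = (noOne c).length + if 1 ∈ c then 1 else 0 := by
  rw [← hc.count_one, noOne, ← List.countP_eq_length_filter, List.count,
    List.length_eq_countP_add_countP (fun x => decide (x ≠ 1))]
  congr 1
  refine List.countP_congr fun x _ => ?_
  simp

/-- The length tells whether a `1` is present. -/
theorem DecCol.ext_noOne {c d : List ℕ+} (hc : DecCol c) (hd : DecCol d) (h : noOne c = noOne d)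
    (hl : c.length = d.length) : c = d := by
  have h1 : 1 ∈ c ↔ 1 ∈ d := by
    rw [hc.length_eq, hd.length_eq, h] at hl
    by_cases h1 : 1 ∈ c <;> by_cases h2 : 1 ∈ d <;> simp [h1, h2] at hl ⊢
  refine hc.ext hd fun x => ?_
  by_cases hx : x = 1
  · rw [hx, h1]
  · have h2 : x ∈ noOne c ↔ x ∈ noOne d := by rw [h]
    simpa [mem_noOne, hx] using h2

/-- A `1` can only be the top entry, so bumping it turns, after deletion of ones, into adding `a` on
top with nothing bumped. -/
theorem noOne_insertColumn {a : ℕ+} {c : List ℕ+} (hc : DecCol c) (ha : a ≠ 1) :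
    insertColumn a (noOne c) =
      (noOne (insertColumn a c).1, (insertColumn a c).2.filter (fun x => x ≠ 1)) := by
  rcases insertColumn_cases a c with h | ⟨l, b, r, rfl, h1, h2⟩
  · rw [insertColumn_of_lt h, insertColumn_of_lt fun y hy => h y (mem_noOne.1 hy).1, noOne_append,
      noOne_cons_of_ne ha]
    rfl
  · rw [insertColumn_append h1 h2, noOne_append, noOne_append, noOne_cons_of_ne ha]
    have h1' : ∀ y ∈ noOne l, a < y := fun y hy => h1 y (mem_noOne.1 hy).1
    by_cases hb : b = 1
    · subst hb
      obtain rfl : r = [] := List.eq_nil_iff_forall_not_mem.2 fun y hy =>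
        not_lt_one ((decCol_append_iff.1 hc).2.2.2.1 y hy)
      rw [noOne_cons_one]
      rw [show noOne [] = [] from rfl, List.append_nil, insertColumn_of_lt h1']
      simp [Option.filter]
    · rw [noOne_cons_of_ne hb, insertColumn_append h1' h2]
      simp [Option.filter, hb]

theorem noOne_insertColumn_one {c : List ℕ+} (hc : DecCol c) :
    noOne (insertColumn 1 c).1 = noOne c ∧
      (insertColumn 1 c).2.filter (fun x => x ≠ 1) = none := by
  by_cases h : 1 ∈ c
  · rw [insertColumn_one_of_mem hc h]
    simp [Option.filter]
  · rw [insertColumn_one_of_notMem h, noOne_append, noOne_cons_one]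
    simp [noOne]

theorem noOne_insertOpt (k : ℕ) {T T' : Tab} (hT : ∀ k, DecCol (colAt T k))
    (h : ∀ k, noOne (colAt T k) = colAt T' k) (o : Option ℕ+) :
    noOne (colAt (insertOpt T o) k) = colAt (insertOpt T' (o.filter (fun x => x ≠ 1))) k := by
  induction k generalizing T T' o with
  | zero =>
    cases o with
    | none => exact h 0
    | some a =>
      by_cases ha : a = 1
      · subst ha
        simp only [insertOpt, Option.filter, ne_eq, not_true, decide_false, Bool.false_eq_true,
          if_false]
        rw [colAt_insertTab_zero, (noOne_insertColumn_one (hT 0)).1, h]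
      · simp only [insertOpt, Option.filter, ne_eq, ha, not_false_eq_true, decide_true, if_true]
        rw [colAt_insertTab_zero, colAt_insertTab_zero, ← h, noOne_insertColumn (hT 0) ha]
  | succ k ih =>
    cases o with
    | none => exact h (k + 1)
    | some a =>
      have ih' := fun o => ih (T := T.tail) (T' := T'.tail) (fun k => by rw [colAt_tail]; exact hT _)
        (fun k => by rw [colAt_tail, colAt_tail]; exact h _) o
      by_cases ha : a = 1
      · subst ha
        simp only [insertOpt, Option.filter, ne_eq, not_true, decide_false, Bool.false_eq_true,
          if_false]
        rw [colAt_insertTab_succ, ih', (noOne_insertColumn_one (hT 0)).2, ← colAt_tail]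
        rfl
      · simp only [insertOpt, Option.filter, ne_eq, ha, not_false_eq_true, decide_true, if_true]
        rw [colAt_insertTab_succ, colAt_insertTab_succ, ← h, noOne_insertColumn (hT 0) ha, ih']

theorem colAt_mem {T : Tab} {P : List ℕ+ → Prop} (h0 : P []) (h : ∀ c ∈ T, P c) (k : ℕ) :
    P (colAt T k) := by
  rw [colAt, List.getD_eq_getElem?_getD]
  cases hk : T[k]? with
  | none => exact h0
  | some c => exact h c (List.mem_of_getElem? hk)

theorem decCol_colAt_tabOf (w : List ℕ+) (k : ℕ) : DecCol (colAt (tabOf w) k) :=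
  colAt_mem List.Pairwise.nil (decCol_tabOf w) k

theorem noOne_tabOf (w : List ℕ+) (k : ℕ) :
    noOne (colAt (tabOf w) k) = colAt (tabOf (noOne w)) k := by
  induction w generalizing k with
  | nil => rfl
  | cons a w ih =>
    have h := noOne_insertOpt k (decCol_colAt_tabOf w) ih (some a)
    by_cases ha : a = 1
    · subst ha
      rw [noOne_cons_one]
      exact h
    · rw [noOne_cons_of_ne ha]
      simp only [insertOpt, Option.filter, ne_eq, ha, not_false_eq_true, decide_true, if_true] at h
      exact h

theorem length_colAt (T : Tab) (k : ℕ) : (colAt T k).length = (T.map List.length).getD k 0 := by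
  rw [colAt, List.getD_eq_getElem?_getD, List.getD_eq_getElem?_getD, List.getElem?_map]
  cases T[k]? <;> rfl

theorem length_colAt_pTab (A : Mat) (k : ℕ) :
    (colAt (pTab A) k).length = (colAt (qTab A) k).length := by
  rw [length_colAt, length_colAt, length_pTab]

/-! ### The first column of a matrix and its corner entry -/

/-- The matrix without its first column. -/
def Mat.dropCol (A : Mat) : Mat := toMat ((biword A).filter (fun x => ¬ x.2 = 1))

theorem Mat.dropCol_apply (A : Mat) (i j : ℕ+) :
    A.dropCol (i, j) = if j = 1 then 0 else A (i, j) := by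
  rw [Mat.dropCol, toMat, Multiset.toFinsupp_apply, ← Multiset.filter_coe, coe_biword,
    Multiset.count_filter, Finsupp.count_toMultiset]
  split_ifs <;> simp_all

theorem biword_dropCol (A : Mat) :
    biword A.dropCol = (biword A).filter (fun x => ¬ x.2 = 1) :=
  biword_toMat ((pairwise_biword A).filter _)

theorem biword_split_one (A : Mat) :
    (biword A).filter (fun x => x.2 = 1) ++ biword A.dropCol = biword A := by
  rw [biword_dropCol]
  refine filter_append_filter_not ((pairwise_biword A).imp fun {x y} h hy => ?_)
  rcases h with h | ⟨h, -⟩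
  · exact absurd (hy ▸ h) not_lt_one
  · exact h.trans hy

/-- The first entries of the letters `(i, 1)`, in increasing order. -/
def firstCol (A : Mat) : List ℕ+ := (((biword A).filter (fun x => x.2 = 1)).map Prod.fst).reverse

theorem tabOf_append (u w : List ℕ+) : tabOf (u ++ w) = u.reverse.foldl insertTab (tabOf w) := by
  rw [tabOf, List.foldr_append, List.foldl_reverse]
  rfl

/-- Biletters `(i, 1)` open the biword while `tabOf` inserts from the right; so they enter last, and
in increasing order. -/
theorem pTab_eq_foldl (A : Mat) : pTab A = (firstCol A).foldl insertTab (pTab A.dropCol) := by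
  rw [firstCol, pTab, pTab, ← tabOf_append]
  conv_lhs => rw [wordI, ← biword_split_one, List.map_append]
  rfl

theorem sorted_firstCol (A : Mat) : (firstCol A).Pairwise (· ≤ ·) := by
  rw [firstCol, List.pairwise_reverse, List.pairwise_map]
  refine ((pairwise_biword A).filter _).imp_of_mem fun {x y} hx hy h => ?_
  simp only [List.mem_filter, decide_eq_true_eq] at hx hy
  rcases h with h | h
  · rw [hx.2, hy.2] at h
    exact absurd h (lt_irrefl _)
  · exact h.2

theorem count_firstCol (A : Mat) : (firstCol A).count 1 = A (1, 1) := by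
  rw [firstCol, List.count_reverse, List.count, List.countP_map, ← countP_column]
  refine List.countP_congr fun x _ => ?_
  simp

/-- The new `(1, 1)` has the smallest possible first entry and so closes the block of second entry
1. It is thus inserted just before `firstCol A`. -/
theorem biword_add_E11 (A : Mat) : biword (A + E11) =
    (biword A).filter (fun x => x.2 = 1) ++ (1, 1) :: biword A.dropCol := by
  refine eq_of_biLe (pairwise_biword _) ?_ ?_
  · have h := pairwise_biword A
    rw [← biword_split_one, List.pairwise_append] at h
    rw [List.pairwise_append, List.pairwise_cons]
    refine ⟨h.1, ⟨fun y hy => Or.inl ?_, h.2.1⟩, fun x hx y hy => ?_⟩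
    · rw [biword_dropCol] at hy
      simp only [List.mem_filter, decide_eq_true_eq] at hy
      exact lt_of_le_of_ne one_le (Ne.symm hy.2)
    · rcases List.mem_cons.1 hy with rfl | hy
      · simp only [List.mem_filter, decide_eq_true_eq] at hx
        exact Or.inr ⟨hx.2, one_le⟩
      · exact h.2.2 x hx y hy
  · rw [Multiset.coe_eq_coe.2 List.perm_middle, biword_split_one, ← Multiset.cons_coe, coe_biword,
      coe_biword, map_add, E11, Finsupp.toMultiset_single, one_smul, add_comm,
      Multiset.singleton_add]

theorem pTab_add_E11 (A : Mat) :
    pTab (A + E11) = (1 :: firstCol A).foldl insertTab (pTab A.dropCol) := by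
  have h : 1 :: firstCol A =
      (((biword A).filter (fun x : ℕ+ × ℕ+ => x.2 = 1)).map Prod.fst ++ [1]).reverse := by
    rw [List.reverse_append]
    rfl
  rw [h, pTab, pTab, ← tabOf_append, wordI, biword_add_E11, List.map_append, List.append_assoc]
  rfl

theorem noOne_wordL_congr {A B : Mat} (h : ∀ i j, j ≠ 1 → A (i, j) = B (i, j)) :
    noOne (wordL A) = noOne (wordL B) := by
  have key : ∀ A : Mat, noOne (wordL A) =
      ((biword (Mat.tr A)).filter (fun x : ℕ+ × ℕ+ => x.1 ≠ 1)).map Prod.fst := by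
    intro A
    rw [wordL_eq, wordI, noOne, List.filter_map]
    rfl
  rw [key, key, filter_biword_congr]
  rintro ⟨i, j⟩ hi
  exact h j i hi

theorem noOne_wordL_add_E11 (A : Mat) : noOne (wordL (A + E11)) = noOne (wordL A) := by
  refine noOne_wordL_congr fun i j hj => ?_
  rw [Finsupp.add_apply, E11, Finsupp.single_apply, if_neg (fun h => hj (Prod.mk.inj h).2.symm),
    add_zero]

theorem wordL_dropCol (A : Mat) : wordL A.dropCol = noOne (wordL A) := by
  rw [← noOne_wordL_congr (A := A.dropCol) (B := A) fun i j hj => by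
    rw [Mat.dropCol_apply, if_neg hj]]
  refine (List.filter_eq_self.2 fun x hx => ?_).symm
  have h1 : x ∈ (wordL A.dropCol : Multiset ℕ+) := hx
  rw [coe_wordL, ← coe_biword, biword_dropCol, Multiset.mem_map] at h1
  obtain ⟨y, hy, rfl⟩ := h1
  simpa using (List.mem_filter.1 (Multiset.mem_coe.1 hy)).2

theorem noOne_qTab (A : Mat) (k : ℕ) : noOne (colAt (qTab A) k) = colAt (qTab A.dropCol) k := by
  rw [qTab, noOne_tabOf, ← wordL_dropCol]
  rfl

/-- Without its ones the second tableau is that of `dropCol`, and both pairs of tableaux have equal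
shapes. So the ones mark exactly the growth of the first tableau. -/
theorem one_mem_qTab (A : Mat) (k : ℕ) : 1 ∈ colAt (qTab A) k ↔
    (colAt (pTab A) k).length = (colAt (pTab A.dropCol) k).length + 1 := by
  rw [length_colAt_pTab, length_colAt_pTab, ← noOne_qTab,
    DecCol.length_eq (c := colAt (qTab A) k) (decCol_colAt_tabOf _ _)]
  split_ifs with h <;> simp [h]

/-- The operators of colour zero on matrices and on pairs of tableaux. -/
theorem zero_main (A : Mat) (l : List (List ℕ+ × List ℕ+))
    (hP : ∀ k, colAt (l.map Prod.fst) k = colAt (pTab A) k)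
    (hQ : ∀ k, colAt (l.map Prod.snd) k = colAt (qTab A) k) :
    zeroX.wep l = A (1, 1) ∧ ∀ l', zeroX.wF l = some l' →
      (∀ k, colAt (l'.map Prod.fst) k = colAt (pTab (A + E11)) k) ∧
      ∀ k, colAt (l'.map Prod.snd) k = colAt (qTab (A + E11)) k := by
  obtain ⟨h1, h2⟩ := zeroX_spec l (C := pTab A.dropCol) (decCol_colAt_tabOf _) (sorted_firstCol A)
    (fun k => by rw [hP, pTab_eq_foldl]) (fun k => by rw [hP, hQ, one_mem_qTab])
  rw [count_firstCol] at h1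
  refine ⟨h1, fun l' hl' => ?_⟩
  have h3 := h2 l' hl'
  rw [← pTab_add_E11] at h3
  refine ⟨h3, fun k => ?_⟩
  have hcol : ∀ (l : List (List ℕ+ × List ℕ+)) (g : List ℕ+ × List ℕ+ → List ℕ+) (k : ℕ),
      (h : k < l.length) → colAt (l.map g) k = g l[k] := by
    intro l g k h
    rw [colAt, List.getD_eq_getElem _ _ (by simpa using h), List.getElem_map]
  have hQl : ∀ b ∈ l, DecCol b.2 ∧ b.1.length = b.2.length := by
    intro b hb
    obtain ⟨k, hk, rfl⟩ := List.getElem_of_mem hb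
    rw [← hcol l Prod.fst k hk, ← hcol l Prod.snd k hk, hP, hQ]
    exact ⟨decCol_colAt_tabOf _ _, length_colAt_pTab _ _⟩
  have hQl' : ∀ b ∈ l', DecCol b.2 ∧ b.1.length = b.2.length := by
    refine OneColour.mem_of_wF (X := zeroX) (fun b b' hb hQ => ?_) hl' hQl
    simp only [zeroX] at hb
    split_ifs at hb with h
    cases hb
    refine ⟨?_, by simpa using hQ.2⟩
    have := decCol_insertColumn 1 hQ.1
    rwa [insertColumn_one_of_notMem h.2] at this
  have hno : ∀ (l : List (List ℕ+ × List ℕ+)) (k : ℕ), noOne (colAt (l.map Prod.snd) k) =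
      colAt (l.map (fun b => noOne b.2)) k := by
    intro l k
    rw [colAt, colAt, List.getD_eq_getElem?_getD, List.getD_eq_getElem?_getD, List.getElem?_map,
      List.getElem?_map]
    cases l[k]? <;> rfl
  have hmap : l'.map (fun b => noOne b.2) = l.map (fun b => noOne b.2) := by
    refine OneColour.map_of_wF (X := zeroX) (fun b b' hb => ?_) hl'
    simp only [zeroX] at hb
    split_ifs at hb with h
    cases hb
    rw [noOne_append, noOne_cons_one]
    exact List.append_nil _
  -- The second tableau is known once its letters other than `1`, which do not change, and its
  -- column lengths, shared with the first tableau, are known.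
  refine DecCol.ext_noOne ?_ (decCol_colAt_tabOf _ _) ?_ ?_
  · refine colAt_mem List.Pairwise.nil (fun c hc => ?_) k
    obtain ⟨b, hb, rfl⟩ := List.mem_map.1 hc
    exact (hQl' b hb).1
  · rw [hno, hmap, ← hno, hQ, qTab, qTab, noOne_tabOf, noOne_tabOf, noOne_wordL_add_E11]
  · refine Eq.trans ?_ (length_colAt_pTab (A + E11) k)
    rw [← h3]
    by_cases hk : k < l'.length
    · rw [hcol _ _ _ hk, hcol _ _ _ hk]
      exact (hQl' _ (List.getElem_mem hk)).2.symm
    · rw [colAt, colAt, List.getD_eq_default _ _ (by simpa using hk),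
        List.getD_eq_default _ _ (by simpa using hk)]

/-! ### The crystal of semi-infinite words -/

theorem SemiInfWord.letters_injective {v w : SemiInfWord} (h : v.letters = w.letters) : v = w := by
  refine SemiInfWord.ext ?_
  have := (StrictMono.range_inj (f := fun k => OrderDual.toDual (v.letter k))
    (g := fun k => OrderDual.toDual (w.letter k)) (fun a b hab => v.strict hab)
    (fun a b hab => w.strict hab)).1 h
  exact this

theorem SemiInfWord.mem_subst {w : SemiInfWord} {a b : Letter} (ha : a ∈ w.letters)
    (hb : b ∉ w.letters) (hab : ∀ x : Letter, x ≠ a → x ≠ b → (x < a ↔ x < b)) (x : Letter) :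
    x ∈ (w.subst a b hb hab).letters ↔ x = b ∨ (x ∈ w.letters ∧ x ≠ a) := by
  constructor
  · rintro ⟨k, rfl⟩
    simp only [SemiInfWord.subst]
    split_ifs with h
    · exact Or.inl rfl
    · exact Or.inr ⟨⟨k, rfl⟩, h⟩
  · rintro (rfl | ⟨⟨k, rfl⟩, h⟩)
    · obtain ⟨k, hk⟩ := ha
      exact ⟨k, if_pos hk⟩
    · exact ⟨k, if_neg h⟩

/-- Trades the sequence for its set of letters, which determines it. -/
theorem fock_f_iff {i : ℤ} {w v : SemiInfWord} : fock.f i w = some v ↔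
    lo i ∈ w.letters ∧ hi i ∉ w.letters ∧
      ∀ x, x ∈ v.letters ↔ x = hi i ∨ (x ∈ w.letters ∧ x ≠ lo i) := by
  constructor
  · intro h
    simp only [fock] at h
    split_ifs at h with h1
    cases h
    exact ⟨h1.1, h1.2, SemiInfWord.mem_subst h1.1 _ _⟩
  · rintro ⟨h1, h2, h3⟩
    simp only [fock]
    rw [dif_pos ⟨h1, h2⟩, Option.some_inj]
    refine SemiInfWord.letters_injective (Set.ext fun x => ?_)
    rw [h3, SemiInfWord.mem_subst h1]

theorem fock_e_iff {i : ℤ} {w v : SemiInfWord} : fock.e i w = some v ↔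
    hi i ∈ w.letters ∧ lo i ∉ w.letters ∧
      ∀ x, x ∈ v.letters ↔ x = lo i ∨ (x ∈ w.letters ∧ x ≠ hi i) := by
  constructor
  · intro h
    simp only [fock] at h
    split_ifs at h with h1
    cases h
    exact ⟨h1.1, h1.2, SemiInfWord.mem_subst h1.1 _ _⟩
  · rintro ⟨h1, h2, h3⟩
    simp only [fock]
    rw [dif_pos ⟨h1, h2⟩, Option.some_inj]
    refine SemiInfWord.letters_injective (Set.ext fun x => ?_)
    rw [h3, SemiInfWord.mem_subst h1]

theorem fock_f_letter {i : ℤ} {w v : SemiInfWord} (h : fock.f i w = some v) (k : ℕ) :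
    v.letter k = if w.letter k = lo i then hi i else w.letter k := by
  simp only [fock] at h
  split_ifs at h
  cases h
  rfl

theorem fock_e_letter {i : ℤ} {w v : SemiInfWord} (h : fock.e i w = some v) (k : ℕ) :
    v.letter k = if w.letter k = hi i then lo i else w.letter k := by
  simp only [fock] at h
  split_ifs at h
  cases h
  rfl

theorem fock_f_iff_e (i : ℤ) (w v : SemiInfWord) : fock.f i w = some v ↔ fock.e i v = some w := by
  have hne := lo_ne_hi i
  rw [fock_f_iff, fock_e_iff]
  constructor
  · rintro ⟨h1, h2, h3⟩
    refine ⟨(h3 _).2 (Or.inl rfl), fun h => ?_, fun x => ?_⟩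
    · rcases (h3 _).1 h with h | h
      · exact hne h
      · exact h.2 rfl
    · rw [h3]
      by_cases hx : x = lo i
      · subst hx; simp [h1]
      · by_cases hx' : x = hi i
        · subst hx'; simp [h2, hx]
        · simp [hx, hx']
  · rintro ⟨h1, h2, h3⟩
    refine ⟨(h3 _).2 (Or.inl rfl), fun h => ?_, fun x => ?_⟩
    · rcases (h3 _).1 h with h | h
      · exact hne h.symm
      · exact h.2 rfl
    · rw [h3]
      by_cases hx : x = hi i
      · subst hx; simp [h1]
      · by_cases hx' : x = lo i
        · subst hx'; simp [h2, hx]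
        · simp [hx, hx']

open Classical in
/-- The crystal of semi-infinite words for a single colour. -/
def fockX (i : ℤ) : OneColour SemiInfWord where
  ep w := if hi i ∈ w.letters ∧ lo i ∉ w.letters then 1 else 0
  ph w := if lo i ∈ w.letters ∧ hi i ∉ w.letters then 1 else 0
  e := fock.e i
  f := fock.f i

theorem fockX_law (i : ℤ) : (fockX i).Law := by
  refine ⟨fock_f_iff_e i, fun w v h => ?_, fun w => ?_, fun w => ?_⟩
  · have h1 := fock_f_iff.1 h
    have h2 := fock_e_iff.1 ((fock_f_iff_e i w v).1 h)
    simp [fockX, h1.1, h1.2.1, h2.1, h2.2.1]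
  · simp only [fockX, fock]
    split_ifs with h <;> simp
  · simp only [fockX, fock]
    split_ifs with h <;> simp

theorem lo_neg_iff (i : ℤ) : (lo i : ℤ) < 0 ↔ i ≤ 0 := by
  simp only [lo]; split_ifs <;> omega

theorem hi_neg_iff (i : ℤ) : (hi i : ℤ) < 0 ↔ i < 0 := by
  simp only [hi]; split_ifs <;> omega

theorem fock_wt_apply (w : SemiInfWord) (k : Letter) : (fock.wt w).1 k = w.mult k :=
  zero_add (w.mult k)

/-- The shift of `mult` on negative letters cancels in the pairing except for `i = 0`, whose arrow
leads from -1 to 1; there `⟨Λ₀, h₀⟩ = 1` compensates. -/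
theorem fock_models (i : ℤ) : Models fock i (fockX i) := by
  refine ⟨fun w => ?_, fun w => ?_, fun w => ?_, fun w => rfl, fun w => rfl⟩
  · simp only [fock, fockX]
    split_ifs <;> rfl
  · simp only [fock, fockX]
    split_ifs <;> rfl
  · have h1 : pairing (fock.wt w) i = w.mult (lo i) - w.mult (hi i) + if i = 0 then 1 else 0 := by
      rw [pairing, fock_wt_apply, fock_wt_apply]
      rfl
    rw [h1]
    simp only [SemiInfWord.mult, lo_neg_iff, hi_neg_iff, fockX]
    rcases lt_trichotomy i 0 with h | h | h
    · rw [if_pos h.le, if_pos h, if_neg h.ne]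
      split_ifs <;> simp_all
    · rw [if_pos h.le, if_neg h.ge.not_gt, if_pos h]
      split_ifs <;> simp_all
    · rw [if_neg h.not_ge, if_neg h.asymm, if_neg h.ne']
      split_ifs <;> simp_all

theorem fock_wt_step {i : ℤ} {w v : SemiInfWord} (h : fock.f i w = some v) :
    fock.wt v = fock.wt w - simpleRoot i := by
  have hne := lo_ne_hi i
  obtain ⟨h1, h2, h3⟩ := fock_f_iff.1 h
  refine Prod.ext (Finsupp.ext fun k => ?_) ?_
  · classical
    have key : v.mult k = w.mult k - ((if lo i = k then 1 else 0) - if hi i = k then 1 else 0) := by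
      have h4 := h3 k
      simp only [SemiInfWord.mult]
      by_cases hk : k = lo i
      · subst hk
        rw [if_neg (fun h => by simpa [hne] using h4.1 h), if_pos h1, if_pos rfl, if_neg hne.symm]
        ring
      · by_cases hk' : k = hi i
        · subst hk'
          rw [if_pos (h4.2 (Or.inl rfl)), if_neg h2, if_neg hne, if_pos rfl]
          ring
        · rw [if_neg (Ne.symm hk), if_neg (Ne.symm hk'), sub_self, sub_zero]
          refine congrArg₂ _ (if_congr (h4.trans ?_) rfl rfl) rfl
          simp [hk, hk']
    rw [Prod.fst_sub, Finsupp.sub_apply, fock_wt_apply, fock_wt_apply, key]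
    simp [simpleRoot, epsWt, Finsupp.single_apply]
  · simp [fock, SemiInfWord.wt, Lam0, simpleRoot, epsWt]

/-! ### Columns of semi-infinite words -/

theorem letter_pos_or_neg (x : Letter) : (∃ p, x = posLetter p) ∨ ∃ p, x = negLetter p := by
  obtain ⟨x, hx⟩ := x
  rcases lt_or_gt_of_ne hx with h | h
  · right
    refine ⟨⟨(-x).toNat, by omega⟩, Subtype.ext ?_⟩
    simp only [negLetter, PNat.mk_coe]
    omega
  · left
    refine ⟨⟨x.toNat, by omega⟩, Subtype.ext ?_⟩
    simp only [posLetter, PNat.mk_coe]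
    omega

theorem posLetter_inj {p q : ℕ+} : posLetter p = posLetter q ↔ p = q := by
  simp [posLetter, Subtype.ext_iff]

theorem negLetter_inj {p q : ℕ+} : negLetter p = negLetter q ↔ p = q := by
  simp [negLetter, Subtype.ext_iff]

theorem posLetter_ne_negLetter (p q : ℕ+) : posLetter p ≠ negLetter q := by
  have := p.pos
  have := q.pos
  simp only [posLetter, negLetter, ne_eq, Subtype.ext_iff]
  omega

theorem posLetter_le {p q : ℕ+} : posLetter p ≤ posLetter q ↔ p ≤ q := by
  simp only [posLetter, ← Subtype.coe_le_coe, ← PNat.coe_le_coe]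
  omega

theorem negLetter_le {p q : ℕ+} : negLetter p ≤ negLetter q ↔ q ≤ p := by
  simp only [negLetter, ← Subtype.coe_le_coe, ← PNat.coe_le_coe]
  omega

theorem negLetter_le_posLetter (p q : ℕ+) : negLetter p ≤ posLetter q := by
  simp only [negLetter, posLetter, ← Subtype.coe_le_coe]
  omega

theorem not_posLetter_le (p q : ℕ+) : ¬ posLetter p ≤ negLetter q := by
  have := p.pos
  have := q.pos
  simp only [negLetter, posLetter, ← Subtype.coe_le_coe]
  omega

theorem lo_pos (p : ℕ+) : lo (p : ℤ) = posLetter p := by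
  have := p.pos
  refine Subtype.ext ?_
  simp only [lo, posLetter]
  rw [if_pos (by omega)]

theorem hi_pos (p : ℕ+) : hi (p : ℤ) = posLetter (p + 1) := by
  refine Subtype.ext ?_
  simp only [hi, posLetter, PNat.add_coe, PNat.one_coe]
  rw [if_pos (by omega)]
  push_cast
  rfl

theorem lo_neg (p : ℕ+) : lo (-(p : ℤ)) = negLetter (p + 1) := by
  refine Subtype.ext ?_
  simp only [lo, negLetter, PNat.add_coe, PNat.one_coe]
  rw [if_neg (by omega)]
  push_cast
  ring

theorem hi_neg (p : ℕ+) : hi (-(p : ℤ)) = negLetter p := by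
  have := p.pos
  refine Subtype.ext ?_
  simp only [hi, negLetter]
  rw [if_neg (by omega)]

theorem lo_zero : lo 0 = negLetter 1 := rfl

theorem hi_zero : hi 0 = posLetter 1 := rfl

theorem colour_cases (i : ℤ) : (∃ p : ℕ+, i = p) ∨ (∃ p : ℕ+, i = -p) ∨ i = 0 := by
  rcases lt_trichotomy i 0 with h | h | h
  · exact Or.inr (Or.inl ⟨⟨(-i).toNat, by omega⟩, by rw [PNat.mk_coe]; omega⟩)
  · exact Or.inr (Or.inr h)
  · exact Or.inl ⟨⟨i.toNat, by omega⟩, by rw [PNat.mk_coe]; omega⟩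

theorem mem_posColumn {w : SemiInfWord} {p : ℕ+} : p ∈ w.posColumn ↔ posLetter p ∈ w.letters := by
  rw [SemiInfWord.posColumn, Finset.mem_sort, Set.Finite.mem_toFinset]
  rfl

theorem mem_negColumn {w : SemiInfWord} {p : ℕ+} : p ∈ w.negColumn ↔ negLetter p ∉ w.letters := by
  rw [SemiInfWord.negColumn, Finset.mem_sort, Set.Finite.mem_toFinset]
  rfl

theorem decCol_sort (s : Finset ℕ+) : DecCol (s.sort (fun a b => b ≤ a)) := by
  have h1 := Finset.pairwise_sort s (fun a b => b ≤ a)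
  have h2 := Finset.sort_nodup s (fun a b => b ≤ a)
  exact (h1.and h2).imp fun h => lt_of_le_of_ne h.1 h.2.symm

theorem decCol_posColumn (w : SemiInfWord) : DecCol w.posColumn := decCol_sort _

theorem decCol_negColumn (w : SemiInfWord) : DecCol w.negColumn := decCol_sort _

theorem SemiInfWord.ext_columns {v w : SemiInfWord} (h1 : v.negColumn = w.negColumn)
    (h2 : v.posColumn = w.posColumn) : v = w := by
  refine SemiInfWord.letters_injective (Set.ext fun x => ?_)
  rcases letter_pos_or_neg x with ⟨p, rfl⟩ | ⟨p, rfl⟩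
  · rw [← mem_posColumn, h2, mem_posColumn]
  · rw [← not_iff_not, ← mem_negColumn, h1, mem_negColumn]

theorem posColumn_hom (p : ℕ+) : OneColour.IsHom (fockX p) (colX p) SemiInfWord.posColumn := by
  have hph : ∀ w : SemiInfWord, (colX p).ph w.posColumn = (fockX p).ph w := fun w =>
    by classical exact if_congr (by simp only [mem_posColumn, lo_pos, hi_pos]) rfl rfl
  refine ⟨fun w => by classical exact if_congr (by simp only [mem_posColumn, lo_pos, hi_pos]) rfl rfl,
    hph, fun w => ?_⟩
  · cases hv : (fockX p).f w with
    | none =>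
      rw [(fockX_law p).f_none] at hv
      exact ((colX_law p).f_none _).2 ((hph w).trans hv)
    | some v =>
      obtain ⟨h1, h2, h3⟩ := fock_f_iff.1 hv
      rw [lo_pos] at h1
      rw [hi_pos] at h2
      have hf : (colX p).f w.posColumn =
          some (w.posColumn.map fun x => if x = p then p + 1 else x) :=
        if_pos ⟨mem_posColumn.2 h1, fun h => h2 (mem_posColumn.1 h)⟩
      rw [hf, Option.map_some, Option.some_inj]
      refine (decCol_of_f hf (decCol_posColumn w)).ext (decCol_posColumn v) fun x => ?_
      rw [mem_map_replace, mem_posColumn, mem_posColumn, mem_posColumn, h3, lo_pos, hi_pos,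
        posLetter_inj, ne_eq, ne_eq, posLetter_inj]
      simp [h1]

/-- Complement and negation each reverse the arrow: when the letter -(p+1) becomes -p, the missing
letter -p becomes -(p+1). -/
theorem negColumn_hom (p : ℕ+) : OneColour.IsHom (fockX (-p)) (colX p) SemiInfWord.negColumn := by
  have hph : ∀ w : SemiInfWord, (colX p).ph w.negColumn = (fockX (-p)).ph w := fun w =>
    by classical exact if_congr (by
      simp only [mem_negColumn, lo_neg, hi_neg, not_not, and_comm]) rfl rfl
  refine ⟨fun w => by
    classical exact if_congr (by
      simp only [mem_negColumn, lo_neg, hi_neg, not_not, and_comm]) rfl rfl,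
    hph, fun w => ?_⟩
  · cases hv : (fockX (-p)).f w with
    | none =>
      rw [(fockX_law _).f_none] at hv
      exact ((colX_law p).f_none _).2 ((hph w).trans hv)
    | some v =>
      obtain ⟨h1, h2, h3⟩ := fock_f_iff.1 hv
      rw [lo_neg] at h1
      rw [hi_neg] at h2
      have hf : (colX p).f w.negColumn =
          some (w.negColumn.map fun x => if x = p then p + 1 else x) :=
        if_pos ⟨mem_negColumn.2 h2, fun h => mem_negColumn.1 h h1⟩
      rw [hf, Option.map_some, Option.some_inj]
      refine (decCol_of_f hf (decCol_negColumn w)).ext (decCol_negColumn v) fun x => ?_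
      rw [mem_map_replace, mem_negColumn, mem_negColumn, mem_negColumn, h3, lo_neg, hi_neg,
        negLetter_inj, ne_eq, ne_eq, negLetter_inj]
      have h4 := pnat_ne_succ p
      by_cases hx : x = p
      · subst hx; simp [h4]
      · by_cases hx' : x = p + 1
        · subst hx'; simp [h4.symm, h2]
        · simp [hx, hx']

theorem negColumn_of_pos {p : ℕ+} {v w : SemiInfWord} (h : fock.f p w = some v) :
    v.negColumn = w.negColumn := by
  refine (decCol_negColumn v).ext (decCol_negColumn w) fun x => ?_
  rw [mem_negColumn, mem_negColumn, (fock_f_iff.1 h).2.2, lo_pos, hi_pos]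
  simp [(posLetter_ne_negLetter _ _).symm]

theorem posColumn_of_neg {p : ℕ+} {v w : SemiInfWord} (h : fock.f (-p) w = some v) :
    v.posColumn = w.posColumn := by
  refine (decCol_posColumn v).ext (decCol_posColumn w) fun x => ?_
  rw [mem_posColumn, mem_posColumn, (fock_f_iff.1 h).2.2, lo_neg, hi_neg]
  simp [posLetter_ne_negLetter]

theorem decCol_append_one {c : List ℕ+} (hc : DecCol c) (h : 1 ∉ c) : DecCol (c ++ [1]) := by
  have := decCol_insertColumn 1 hc
  rwa [insertColumn_one_of_notMem h] at this

/-- Replacing -1 by 1 makes -1 missing and 1 present, so both columns receive the smallest entry, on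
top. -/
theorem columns_hom : OneColour.IsHom (fockX 0) zeroX (fun w => (w.negColumn, w.posColumn)) := by
  have hph : ∀ w : SemiInfWord, zeroX.ph (w.negColumn, w.posColumn) = (fockX 0).ph w := fun w =>
    by classical exact if_congr (by
      simp only [mem_negColumn, mem_posColumn, lo_zero, hi_zero, not_not]) rfl rfl
  have hep : ∀ w : SemiInfWord, zeroX.ep (w.negColumn, w.posColumn) = (fockX 0).ep w := fun w => by
    classical
    exact if_congr (by
      simp only [mem_negColumn, mem_posColumn, lo_zero, hi_zero, and_comm]) rfl rfl
  refine ⟨hep, hph, fun w => ?_⟩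
  · cases hv : (fockX 0).f w with
    | none =>
      rw [(fockX_law _).f_none] at hv
      refine if_neg fun h => ?_
      rw [← hph] at hv
      simp [zeroX, h.1, h.2] at hv
    | some v =>
      obtain ⟨h1, h2, h3⟩ := fock_f_iff.1 hv
      rw [lo_zero] at h1
      rw [hi_zero] at h2
      have h4 : 1 ∉ w.negColumn := fun h => mem_negColumn.1 h h1
      have h5 : 1 ∉ w.posColumn := fun h => h2 (mem_posColumn.1 h)
      have hf : zeroX.f (w.negColumn, w.posColumn) =
          some (w.negColumn ++ [1], w.posColumn ++ [1]) := if_pos ⟨h4, h5⟩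
      rw [hf, Option.map_some, Option.some_inj, Prod.mk.injEq]
      constructor
      · refine (decCol_append_one (decCol_negColumn w) h4).ext (decCol_negColumn v) fun x => ?_
        rw [List.mem_append, List.mem_singleton, mem_negColumn, mem_negColumn, h3, lo_zero, hi_zero]
        simp only [(posLetter_ne_negLetter _ _).symm, false_or, ne_eq, negLetter_inj]
        tauto
      · refine (decCol_append_one (decCol_posColumn w) h5).ext (decCol_posColumn v) fun x => ?_
        rw [List.mem_append, List.mem_singleton, mem_posColumn, mem_posColumn, h3, lo_zero, hi_zero]
        simp only [posLetter_ne_negLetter, not_false_eq_true, and_true, ne_eq, posLetter_inj]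
        tauto

/-! ### The fundamental crystal -/

theorem groundWord_mem : groundWord ∈ BLam0 := Relation.EqvGen.refl _

theorem mem_BLam0_of_f {i : ℤ} {w v : SemiInfWord} (h : fock.f i w = some v) (hw : w ∈ BLam0) :
    v ∈ BLam0 :=
  Relation.EqvGen.trans _ _ _ hw (Relation.EqvGen.rel _ _ ⟨i, h⟩)

theorem mem_BLam0_of_e {i : ℤ} {w v : SemiInfWord} (h : fock.e i w = some v) (hw : w ∈ BLam0) :
    v ∈ BLam0 :=
  Relation.EqvGen.trans _ _ _ hw
    (Relation.EqvGen.symm _ _ (Relation.EqvGen.rel _ _ ⟨i, (fock_f_iff_e i v w).2 h⟩))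

theorem length_of_colX_f {p : ℕ+} {c d : List ℕ+} (h : (colX p).f c = some d) :
    d.length = c.length := by
  simp only [colX] at h
  split_ifs at h
  cases h
  exact List.length_map _

theorem groundWord_columns : groundWord.negColumn = [] ∧ groundWord.posColumn = [] := by
  constructor <;> refine List.eq_nil_iff_forall_not_mem.2 fun p hp => ?_
  · rw [mem_negColumn] at hp
    refine hp ⟨p.natPred, Subtype.ext ?_⟩
    have := PNat.natPred_add_one p
    simp only [groundWord, negLetter]
    omega
  · rw [mem_posColumn] at hp
    obtain ⟨k, hk⟩ := hp
    have := congrArg Subtype.val hk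
    have := p.pos
    simp only [groundWord, posLetter] at *
    omega

/-- Non-zero colours preserve both lengths and colour zero changes both by one; the ground word has
two empty columns. -/
theorem length_columns {w : SemiInfWord} (hw : w ∈ BLam0) :
    w.negColumn.length = w.posColumn.length := by
  have key : ∀ x y : SemiInfWord, Relation.EqvGen (fun x y => ∃ i, fock.f i x = some y) x y →
      (x.negColumn.length = x.posColumn.length ↔ y.negColumn.length = y.posColumn.length) := by
    intro x y h
    induction h with
    | rel x y h =>
      obtain ⟨i, h⟩ := h
      rcases colour_cases i with ⟨p, rfl⟩ | ⟨p, rfl⟩ | rfl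
      · have h1 : (colX p).f x.posColumn = some y.posColumn := by
          rw [(posColumn_hom p).f, show (fockX p).f x = some y from h]; rfl
        rw [negColumn_of_pos h, length_of_colX_f h1]
      · have h1 : (colX p).f x.negColumn = some y.negColumn := by
          rw [(negColumn_hom p).f, show (fockX (-p)).f x = some y from h]; rfl
        rw [posColumn_of_neg h, length_of_colX_f h1]
      · have h1 : zeroX.f (x.negColumn, x.posColumn) = some (y.negColumn, y.posColumn) := by
          rw [columns_hom.f, show (fockX 0).f x = some y from h]; rfl
        simp only [zeroX] at h1
        split_ifs at h1
        simp only [Option.some_inj, Prod.mk.injEq] at h1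
        rw [← h1.1, ← h1.2]
        simp
    | refl x => exact Iff.rfl
    | symm x y _ ih => exact ih.symm
    | trans x y z _ _ ih1 ih2 => exact ih1.trans ih2
  refine (key _ _ hw).1 ?_
  rw [groundWord_columns.1, groundWord_columns.2]

theorem DecCol.exists_append_one {c : List ℕ+} (hc : DecCol c) (h : 1 ∈ c) :
    ∃ d, c = d ++ [1] ∧ DecCol d ∧ 1 ∉ d := by
  obtain ⟨l, r, rfl⟩ := List.append_of_mem h
  have h1 := decCol_append_iff.1 hc
  obtain rfl : r = [] := List.eq_nil_iff_forall_not_mem.2 fun y hy =>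
    not_lt_one (h1.2.2.2.1 y hy)
  exact ⟨l, rfl, h1.1, fun h => lt_irrefl _ (h1.2.2.1 1 h)⟩

/-- Converse of `length_columns`. A common `1` is removed by colour zero; otherwise one column is
lowered by a non-zero colour. Only the empty pair admits neither. -/
theorem exists_word {c d : List ℕ+} (hc : DecCol c) (hd : DecCol d) (h : c.length = d.length) :
    ∃ w ∈ BLam0, w.negColumn = c ∧ w.posColumn = d := by
  induction hn : colSum c + colSum d using Nat.strong_induction_on generalizing c d with
  | _ n ih =>
    subst hn
    by_cases h1 : 1 ∈ c ∧ 1 ∈ d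
    · obtain ⟨c', rfl, hc', hc1⟩ := hc.exists_append_one h1.1
      obtain ⟨d', rfl, hd', hd1⟩ := hd.exists_append_one h1.2
      obtain ⟨w, hw, rfl, rfl⟩ := ih _ (by simp [colSum]; omega) hc' hd' (by simpa using h) rfl
      have h2 := columns_hom.f w
      have h3 : zeroX.f (w.negColumn, w.posColumn) =
          some (w.negColumn ++ [1], w.posColumn ++ [1]) := if_pos ⟨hc1, hd1⟩
      rw [h3] at h2
      obtain ⟨v, hv, hv'⟩ := Option.map_eq_some_iff.1 h2.symm
      exact ⟨v, mem_BLam0_of_f hv hw, (Prod.mk.inj hv').1, (Prod.mk.inj hv').2⟩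
    by_cases h2 : ∃ p, (colX p).ep d ≠ 0
    · obtain ⟨p, hp⟩ := h2
      obtain ⟨d', hd'⟩ := (colX_law p).exists_e hp
      have h3 := ((colX_law p).f_iff_e _ _).2 hd'
      obtain ⟨w, hw, rfl, rfl⟩ := ih _ (Nat.add_lt_add_left (colSum_lt hd') _) hc
        (decCol_of_e hd' hd) (h.trans (length_of_colX_f h3)) rfl
      rw [(posColumn_hom p).f] at h3
      obtain ⟨v, hv, hv'⟩ := Option.map_eq_some_iff.1 h3
      exact ⟨v, mem_BLam0_of_f hv hw, negColumn_of_pos hv, hv'⟩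
    by_cases h3 : ∃ p, (colX p).ep c ≠ 0
    · obtain ⟨p, hp⟩ := h3
      obtain ⟨c', hc'⟩ := (colX_law p).exists_e hp
      have h3 := ((colX_law p).f_iff_e _ _).2 hc'
      obtain ⟨w, hw, rfl, rfl⟩ := ih _ (Nat.add_lt_add_right (colSum_lt hc') _)
        (decCol_of_e hc' hc) hd ((length_of_colX_f h3).symm.trans h) rfl
      rw [(negColumn_hom p).f] at h3
      obtain ⟨v, hv, hv'⟩ := Option.map_eq_some_iff.1 h3
      exact ⟨v, mem_BLam0_of_f hv hw, hv', posColumn_of_neg hv⟩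
    -- Both columns are now 1, …, n with the same n, and n > 0 would give the common `1` excluded by
    -- `h1`.
    push Not at h2 h3
    have h4 := eq_initialCol hc h3
    have h5 := eq_initialCol hd h2
    by_cases h6 : c.length = 0
    · rw [h6] at h4
      rw [← h, h6] at h5
      exact ⟨groundWord, groundWord_mem, groundWord_columns.1.trans h4.symm,
        groundWord_columns.2.trans h5.symm⟩
    · refine absurd ⟨?_, ?_⟩ h1
      · rw [h4, mem_initialCol]
        simp only [PNat.one_coe]
        omega
      · rw [h5, mem_initialCol]
        simp only [PNat.one_coe]
        omega

/-! ### Comparison of semi-infinite words -/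

theorem SemiInfWord.letter_le (w : SemiInfWord) (k : ℕ) :
    (w.letter k : ℤ) ≤ (w.letter 0 : ℤ) - k := by
  induction k with
  | zero => simp
  | succ k ih =>
    have h : (w.letter (k + 1) : ℤ) < w.letter k := w.strict (Nat.lt_succ_self k)
    push_cast
    omega

theorem SemiInfWord.finite_ge (w : SemiInfWord) (x : Letter) : {k | x ≤ w.letter k}.Finite := by
  refine (Set.finite_Iic ((w.letter 0 : ℤ) - x).toNat).subset fun k hk => ?_
  have h1 : (x : ℤ) ≤ w.letter k := hk
  have h2 := w.letter_le k
  rw [Set.mem_Iic]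
  omega

/-- The number of letters `≥ x`. -/
def SemiInfWord.countGe (w : SemiInfWord) (x : Letter) : ℕ := {k | x ≤ w.letter k}.ncard

/-- Decreasing sequences compare termwise exactly when their counting functions do; for the
converse, count at `x = w.letter k`. -/
theorem letter_le_iff {v w : SemiInfWord} :
    (∀ k, w.letter k ≤ v.letter k) ↔ ∀ x, w.countGe x ≤ v.countGe x := by
  constructor
  · intro h x
    exact Set.ncard_le_ncard (fun k hk => le_trans hk (h k)) (v.finite_ge x)
  · intro h k
    by_contra hk
    have h1 := h (w.letter k)
    have h2 : {j | w.letter k ≤ w.letter j} = Set.Iic k := by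
      ext j
      exact w.strict.le_iff_ge
    have h3 : {j | w.letter k ≤ v.letter j} ⊆ Set.Iio k := by
      intro j hj
      by_contra hjk
      exact hk (le_trans hj (v.strict.antitone (not_lt.1 hjk)))
    have h4 := Set.ncard_le_ncard h3 (Set.finite_Iio k)
    rw [SemiInfWord.countGe, SemiInfWord.countGe, h2] at h1
    rw [← Finset.coe_Iic, Set.ncard_coe_finset, Nat.card_Iic] at h1
    rw [← Finset.coe_Iio, Set.ncard_coe_finset, Nat.card_Iio] at h4
    omega

theorem SemiInfWord.countGe_eq (w : SemiInfWord) (x : Letter) :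
    w.countGe x = {y | y ∈ w.letters ∧ x ≤ y}.ncard := by
  rw [SemiInfWord.countGe, ← Set.ncard_image_of_injective _ w.strict.injective]
  congr 1
  ext y
  constructor
  · rintro ⟨k, hk, rfl⟩
    exact ⟨⟨k, rfl⟩, hk⟩
  · rintro ⟨⟨k, rfl⟩, hk⟩
    exact ⟨k, hk, rfl⟩

theorem DecCol.nodup {c : List ℕ+} (hc : DecCol c) : c.Nodup := hc.imp fun h => h.ne'

theorem DecCol.countP_eq {c : List ℕ+} (hc : DecCol c) (P : ℕ+ → Prop) [DecidablePred P] :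
    c.countP (fun x => P x) = (c.toFinset.filter P).card := by
  rw [List.countP_eq_length_filter, ← List.toFinset_card_of_nodup (hc.nodup.filter _)]
  congr 1
  ext x
  simp

theorem countGe_posLetter (w : SemiInfWord) (p : ℕ+) :
    w.countGe (posLetter p) = w.posColumn.countP (fun q => p ≤ q) := by
  rw [w.countGe_eq, (decCol_posColumn w).countP_eq (fun q => p ≤ q),
    ← Finset.card_image_of_injective _
      (fun a b h => posLetter_inj.1 h : Function.Injective posLetter),
    ← Set.ncard_coe_finset]
  congr 1
  ext y
  simp only [Finset.coe_image, Finset.coe_filter, List.mem_toFinset, Set.mem_image,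
    Set.mem_ofPred_eq]
  constructor
  · rintro ⟨h1, h2⟩
    rcases letter_pos_or_neg y with ⟨q, rfl⟩ | ⟨q, rfl⟩
    · exact ⟨q, ⟨mem_posColumn.2 h1, posLetter_le.1 h2⟩, rfl⟩
    · exact absurd h2 (not_posLetter_le _ _)
  · rintro ⟨q, ⟨h1, h2⟩, rfl⟩
    exact ⟨mem_posColumn.1 h1, posLetter_le.2 h2⟩

/-- The letters `≥ -m` are all the positive ones and those among -1, …, -m which are not missing. -/
theorem countGe_negLetter (w : SemiInfWord) (m : ℕ+) :
    w.countGe (negLetter m) + w.negColumn.countP (fun q => q ≤ m) = m + w.posColumn.length := by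
  have hS : {y | y ∈ w.letters ∧ negLetter m ≤ y} = ↑(w.posColumn.toFinset.image posLetter ∪
      ((Finset.Icc 1 m).filter (fun q => q ∉ w.negColumn)).image negLetter) := by
    ext y
    simp only [Finset.coe_union, Finset.coe_image, Finset.coe_filter, List.coe_toFinset,
      Set.mem_union, Set.mem_image, Set.mem_ofPred_eq, Finset.mem_Icc]
    constructor
    · rintro ⟨h1, h2⟩
      rcases letter_pos_or_neg y with ⟨q, rfl⟩ | ⟨q, rfl⟩
      · exact Or.inl ⟨q, mem_posColumn.2 h1, rfl⟩
      · exact Or.inr ⟨q, ⟨⟨one_le, negLetter_le.1 h2⟩, fun h => mem_negColumn.1 h h1⟩, rfl⟩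
    · rintro (⟨q, h1, rfl⟩ | ⟨q, ⟨⟨-, h1⟩, h2⟩, rfl⟩)
      · exact ⟨mem_posColumn.1 h1, negLetter_le_posLetter _ _⟩
      · exact ⟨not_not.1 fun h => h2 (mem_negColumn.2 h), negLetter_le.2 h1⟩
  rw [w.countGe_eq, hS, Set.ncard_coe_finset, Finset.card_union_of_disjoint,
    Finset.card_image_of_injective _ (fun a b h => posLetter_inj.1 h),
    Finset.card_image_of_injective _ (fun a b h => negLetter_inj.1 h),
    List.toFinset_card_of_nodup (decCol_posColumn w).nodup,
    (decCol_negColumn w).countP_eq (fun q => q ≤ m)]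
  · have h1 := Finset.card_filter_add_card_filter_not (s := Finset.Icc 1 m)
      (fun q => q ∈ w.negColumn)
    have h2 : (Finset.Icc 1 m).filter (fun q => q ∈ w.negColumn) =
        w.negColumn.toFinset.filter (fun q => q ≤ m) := by
      ext q
      simp [and_comm]
    rw [h2, PNat.card_Icc, PNat.one_coe] at h1
    omega
  · rw [Finset.disjoint_left]
    intro y hy hy'
    obtain ⟨p, -, rfl⟩ := Finset.mem_image.1 hy
    obtain ⟨q, -, hq⟩ := Finset.mem_image.1 hy'
    exact posLetter_ne_negLetter _ _ hq.symm

theorem DecCol.lt_countP_iff {c : List ℕ+} (hc : DecCol c) (k : ℕ) (p : ℕ+) :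
    k < c.countP (fun q => p ≤ q) ↔ ∃ h : k < c.length, p ≤ (c)[k]'h := by
  induction c generalizing k with
  | nil => simp
  | cons b c ih =>
    have hc' := List.pairwise_cons.1 hc
    rw [List.countP_cons]
    by_cases hb : p ≤ b
    · cases k with
      | zero => simp [hb]
      | succ k => simp [hb, ih hc'.2]
    · have h0 : c.countP (fun q => p ≤ q) = 0 := by
        rw [List.countP_eq_zero]
        intro x hx
        simpa using (hc'.1 x hx).trans (not_le.1 hb)
      rw [h0]
      simp only [hb, decide_false, Bool.false_eq_true, if_false, add_zero, not_lt_zero, false_iff,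
        not_exists, not_le]
      intro hk
      cases k with
      | zero => exact not_le.1 hb
      | succ k => exact (hc'.1 _ (List.getElem_mem _)).trans (not_le.1 hb)

theorem colLe_iff_countP {c d : List ℕ+} (hc : DecCol c) (hd : DecCol d) : ColLe c d ↔
    ∀ p, d.countP (fun q => p ≤ q) ≤ c.countP (fun q => p ≤ q) := by
  constructor
  · intro h p
    refine le_of_forall_lt fun k hk => ?_
    obtain ⟨h1, h2⟩ := (hd.lt_countP_iff k p).1 hk
    exact (hc.lt_countP_iff k p).2 ⟨h1.trans_le h.1, h2.trans (h.2 k h1 _)⟩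
  · intro h
    refine ⟨?_, fun k hk hk' => ?_⟩
    · have hl : ∀ c : List ℕ+, c.countP (fun q => 1 ≤ q) = c.length := fun c =>
        List.countP_eq_length.2 fun x _ => by simp
      have := h 1
      rwa [hl, hl] at this
    · exact ((hc.lt_countP_iff k _).1 (((hd.lt_countP_iff k _).2 ⟨hk, le_rfl⟩).trans_le (h _))).2

/-- As both columns of a word have equal length, the number of letters `≥ -m` is m plus the number
of missing letters below -m. So counting letters amounts to counting in the two columns. -/
theorem letter_le_iff_colLe {v w : SemiInfWord} (hv : v ∈ BLam0) (hw : w ∈ BLam0) :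
    (∀ k, w.letter k ≤ v.letter k) ↔
      ColLe v.negColumn w.negColumn ∧ ColLe v.posColumn w.posColumn := by
  have key : ∀ w ∈ BLam0, ∀ m : ℕ+,
      w.countGe (negLetter m) = m + w.negColumn.countP (fun q => m + 1 ≤ q) := by
    intro w hw m
    have h1 := countGe_negLetter w m
    have h2 := List.length_eq_countP_add_countP (fun q => decide (q ≤ m)) (l := w.negColumn)
    have h3 : w.negColumn.countP (fun q => decide ¬ decide (q ≤ m) = true) =
        w.negColumn.countP (fun q => m + 1 ≤ q) := by
      refine List.countP_congr fun x _ => ?_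
      simp
    rw [h3] at h2
    rw [← length_columns hw] at h1
    omega
  have hl : ∀ c : List ℕ+, c.countP (fun q => 1 ≤ q) = c.length := fun c =>
    List.countP_eq_length.2 fun x _ => by simp
  rw [letter_le_iff, colLe_iff_countP (decCol_negColumn v) (decCol_negColumn w),
    colLe_iff_countP (decCol_posColumn v) (decCol_posColumn w)]
  constructor
  · intro h
    have h1 : ∀ p, w.posColumn.countP (fun q => p ≤ q) ≤ v.posColumn.countP (fun q => p ≤ q) :=
      fun p => by rw [← countGe_posLetter, ← countGe_posLetter]; exact h _
    refine ⟨fun p => ?_, h1⟩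
    induction p using PNat.recOn with
    -- Counts at negative letters only see thresholds `m + 1`. The threshold 1 is the length, which
    -- is taken over from the positive column.
    | one =>
      have h2 := h1 1
      rw [hl, hl] at h2 ⊢
      rwa [length_columns hv, length_columns hw]
    | succ m _ =>
      have h2 := h (negLetter m)
      rw [key v hv, key w hw] at h2
      omega
  · rintro ⟨h1, h2⟩ x
    rcases letter_pos_or_neg x with ⟨p, rfl⟩ | ⟨p, rfl⟩
    · rw [countGe_posLetter, countGe_posLetter]
      exact h2 p
    · rw [key v hv, key w hw]
      exact Nat.add_le_add_left (h1 _) _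

/-! ### Stability of the semi-infinite semistandard tableaux -/

theorem hi_le_of_lo_lt {i : ℤ} {x : Letter} (h : lo i < x) : hi i ≤ x := by
  by_contra h'
  have h1 : x ≠ lo i := h.ne'
  have h2 : x ≠ hi i := fun h2 => h' h2.ge
  exact lt_asymm h ((lo_hi_adj i x h1 h2).2 (not_le.1 h'))

theorem le_lo_of_lt_hi {i : ℤ} {x : Letter} (h : x < hi i) : x ≤ lo i :=
  not_lt.1 fun h' => absurd (hi_le_of_lo_lt h') (not_le.2 h)

theorem fockX_ep_of_ph {i : ℤ} (v : SemiInfWord) (h : (fockX i).ph v ≠ 0) : (fockX i).ep v = 0 := by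
  simp only [fockX] at h ⊢
  split_ifs at h ⊢ with h1 h2
  · exact absurd h1.1 h2.2
  all_goals first | rfl | exact absurd rfl h

theorem isChain_of_fock_f {i : ℤ} {t t' : List SemiInfWord} (h : (fockX i).wF t = some t')
    (ht : t.IsChain (fun v w => ∀ k, w.letter k ≤ v.letter k)) :
    t'.IsChain (fun v w => ∀ k, w.letter k ≤ v.letter k) := by
  refine OneColour.isChain_of_wF fockX_ep_of_ph ?_ ?_ h ht
  · intro u v v' huv hv hu k
    obtain ⟨h1, h2, -⟩ := fock_f_iff.1 hv
    rw [fock_f_letter hv]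
    split_ifs with hk
    -- If `u` also had `lo i` in row `k`, then `ph u = 0` would put `hi i` in another row `j` of
    -- `u`; the letter of `v` in row `j` is squeezed to `hi i`, which `v` does not contain.
    · refine hi_le_of_lo_lt (lt_of_le_of_ne (hk ▸ huv k) fun h3 => h2 ?_)
      have h4 : hi i ∈ u.letters := by
        by_contra h5
        have : (fockX i).ph u = 1 := if_pos ⟨⟨k, h3.symm⟩, h5⟩
        omega
      obtain ⟨j, hj⟩ := h4
      have hjk : j < k := u.strict.lt_iff_gt.1 (by rw [hj, ← h3]; exact lo_lt_hi i)
      refine ⟨j, le_antisymm (hj ▸ huv j) (hi_le_of_lo_lt ?_)⟩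
      rw [← hk]
      exact v.strict hjk
    · exact huv k
  · intro u u' v huv hu k
    rw [fock_f_letter hu]
    split_ifs with hk
    · exact (hk ▸ huv k).trans (lo_lt_hi i).le
    · exact huv k

theorem isChain_of_fock_e {i : ℤ} {t t' : List SemiInfWord} (h : (fockX i).wE t = some t')
    (ht : t.IsChain (fun v w => ∀ k, w.letter k ≤ v.letter k)) :
    t'.IsChain (fun v w => ∀ k, w.letter k ≤ v.letter k) := by
  refine OneColour.isChain_of_wE fockX_ep_of_ph (fockX_law i) ?_ ?_ h ht
  · intro u u' v huv hu hv k
    obtain ⟨h1, h2, -⟩ := fock_e_iff.1 hu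
    rw [fock_e_letter hu]
    split_ifs with hk
    · refine le_lo_of_lt_hi (lt_of_le_of_ne (hk ▸ huv k) fun h3 => h2 ?_)
      have h4 : lo i ∈ v.letters := by
        by_contra h5
        have : (fockX i).ep v = 1 := if_pos ⟨⟨k, h3⟩, h5⟩
        omega
      obtain ⟨j, hj⟩ := h4
      have hjk : k < j := v.strict.lt_iff_gt.1 (by rw [hj, h3]; exact lo_lt_hi i)
      refine ⟨j, le_antisymm (le_lo_of_lt_hi ?_) (hj ▸ huv j)⟩
      rw [← hk]
      exact u.strict hjk
    · exact huv k
  · intro u v v' huv hv k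
    rw [fock_e_letter hv]
    split_ifs with hk
    · exact (lo_lt_hi i).le.trans (hk ▸ huv k)
    · exact huv k

theorem OneColour.length_of_wF {B : Type*} {X : OneColour B} {l m : List B}
    (h : X.wF l = some m) : m.length = l.length := by
  simpa using congrArg List.length (map_of_wF (g := fun _ => ()) (fun _ _ _ => rfl) h)

theorem mem_BnLam0_of_f {n : ℕ} {i : ℤ} {t t' : List SemiInfWord} (ht : t ∈ BnLam0 n)
    (h : (fockX i).wF t = some t') : t' ∈ BnLam0 n :=
  ⟨(OneColour.length_of_wF h).trans ht.1,
    OneColour.mem_of_wF (fun _ _ h => mem_BLam0_of_f h) h ht.2.1, isChain_of_fock_f h ht.2.2⟩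

theorem mem_BnLam0_of_e {n : ℕ} {i : ℤ} {t t' : List SemiInfWord} (ht : t ∈ BnLam0 n)
    (h : (fockX i).wE t = some t') : t' ∈ BnLam0 n :=
  ⟨(OneColour.length_of_wF (((OneColour.word_law (fockX_law i)).f_iff_e _ _).2 h)).symm.trans ht.1,
    OneColour.mem_of_wE (fun _ _ h => mem_BLam0_of_e h) h ht.2.1, isChain_of_fock_e h ht.2.2⟩

/-! ### The tableaux of positive and negative entries -/

theorem colLe_trans {x y z : List ℕ+} (h1 : ColLe x y) (h2 : ColLe y z) : ColLe x z :=
  ⟨h2.1.trans h1.1, fun p hz hx =>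
    (h2.2 p hz (hz.trans_le h2.1)).trans (h1.2 p (hz.trans_le h2.1) hx)⟩

instance : IsTrans (List ℕ+) ColLe := ⟨fun _ _ _ => colLe_trans⟩

theorem eq_nil_of_colLe_nil {y : List ℕ+} (h : ColLe [] y) : y = [] := by
  cases y with
  | nil => rfl
  | cons b y => exact absurd h (not_colLe_nil b y)

theorem isSST_filter {L : Tab} (h1 : ∀ c ∈ L, DecCol c) (h2 : L.IsChain ColLe) :
    IsSST (L.filter (fun c => c ≠ [])) := by
  rw [isSST_iff, List.isChain_iff_pairwise]
  rw [List.isChain_iff_pairwise] at h2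
  refine ⟨fun c hc => ?_, h2.filter _⟩
  rw [List.mem_filter] at hc
  exact ⟨by simpa using hc.2, h1 c hc.1⟩

theorem filter_eq_nil_of_colLe {L : Tab} (h : ([] :: L).IsChain ColLe) :
    L.filter (fun c => c ≠ []) = [] ∧ ∀ c ∈ L, c = [] := by
  rw [List.isChain_iff_pairwise, List.pairwise_cons] at h
  have h1 : ∀ c ∈ L, c = [] := fun c hc => eq_nil_of_colLe_nil (h.1 c hc)
  refine ⟨List.filter_eq_nil_iff.2 fun c hc => ?_, h1⟩
  simp [h1 c hc]

/-- Heights decrease, so empty columns stand at the end and their removal shifts nothing. -/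
theorem colAt_filter {L : Tab} (h : L.IsChain ColLe) (k : ℕ) :
    colAt (L.filter (fun c => c ≠ [])) k = colAt L k := by
  induction L generalizing k with
  | nil => rfl
  | cons c L ih =>
    by_cases hc : c = []
    · subst hc
      obtain ⟨h1, h2⟩ := filter_eq_nil_of_colLe h
      rw [List.filter_cons_of_neg (by simp), h1]
      exact (colAt_mem (P := fun c => c = []) rfl (by simpa using h2) k).symm
    · rw [List.filter_cons_of_pos (by simpa using hc)]
      cases k with
      | zero => rfl
      | succ k => exact ih (List.isChain_cons.1 h).2 k

theorem isChain_columns {n : ℕ} {t : List SemiInfWord} (ht : t ∈ BnLam0 n) :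
    (t.map SemiInfWord.negColumn).IsChain ColLe ∧ (t.map SemiInfWord.posColumn).IsChain ColLe := by
  have h : t.IsChain (fun v w => ColLe v.negColumn w.negColumn ∧ ColLe v.posColumn w.posColumn) :=
    ht.2.2.imp_of_mem_imp fun v w hv hw h =>
      (letter_le_iff_colLe (ht.2.1 v hv) (ht.2.1 w hw)).1 h
  rw [List.isChain_map, List.isChain_map]
  exact ⟨h.imp fun _ _ h => h.1, h.imp fun _ _ h => h.2⟩

theorem colAt_negPart {n : ℕ} {t : List SemiInfWord} (ht : t ∈ BnLam0 n) (k : ℕ) :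
    colAt (negPart t) k = colAt (t.map SemiInfWord.negColumn) k :=
  colAt_filter (isChain_columns ht).1 k

theorem colAt_posPart {n : ℕ} {t : List SemiInfWord} (ht : t ∈ BnLam0 n) (k : ℕ) :
    colAt (posPart t) k = colAt (t.map SemiInfWord.posColumn) k :=
  colAt_filter (isChain_columns ht).2 k

theorem map_length_filter {L M : Tab} (h : L.map List.length = M.map List.length) :
    (L.filter (fun c => c ≠ [])).map List.length = (M.filter (fun c => c ≠ [])).map List.length := by
  have key : ∀ L : Tab, (L.filter (fun c => c ≠ [])).map List.length =
      (L.map List.length).filter (fun n => n ≠ 0) := by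
    intro L
    rw [List.filter_map]
    congr 1
    refine List.filter_congr fun c _ => ?_
    simp
  rw [key, key, h]

theorem parts_mem {n : ℕ} {t : List SemiInfWord} (ht : t ∈ BnLam0 n) :
    (negPart t, posPart t) ∈ bitableaux := by
  refine ⟨isSST_filter ?_ (isChain_columns ht).1, isSST_filter ?_ (isChain_columns ht).2,
    map_length_filter ?_⟩
  · intro c hc
    obtain ⟨w, -, rfl⟩ := List.mem_map.1 hc
    exact decCol_negColumn w
  · intro c hc
    obtain ⟨w, -, rfl⟩ := List.mem_map.1 hc
    exact decCol_posColumn w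
  · rw [List.map_map, List.map_map]
    exact List.map_congr_left fun w hw => length_columns (ht.2.1 w hw)

theorem negPart_append (t u : List SemiInfWord) : negPart (t ++ u) = negPart t ++ negPart u := by
  rw [negPart, List.map_append, List.filter_append]
  rfl

theorem posPart_append (t u : List SemiInfWord) : posPart (t ++ u) = posPart t ++ posPart u := by
  rw [posPart, List.map_append, List.filter_append]
  rfl

theorem parts_groundWord : negPart [groundWord] = [] ∧ posPart [groundWord] = [] := by
  simp [negPart, posPart, groundWord_columns]

/-- The ground word has empty columns, so it fits to the left of any tableau without altering its
two parts; this yields the inclusion of images. -/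
theorem append_groundWord_mem {n : ℕ} {t : List SemiInfWord} (ht : t ∈ BnLam0 n) :
    t ++ [groundWord] ∈ BnLam0 (n + 1) := by
  refine ⟨by simp [ht.1], fun w hw => ?_, ?_⟩
  · rcases List.mem_append.1 hw with hw | hw
    · exact ht.2.1 w hw
    · rw [List.mem_singleton.1 hw]
      exact groundWord_mem
  · rw [List.isChain_append]
    refine ⟨ht.2.2, List.isChain_singleton _, fun v hv w hw => ?_⟩
    obtain rfl : groundWord = w := by simpa using hw
    rw [letter_le_iff_colLe (ht.2.1 v (List.mem_of_mem_getLast? hv)) groundWord_mem,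
      groundWord_columns.1, groundWord_columns.2]
    exact ⟨colLe_nil _, colLe_nil _⟩

theorem exists_words {S T : Tab} (hS : ∀ c ∈ S, DecCol c) (hT : ∀ c ∈ T, DecCol c)
    (h : S.map List.length = T.map List.length) : ∃ t : List SemiInfWord,
      (∀ w ∈ t, w ∈ BLam0) ∧ t.map SemiInfWord.negColumn = S ∧ t.map SemiInfWord.posColumn = T := by
  induction S generalizing T with
  | nil =>
    obtain rfl : T = [] := by simpa [eq_comm] using h
    exact ⟨[], by simp, rfl, rfl⟩
  | cons c S ih =>
    cases T with
    | nil => simp at h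
    | cons d T =>
      rw [List.forall_mem_cons] at hS hT
      simp only [List.map_cons, List.cons.injEq] at h
      obtain ⟨w, hw, rfl, rfl⟩ := exists_word hS.1 hT.1 h.1
      obtain ⟨t, ht, rfl, rfl⟩ := ih hS.2 hT.2 h.2
      exact ⟨w :: t, List.forall_mem_cons.2 ⟨hw, ht⟩, rfl, rfl⟩

theorem exists_mem_BnLam0 {S T : Tab} (h : (S, T) ∈ bitableaux) :
    ∃ n, ∃ t ∈ BnLam0 n, negPart t = S ∧ posPart t = T := by
  obtain ⟨hS, hT, hST⟩ := h
  rw [isSST_iff] at hS hT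
  obtain ⟨t, ht, rfl, rfl⟩ :=
    exists_words (fun c hc => (hS.1 c hc).2) (fun c hc => (hT.1 c hc).2) hST
  refine ⟨t.length, t, ⟨rfl, ht, ?_⟩, ?_, ?_⟩
  · have h1 := hS.2
    have h2 := hT.2
    rw [List.isChain_iff_pairwise, List.pairwise_map] at h1 h2
    exact (h1.and h2).isChain.imp_of_mem_imp fun v w hv hw h =>
      (letter_le_iff_colLe (ht v hv) (ht w hw)).2 h
  · exact List.filter_eq_self.2 fun c hc => by simpa using (hS.1 c hc).1
  · exact List.filter_eq_self.2 fun c hc => by simpa using (hT.1 c hc).1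

theorem eq_of_filter_eq {L M : Tab} (hL : L.IsChain ColLe) (hM : M.IsChain ColLe)
    (hlen : L.length = M.length)
    (h : L.filter (fun c => c ≠ []) = M.filter (fun c => c ≠ [])) : L = M := by
  refine List.ext_getElem hlen fun k h1 h2 => ?_
  have h3 := colAt_filter hL k
  rw [h, colAt_filter hM k, colAt, colAt, List.getD_eq_getElem _ _ h1,
    List.getD_eq_getElem _ _ h2] at h3
  exact h3.symm

theorem parts_injective {n : ℕ} {t u : List SemiInfWord} (ht : t ∈ BnLam0 n) (hu : u ∈ BnLam0 n)
    (h1 : negPart t = negPart u) (h2 : posPart t = posPart u) : t = u := by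
  have hlen : t.length = u.length := ht.1.trans hu.1.symm
  have h3 := eq_of_filter_eq (isChain_columns ht).1 (isChain_columns hu).1 (by simpa using hlen) h1
  have h4 := eq_of_filter_eq (isChain_columns ht).2 (isChain_columns hu).2 (by simpa using hlen) h2
  refine List.ext_getElem hlen fun k hk hk' => SemiInfWord.ext_columns ?_ ?_
  · simpa [hk, hk'] using congrArg (fun l : Tab => l[k]?) h3
  · simpa [hk, hk'] using congrArg (fun l : Tab => l[k]?) h4

theorem filter_flatMap (t : List SemiInfWord) (g : SemiInfWord → List ℕ+) :
    (t.map g).filter (fun c => c ≠ []) = t.flatMap (fun w => if g w = [] then [] else [g w]) := by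
  induction t with
  | nil => rfl
  | cons w t ih =>
    rw [List.map_cons, List.flatMap_cons, ← ih]
    by_cases h : g w = [] <;> simp [h]

/-- An empty column has `ε = φ = 0`, like the empty word, and `f` preserves lengths, so emptiness is
never created. -/
theorem isHom_singleton {B : Type*} {X : OneColour B} (hX : X.Law) {p : ℕ+} {g : B → List ℕ+}
    (h : OneColour.IsHom X (colX p) g) :
    OneColour.IsHom X (colX p).word (fun w => if g w = [] then [] else [g w]) := by
  have h0 : (colX p).ep [] = 0 ∧ (colX p).ph [] = 0 := by simp [colX]
  have hep := h.ep
  have hph := h.ph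
  refine ⟨fun w => ?_, fun w => ?_, fun w => ?_⟩
  · split_ifs with hw
    · rw [← hep, hw, h0.1]; rfl
    · rw [← hep]
      simp [OneColour.word, OneColour.wep]
  · split_ifs with hw
    · rw [← hph, hw, h0.2]; rfl
    · rw [← hph]
      simp [OneColour.word, OneColour.wph, OneColour.wep]
  · have hf := h.f w
    split_ifs with hw
    · rw [(hX.f_none w).2 (by rw [← hph, hw, h0.2])]
      rfl
    · change (colX p).wF [g w] = _
      rw [OneColour.wF]
      cases hv : X.f w with
      | none =>
        have h1 := (hX.f_none w).1 hv
        rw [hph, h1]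
        rfl
      | some v =>
        have h1 := hX.ph_ne hv
        rw [hv, Option.map_some] at hf
        have h2 := length_of_colX_f hf
        have h3 : g v ≠ [] := fun h3 => hw (by
          rw [h3] at h2; exact List.length_eq_zero_iff.1 h2.symm)
        rw [if_pos (by rw [hph, OneColour.wep]; omega), hf, Option.map_some, Option.map_some,
          if_neg h3]

theorem posPart_hom (p : ℕ+) : OneColour.IsHom (fockX p).word (colX p).word posPart := by
  have h := (isHom_singleton (fockX_law p) (posColumn_hom p)).flatMap
  rwa [show (fun l : List SemiInfWord => l.flatMap _) = posPart from
    funext fun t => (filter_flatMap t _).symm] at h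

theorem negPart_hom (p : ℕ+) : OneColour.IsHom (fockX (-p)).word (colX p).word negPart := by
  have h := (isHom_singleton (fockX_law (-p)) (negColumn_hom p)).flatMap
  rwa [show (fun l : List SemiInfWord => l.flatMap _) = negPart from
    funext fun t => (filter_flatMap t _).symm] at h

theorem negPart_of_pos {p : ℕ+} {t t' : List SemiInfWord} (h : (fockX p).wF t = some t') :
    negPart t' = negPart t := by
  rw [negPart, negPart, OneColour.map_of_wF (fun _ _ h => negColumn_of_pos h) h]

theorem posPart_of_neg {p : ℕ+} {t t' : List SemiInfWord} (h : (fockX (-p)).wF t = some t') :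
    posPart t' = posPart t := by
  rw [posPart, posPart, OneColour.map_of_wF (fun _ _ h => posColumn_of_neg h) h]

/-! ### Crystals, colour by colour -/

/-- The axioms of a crystal for the colour `i`. -/
structure IsColour {B : Type} (C : CrystalData B) (i : ℤ) : Prop where
  phi_eq : ∀ b, C.phi i b = (pairing (C.wt b) i : WithBot ℤ) + C.eps i b
  f_step : ∀ b b', C.f i b = some b' →
    C.eps i b' = C.eps i b + ((1 : ℤ) : WithBot ℤ) ∧ C.wt b' = C.wt b - simpleRoot i
  f_iff_e : ∀ b b', C.f i b = some b' ↔ C.e i b' = some b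
  ne_bot : ∀ b, C.eps i b ≠ ⊥

theorem pairing_sub (x y : Weight) (i : ℤ) : pairing (x - y) i = pairing x i - pairing y i := by
  have h := pairing_add (x - y) y i
  rw [sub_add_cancel] at h
  omega

theorem pairing_neg (x : Weight) (i : ℤ) : pairing (-x) i = -pairing x i := by
  have h := pairing_add (-x) x i
  rw [neg_add_cancel] at h
  have h0 : pairing 0 i = 0 := by simp [pairing]
  omega

theorem pairing_simpleRoot (i : ℤ) : pairing (simpleRoot i) i = 2 := by
  have := lo_ne_hi i
  rw [simpleRoot, pairing_sub, pairing_epsWt, pairing_epsWt]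
  simp [this, this.symm]

/-- The rest follows formally: `φ` from `ε` and `⟨α_i, h_i⟩ = 2`, the rules for `e` by inverting
`f`, and the last axiom is vacuous since `ε` is finite. -/
theorem isCrystal_of_isColour {B : Type} {C : CrystalData B} (h : ∀ i, IsColour C i) :
    C.IsCrystal := by
  have hf : ∀ i b b', C.f i b = some b' →
      C.eps i b' = C.eps i b + ((1 : ℤ) : WithBot ℤ) ∧
      C.phi i b' = C.phi i b + ((-1 : ℤ) : WithBot ℤ) ∧ C.wt b' = C.wt b - simpleRoot i := by
    intro i b b' hb
    obtain ⟨h1, h2⟩ := (h i).f_step b b' hb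
    refine ⟨h1, ?_, h2⟩
    rw [(h i).phi_eq, (h i).phi_eq, h1, h2, pairing_sub, pairing_simpleRoot]
    obtain ⟨x, hx⟩ := WithBot.ne_bot_iff_exists.1 ((h i).ne_bot b)
    rw [← hx]
    norm_cast
    omega
  refine ⟨fun i => (h i).phi_eq, fun i b b' hb => ?_, hf, fun i => (h i).f_iff_e, fun i b hb => ?_⟩
  · obtain ⟨h1, h2, h3⟩ := hf i b' b (((h i).f_iff_e _ _).2 hb)
    rw [h1, h2, h3, sub_add_cancel, add_assoc, add_assoc]
    norm_cast
    simp
  · rw [(h i).phi_eq] at hb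
    obtain ⟨x, hx⟩ := WithBot.ne_bot_iff_exists.1 ((h i).ne_bot b)
    rw [← hx] at hb
    cases hb

theorem Models.isColour {B : Type} {C : CrystalData B} {i : ℤ} {X : OneColour B}
    (h1 : Models C i X) (h2 : X.Law)
    (hwt : ∀ b b', C.f i b = some b' → C.wt b' = C.wt b - simpleRoot i) : IsColour C i := by
  refine ⟨fun b => ?_, fun b b' hb => ⟨?_, hwt _ _ hb⟩, fun b b' => ?_, fun b => ?_⟩
  · rw [h1.phi, h1.eps, h1.pair, ← WithBot.coe_add]
    congr 1
    omega
  · rw [h1.f] at hb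
    have := h2.step _ _ hb
    rw [h1.eps, h1.eps, ← WithBot.coe_add]
    congr 1
    omega
  · rw [h1.f, h1.e, h2.f_iff_e]
  · rw [h1.eps]
    exact WithBot.coe_ne_bot

theorem posCrystal_models (p : ℕ+) : Models posCrystal p (letX p) := by
  have hp := p.pos
  have h1 : ∀ x : ℕ+, (0 < (p : ℤ) ∧ (x : ℤ) = p + 1) ↔ x = p + 1 := by
    intro x
    rw [← PNat.coe_inj, PNat.add_coe, PNat.one_coe]
    omega
  have h2 : ∀ x : ℕ+, (x : ℤ) = p ↔ x = p := by
    intro x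
    rw [← PNat.coe_inj]
    omega
  refine ⟨fun x => ?_, fun x => ?_, fun x => ?_, fun x => ?_, fun x => ?_⟩ <;>
    simp only [posCrystal, letX, h1, h2]
  · split_ifs <;> rfl
  · split_ifs <;> rfl
  · rw [pairing_epsWt, lo_pos, hi_pos]
    simp only [posLetter_inj]
    split_ifs <;> rfl
  · split_ifs with h
    · rw [h, PNat.add_sub]
    · rfl
  · split_ifs with h
    · rw [h]
    · rfl

theorem dualCrystal_models (p : ℕ+) : Models dualCrystal (-p) (letX p) := by
  have hp := p.pos
  have h1 : ∀ x : ℕ+, (-(p : ℤ) < 0 ∧ (x : ℤ) = -(-(p : ℤ)) + 1) ↔ x = p + 1 := by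
    intro x
    rw [← PNat.coe_inj, PNat.add_coe, PNat.one_coe]
    omega
  have h2 : ∀ x : ℕ+, (x : ℤ) = -(-(p : ℤ)) ↔ x = p := by
    intro x
    rw [← PNat.coe_inj]
    omega
  refine ⟨fun x => ?_, fun x => ?_, fun x => ?_, fun x => ?_, fun x => ?_⟩ <;>
    simp only [dualCrystal, letX, h1, h2]
  · split_ifs <;> rfl
  · split_ifs <;> rfl
  · rw [pairing_neg, pairing_epsWt, lo_neg, hi_neg]
    simp only [negLetter_inj]
    split_ifs <;> rfl
  · split_ifs with h
    · rw [h, PNat.add_sub]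
    · rfl
  · split_ifs with h
    · rw [h]
    · rfl

/-! ### Weights -/

theorem wordWt_eq_sum {B : Type} (C : CrystalData B) (l : List B) :
    wordWt C l = (l.map C.wt).sum := by
  induction l with
  | nil => rfl
  | cons b l ih => rw [wordWt, ih, List.map_cons, List.sum_cons]

theorem wordWt_perm {B : Type} {C : CrystalData B} {l m : List B} (h : l.Perm m) :
    wordWt C l = wordWt C m := by
  rw [wordWt_eq_sum, wordWt_eq_sum, (h.map _).sum_eq]

theorem wordWt_append {B : Type} (C : CrystalData B) (l m : List B) :
    wordWt C (l ++ m) = wordWt C l + wordWt C m := by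
  rw [wordWt_eq_sum, wordWt_eq_sum, wordWt_eq_sum, List.map_append, List.sum_append]

theorem matWt_add_single (A : Mat) (x : ℕ+ × ℕ+) : matWt (A + Finsupp.single x 1) =
    matWt A + (-epsWt (negLetter x.1) + epsWt (posLetter x.2)) := by
  rw [matWt, Finsupp.sum_add_index' (by simp) (by intros; rw [add_smul]),
    Finsupp.sum_single_index (by simp), one_smul]
  rfl

theorem matWt_toMat (l : List (ℕ+ × ℕ+)) : matWt (toMat l) =
    wordWt dualCrystal (l.map Prod.fst) + wordWt posCrystal (l.map Prod.snd) := by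
  induction l with
  | nil =>
    have : toMat [] = 0 := by simp [toMat]
    rw [this]
    simp [matWt, wordWt]
  | cons x l ih =>
    rw [toMat_cons, matWt_add_single, ih, List.map_cons, List.map_cons, wordWt, wordWt]
    simp only [dualCrystal, posCrystal]
    abel

theorem wordJ_perm_wordL (A : Mat) : (wordJ A).Perm (wordL A) := by
  rw [← Multiset.coe_eq_coe, coe_wordJ, coe_wordL]

theorem matWt_eq (A : Mat) :
    matWt A = wordWt dualCrystal (wordI A) + wordWt posCrystal (wordL A) := by
  rw [← wordWt_perm (wordJ_perm_wordL A)]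
  conv_lhs => rw [← toMat_biword A]
  exact matWt_toMat _

theorem pairing_wordWt_eq_zero {B : Type} {C : CrystalData B} {i : ℤ}
    (h : ∀ b, pairing (C.wt b) i = 0) (l : List B) : pairing (wordWt C l) i = 0 := by
  induction l with
  | nil => simp [wordWt, pairing]
  | cons b l ih => rw [wordWt, pairing_add, h, ih, add_zero]

theorem pairing_matWt_pos (A : Mat) (p : ℕ+) :
    pairing (matWt A) p = pairing (wordWt posCrystal (wordL A)) p := by
  rw [matWt_eq, pairing_add, pairing_wordWt_eq_zero, zero_add]
  intro x
  rw [show dualCrystal.wt x = -epsWt (negLetter x) from rfl, pairing_neg, pairing_epsWt, lo_pos,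
    hi_pos, if_neg (posLetter_ne_negLetter _ _).symm, if_neg (posLetter_ne_negLetter _ _).symm]
  rfl

theorem pairing_matWt_neg (A : Mat) (p : ℕ+) :
    pairing (matWt A) (-p) = pairing (wordWt dualCrystal (wordI A)) (-p) := by
  rw [matWt_eq, pairing_add, pairing_wordWt_eq_zero (C := posCrystal), add_zero]
  intro x
  rw [show posCrystal.wt x = epsWt (posLetter x) from rfl, pairing_epsWt, lo_neg,
    hi_neg, if_neg (posLetter_ne_negLetter _ _), if_neg (posLetter_ne_negLetter _ _)]
  rfl

/-! ### The crystal of matrices -/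

theorem toMat_biword' (A : Mat) : toMat (biword' A) = A := by
  have h : (biword' A : Multiset (ℕ+ × ℕ+)) = Finsupp.toMultiset A := by
    rw [biword'_eq, ← Multiset.map_coe, coe_biword, Mat.tr, Finsupp.equivMapDomain_eq_mapDomain,
      ← Finsupp.toMultiset_map, Multiset.map_map]
    exact Multiset.map_id _
  rw [toMat, h, Finsupp.toMultiset_toFinsupp]

theorem ofBiword_wordI (A : Mat) : ofBiword (wordI A) (wordJ A) = A :=
  (ofBiword_map _).trans (toMat_biword A)

theorem ofBiword_wordK (A : Mat) : ofBiword (wordK A) (wordL A) = A :=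
  (ofBiword_map _).trans (toMat_biword' A)

theorem wordK_columnX {p : ℕ+} {A B : Mat} (h : (columnX p).f A = some B) : wordK B = wordK A := by
  rw [wordK_eq, wordK_eq, wordJ_rowX (columnX_f_iff.1 h)]

theorem map_eq_of_forall {α β γ : Type*} {o : Option α} {g : α → β} {h : β → γ} {k : α → γ}
    (H : ∀ a, o = some a → h (g a) = k a) : (o.map g).map h = o.map k := by
  cases o with
  | none => rfl
  | some a => exact congrArg some (H a rfl)

theorem matCrystal_models_neg (p : ℕ+) : Models matCrystal (-p) (rowX p) := by
  have hp := p.pos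
  have hi : (-(p : ℤ)) < 0 := by omega
  have hw := (dualCrystal_models p).word
  refine ⟨fun A => ?_, fun A => ?_, fun A => ?_, fun A => ?_, fun A => ?_⟩
  · exact (if_pos hi).trans ((hw.eps _).trans (by rw [← (wordI_hom p).ep]))
  · exact (if_pos hi).trans ((hw.phi _).trans (by rw [← (wordI_hom p).ph]))
  · exact (pairing_matWt_neg A p).trans ((hw.pair _).trans
      (by rw [← (wordI_hom p).ep, ← (wordI_hom p).ph]))
  · refine (if_pos hi).trans ?_
    rw [show wordE dualCrystal (-p) (wordI A) = _ from hw.e _,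
      (wordI_hom p).e (rowX_law p) (OneColour.word_law (letX_law p))]
    refine (map_eq_of_forall fun B hB => ?_).trans Option.map_id'
    -- The word of second entries is the same for the new matrix, so pairing the new first word with
    -- the old second one gives back that matrix.
    rw [wordJ_rowX (((rowX_law p).f_iff_e _ _).2 hB), ofBiword_wordI]
  · refine (if_pos hi).trans ?_
    rw [show wordF dualCrystal (-p) (wordI A) = _ from hw.f _, (wordI_hom p).f]
    refine (map_eq_of_forall fun B hB => ?_).trans Option.map_id'
    rw [← wordJ_rowX hB, ofBiword_wordI]

theorem matCrystal_models_pos (p : ℕ+) : Models matCrystal p (columnX p) := by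
  have hp := p.pos
  have hi : ¬ (p : ℤ) < 0 := by omega
  have hi' : 0 < (p : ℤ) := by omega
  have hw := (posCrystal_models p).word
  refine ⟨fun A => ?_, fun A => ?_, fun A => ?_, fun A => ?_, fun A => ?_⟩
  · have h : matCrystal.eps p A = wordEps posCrystal p (wordL A) := by
      simp only [matCrystal, if_neg hi, if_pos hi']
    refine h.trans ((hw.eps _).trans ?_)
    rw [← (wordL_hom p).ep]
  · have h : matCrystal.phi p A = wordPhi posCrystal p (wordL A) := by
      simp only [matCrystal, if_neg hi, if_pos hi']
    refine h.trans ((hw.phi _).trans ?_)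
    rw [← (wordL_hom p).ph]
  · exact (pairing_matWt_pos A p).trans ((hw.pair _).trans
      (by rw [← (wordL_hom p).ep, ← (wordL_hom p).ph]))
  · have h : matCrystal.e p A =
        (wordE posCrystal p (wordL A)).map (fun v => ofBiword (wordK A) v) := by
      simp only [matCrystal, if_neg hi, if_pos hi']
    rw [h, show wordE posCrystal p (wordL A) = _ from hw.e _,
      (wordL_hom p).e (columnX_law p) (OneColour.word_law (letX_law p))]
    refine (map_eq_of_forall fun B hB => ?_).trans Option.map_id'
    rw [wordK_columnX (((columnX_law p).f_iff_e _ _).2 hB), ofBiword_wordK]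
  · have h : matCrystal.f p A =
        (wordF posCrystal p (wordL A)).map (fun v => ofBiword (wordK A) v) := by
      simp only [matCrystal, if_neg hi, if_pos hi']
    rw [h, show wordF posCrystal p (wordL A) = _ from hw.f _, (wordL_hom p).f]
    refine (map_eq_of_forall fun B hB => ?_).trans Option.map_id'
    rw [← wordK_columnX hB, ofBiword_wordK]

theorem matCrystal_zero (A : Mat) : matCrystal.eps 0 A = ((A (1, 1) : ℤ) : WithBot ℤ) ∧
    matCrystal.phi 0 A = (pairing (matWt A) 0 : WithBot ℤ) + ((A (1, 1) : ℤ) : WithBot ℤ) ∧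
    matCrystal.e 0 A = (if A (1, 1) ≠ 0 then some (A - E11) else none) ∧
    matCrystal.f 0 A = some (A + E11) := by
  simp [matCrystal]

theorem matCrystal_isCrystal : matCrystal.IsCrystal := by
  refine isCrystal_of_isColour fun i => ?_
  rcases colour_cases i with ⟨p, rfl⟩ | ⟨p, rfl⟩ | rfl
  · have hm := matCrystal_models_pos p
    refine hm.isColour (columnX_law p) fun A B hAB => ?_
    rw [hm.f] at hAB
    obtain ⟨i, -, h⟩ := columnX_f_iff_move.1 hAB
    have h1 := congrArg matWt h
    rw [matWt_add_single, matWt_add_single] at h1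
    rw [simpleRoot, lo_pos, hi_pos]
    change matWt B = matWt A - _
    rw [eq_sub_of_add_eq h1.symm]
    abel
  · have hm := matCrystal_models_neg p
    refine hm.isColour (rowX_law p) fun A B hAB => ?_
    rw [hm.f] at hAB
    obtain ⟨i, -, h⟩ := rowX_f_iff_move.1 hAB
    have h1 := congrArg matWt h
    rw [matWt_add_single, matWt_add_single] at h1
    rw [simpleRoot, lo_neg, hi_neg]
    change matWt B = matWt A - _
    rw [eq_sub_of_add_eq h1.symm]
    abel
  · refine ⟨fun A => ?_, fun A B hAB => ?_, fun A B => ?_, fun A => ?_⟩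
    · rw [(matCrystal_zero A).1, (matCrystal_zero A).2.1]
      rfl
    · rw [(matCrystal_zero A).2.2.2] at hAB
      cases hAB
      rw [(matCrystal_zero A).1, (matCrystal_zero _).1]
      refine ⟨?_, ?_⟩
      · rw [Finsupp.add_apply, E11, Finsupp.single_eq_same]
        norm_cast
      · change matWt (A + E11) = matWt A - _
        rw [E11, matWt_add_single, simpleRoot, lo_zero, hi_zero]
        abel
    · rw [(matCrystal_zero A).2.2.2, (matCrystal_zero B).2.2.1]
      constructor
      · intro h
        cases h
        have h0 : (A + E11) (1, 1) ≠ 0 := by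
          rw [Finsupp.add_apply, E11, Finsupp.single_eq_same]
          omega
        rw [if_pos h0, add_tsub_cancel_right]
      · intro h
        split_ifs at h with h0
        cases h
        rw [tsub_add_cancel_of_le]
        rw [E11, Finsupp.single_le_iff]
        omega
    · rw [(matCrystal_zero A).1]
      exact WithBot.coe_ne_bot

/-! ### The crystals of semi-infinite tableaux -/

theorem words_models (i : ℤ) : Models (wordCrystal fock) i (fockX i).word :=
  (fock_models i).word

theorem wordWt_of_wF {i : ℤ} {t t' : List SemiInfWord} (h : (fockX i).wF t = some t') :
    wordWt fock t' = wordWt fock t - simpleRoot i := by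
  induction t generalizing t' with
  | nil => cases h
  | cons w t ih =>
    simp only [OneColour.wF] at h
    split_ifs at h
    · obtain ⟨w', hw, rfl⟩ := Option.map_eq_some_iff.1 h
      rw [wordWt, wordWt, fock_wt_step hw]
      abel
    · obtain ⟨t'', ht, rfl⟩ := Option.map_eq_some_iff.1 h
      rw [wordWt, wordWt, ih ht]
      abel

theorem restrict_f_iff {B : Type} {C : CrystalData B} {S : Set B} {i : ℤ}
    (b b' : S) :
    (C.restrict S).f i b = some b' ↔ C.f i b = some b'.1 := by
  simp only [CrystalData.restrict, Option.bind_eq_some_iff]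
  constructor
  · rintro ⟨x, hx, h⟩
    split_ifs at h
    cases h
    exact hx
  · intro h
    exact ⟨b', h, dif_pos b'.2⟩

theorem restrict_e_iff {B : Type} {C : CrystalData B} {S : Set B} {i : ℤ}
    (b b' : S) : (C.restrict S).e i b = some b' ↔ C.e i b = some b'.1 := by
  simp only [CrystalData.restrict, Option.bind_eq_some_iff]
  constructor
  · rintro ⟨x, hx, h⟩
    split_ifs at h
    cases h
    exact hx
  · intro h
    exact ⟨b', h, dif_pos b'.2⟩

theorem tabCrystal_f_iff {n : ℕ} {i : ℤ} (b b' : BnLam0 n) :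
    (tabCrystal n).f i b = some b' ↔ (fockX i).wF b.1 = some b'.1 := by
  rw [tabCrystal, restrict_f_iff, (words_models i).f]
  rfl

theorem tabCrystal_e_iff {n : ℕ} {i : ℤ} (b b' : BnLam0 n) :
    (tabCrystal n).e i b = some b' ↔ (fockX i).wE b.1 = some b'.1 := by
  rw [tabCrystal, restrict_e_iff, (words_models i).e]
  rfl

theorem tabCrystal_eps {n : ℕ} (i : ℤ) (b : BnLam0 n) :
    (tabCrystal n).eps i b = (((fockX i).wep b.1 : ℤ) : WithBot ℤ) := (words_models i).eps _

theorem tabCrystal_isCrystal (n : ℕ) : (tabCrystal n).IsCrystal := by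
  refine isCrystal_of_isColour fun i => ?_
  have hlaw := OneColour.word_law (fockX_law i)
  refine ⟨fun b => ?_, fun b b' hb => ?_, fun b b' => ?_, fun b => ?_⟩
  · rw [show (tabCrystal n).phi i b = _ from (words_models i).phi b.1, tabCrystal_eps,
      show pairing ((tabCrystal n).wt b) i = _ from (words_models i).pair b.1, ← WithBot.coe_add]
    congr 1
    change ((fockX i).wph b.1 : ℤ) = (fockX i).wph b.1 - (fockX i).wep b.1 + (fockX i).wep b.1
    omega
  · rw [tabCrystal_f_iff] at hb
    refine ⟨?_, wordWt_of_wF hb⟩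
    rw [tabCrystal_eps, tabCrystal_eps, ← WithBot.coe_add]
    have : (fockX i).wep b'.1 = (fockX i).wep b.1 + 1 := (hlaw.step _ _ hb).2
    congr 1
    omega
  · rw [tabCrystal_f_iff, tabCrystal_e_iff]
    exact hlaw.f_iff_e _ _
  · rw [tabCrystal_eps]
    exact WithBot.coe_ne_bot

section Shift

variable {B : Type} {C : CrystalData B} (lam : Weight)

theorem tensor_t_eps (i : ℤ) (b : B × Unit) : (tensor C (tCrystal lam)).eps i b = C.eps i b.1 := by
  simp [tensor, tCrystal]

theorem tensor_t_e (i : ℤ) (b : B × Unit) :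
    (tensor C (tCrystal lam)).e i b = (C.e i b.1).map (fun x => (x, b.2)) := by
  simp [tensor, tCrystal]

/-- The rule acts on the left factor when -∞ < `φ`; if `φ` = -∞, the axioms make `f` vanish there
anyway. -/
theorem tensor_t_f (hC : C.IsCrystal) (i : ℤ) (b : B × Unit) :
    (tensor C (tCrystal lam)).f i b = (C.f i b.1).map (fun x => (x, b.2)) := by
  by_cases h : C.phi i b.1 = ⊥
  · simp [tensor, tCrystal, (hC.of_phi_bot i b.1 h).2]
  · simp [tensor, tCrystal, bot_lt_iff_ne_bot.2 h]

theorem tensor_t_phi (i : ℤ) (b : B × Unit) :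
    (tensor C (tCrystal lam)).phi i b = C.phi i b.1 + (pairing lam i : WithBot ℤ) := by
  simp [tensor, tCrystal]

theorem tensor_t_isColour (hC : C.IsCrystal) (i : ℤ) (h : ∀ b, C.eps i b ≠ ⊥) :
    IsColour (tensor C (tCrystal lam)) i := by
  refine ⟨fun b => ?_, fun b b' hb => ?_, fun b b' => ?_, fun b => ?_⟩
  · rw [tensor_t_phi, tensor_t_eps, hC.phi_eq]
    change _ = ((pairing (C.wt b.1 + lam) i : ℤ) : WithBot ℤ) + _
    rw [pairing_add, WithBot.coe_add, add_right_comm]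
  · rw [tensor_t_f lam hC] at hb
    obtain ⟨c, hc, rfl⟩ := Option.map_eq_some_iff.1 hb
    obtain ⟨h1, -, h2⟩ := hC.f_step _ _ _ hc
    rw [tensor_t_eps, tensor_t_eps]
    refine ⟨h1, ?_⟩
    change C.wt c + lam = C.wt b.1 + lam - _
    rw [h2]
    abel
  · rw [tensor_t_f lam hC, tensor_t_e, Option.map_eq_some_iff, Option.map_eq_some_iff]
    constructor
    · rintro ⟨c, hc, rfl⟩
      exact ⟨b.1, (hC.f_iff_e _ _ _).1 hc, rfl⟩
    · rintro ⟨c, hc, rfl⟩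
      exact ⟨b'.1, (hC.f_iff_e _ _ _).2 hc, rfl⟩
  · rw [tensor_t_eps]
    exact h _

end Shift

theorem shiftedCrystal_isCrystal (n : ℕ) : (shiftedCrystal n).IsCrystal :=
  isCrystal_of_isColour fun i => tensor_t_isColour _ (tabCrystal_isCrystal n) i fun b => by
    rw [tabCrystal_eps]
    exact WithBot.coe_ne_bot

/-! ### The embedding -/

theorem wordWt_dualCrystal (l : List ℕ+) : (wordWt dualCrystal l).2 = 0 ∧
    (∀ p, (wordWt dualCrystal l).1 (negLetter p) = -(l.count p : ℤ)) ∧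
    ∀ p, (wordWt dualCrystal l).1 (posLetter p) = 0 := by
  induction l with
  | nil => simp [wordWt]
  | cons x l ih =>
    obtain ⟨h1, h2, h3⟩ := ih
    refine ⟨?_, fun p => ?_, fun p => ?_⟩
    · rw [wordWt, Prod.snd_add, h1]
      simp [dualCrystal, epsWt]
    · rw [wordWt, Prod.fst_add, Finsupp.add_apply, h2, List.count_cons]
      by_cases hx : x = p <;>
        simp [dualCrystal, epsWt, negLetter_inj, hx]
    · rw [wordWt, Prod.fst_add, Finsupp.add_apply, h3]
      simp [dualCrystal, epsWt, (posLetter_ne_negLetter _ _).symm]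

theorem wordWt_posCrystal (l : List ℕ+) : (wordWt posCrystal l).2 = 0 ∧
    (∀ p, (wordWt posCrystal l).1 (posLetter p) = (l.count p : ℤ)) ∧
    ∀ p, (wordWt posCrystal l).1 (negLetter p) = 0 := by
  induction l with
  | nil => simp [wordWt]
  | cons x l ih =>
    obtain ⟨h1, h2, h3⟩ := ih
    refine ⟨?_, fun p => ?_, fun p => ?_⟩
    · rw [wordWt, Prod.snd_add, h1]
      simp [posCrystal, epsWt]
    · rw [wordWt, Prod.fst_add, Finsupp.add_apply, h2, List.count_cons]
      by_cases hx : x = p <;>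
        simp [posCrystal, epsWt, posLetter_inj, hx, add_comm]
    · rw [wordWt, Prod.fst_add, Finsupp.add_apply, h3]
      simp [posCrystal, epsWt, posLetter_ne_negLetter]

theorem fock_wt_eq (w : SemiInfWord) : fock.wt w =
    Lam0 + wordWt dualCrystal w.negColumn + wordWt posCrystal w.posColumn := by
  classical
  have h1 := wordWt_dualCrystal w.negColumn
  have h2 := wordWt_posCrystal w.posColumn
  refine Prod.ext (Finsupp.ext fun k => ?_) ?_
  · rw [fock_wt_apply, Prod.fst_add, Prod.fst_add, Finsupp.add_apply, Finsupp.add_apply,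
      show Lam0.1 k = 0 from rfl, zero_add]
    have hneg : ∀ p, (negLetter p : ℤ) < 0 := fun p => by
      have := p.pos
      simp only [negLetter]
      omega
    have hpos : ∀ p, ¬ (posLetter p : ℤ) < 0 := fun p => by
      simp only [posLetter]
      omega
    rcases letter_pos_or_neg k with ⟨p, rfl⟩ | ⟨p, rfl⟩
    · rw [h1.2.2, h2.2.1, (decCol_posColumn w).count_one, SemiInfWord.mult, if_neg (hpos p)]
      have := mem_posColumn (w := w) (p := p)
      by_cases h : posLetter p ∈ w.letters <;> simp [h, this]
    · rw [h1.2.1, h2.2.2, (decCol_negColumn w).count_one, SemiInfWord.mult, if_pos (hneg p)]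
      have := mem_negColumn (w := w) (p := p)
      by_cases h : negLetter p ∈ w.letters <;> simp [h, this]
  · rw [Prod.snd_add, Prod.snd_add, h1.1, h2.1]
    rfl

theorem flatten_filter (L : Tab) : (L.filter (fun c => c ≠ [])).flatten = L.flatten := by
  induction L with
  | nil => rfl
  | cons c L ih => by_cases h : c = [] <;> simp_all

theorem wordWt_fock (t : List SemiInfWord) : wordWt fock t = t.length • Lam0 +
    wordWt dualCrystal (negPart t).flatten + wordWt posCrystal (posPart t).flatten := by
  rw [negPart, posPart, flatten_filter, flatten_filter]
  induction t with
  | nil => simp [wordWt]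
  | cons w t ih =>
    rw [wordWt, ih, fock_wt_eq, List.length_cons, List.map_cons, List.map_cons, List.flatten_cons,
      List.flatten_cons, wordWt_append, wordWt_append, add_smul, one_smul]
    abel

/-- Surjectivity of `κ` ensures that `invFun` returns a true preimage rather than its default value.
-/
theorem kappa_Psi {n : ℕ} (b : BnLam0 n × Unit) :
    kappa (Psi n b) = (negPart b.1, posPart b.1) :=
  Function.invFun_eq (exists_kappa (parts_mem b.1.2))

theorem pTab_Psi {n : ℕ} (b : BnLam0 n × Unit) : pTab (Psi n b) = negPart b.1 := by
  have h := kappa_Psi b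
  rw [kappa_eq] at h
  exact (Prod.mk.inj h).1

theorem qTab_Psi {n : ℕ} (b : BnLam0 n × Unit) : qTab (Psi n b) = posPart b.1 := by
  have h := kappa_Psi b
  rw [kappa_eq] at h
  exact (Prod.mk.inj h).2

theorem eq_Psi {n : ℕ} {b : BnLam0 n × Unit} {A : Mat} (h1 : pTab A = negPart b.1)
    (h2 : qTab A = posPart b.1) : A = Psi n b :=
  kappa_injective (by rw [kappa_Psi, kappa_eq, h1, h2])

theorem Psi_injective (n : ℕ) : Function.Injective (Psi n) := by
  rintro ⟨b, ⟨⟩⟩ ⟨c, ⟨⟩⟩ h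
  have h1 := kappa_Psi (b, ())
  rw [h, kappa_Psi] at h1
  have h2 : b = c := Subtype.ext
    (parts_injective b.2 c.2 (Prod.mk.inj h1).1.symm (Prod.mk.inj h1).2.symm)
  rw [h2]

theorem matWt_Psi {n : ℕ} (b : BnLam0 n × Unit) :
    matWt (Psi n b) = (shiftedCrystal n).wt b := by
  have h1 : (wordI (Psi n b)).Perm (negPart b.1).flatten := by
    rw [← pTab_Psi]
    exact (tabOf_perm _).symm
  have h2 : (wordL (Psi n b)).Perm (posPart b.1).flatten := by
    rw [← qTab_Psi]
    exact (tabOf_perm _).symm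
  rw [matWt_eq, wordWt_perm h1, wordWt_perm h2]
  change _ = wordWt fock b.1.1 + -(n • Lam0)
  rw [wordWt_fock, b.1.2.1]
  abel

theorem eq_of_colAt {S T : Tab} (hS : IsSST S) (hT : IsSST T) (h : ∀ k, colAt S k = colAt T k) :
    S = T := by
  have key : ∀ {S : Tab}, IsSST S → ∀ k,
      S[k]? = if colAt S k = [] then none else some (colAt S k) := by
    intro S hS k
    rw [colAt, List.getD_eq_getElem?_getD]
    cases hk : S[k]? with
    | none => rfl
    | some c =>
      have := (hS.1 c (List.mem_of_getElem? hk)).1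
      simp [this]
  refine List.ext_getElem? fun k => ?_
  rw [key hS, key hT, h]

/-- The pairs of columns of a semi-infinite tableau. -/
def columnPairs (t : List SemiInfWord) : List (List ℕ+ × List ℕ+) :=
  t.map (fun w => (w.negColumn, w.posColumn))

/-- `zero_main` compares columns through `colAt`, for which absent and empty columns are the same;
so it applies to all n pairs of columns, empty ones included. -/
theorem zero_Psi {n : ℕ} (b : BnLam0 n × Unit) :
    (fockX 0).wep b.1.1 = Psi n b (1, 1) ∧ ∀ b' : BnLam0 n × Unit,
      (fockX 0).wF b.1.1 = some b'.1.1 → Psi n b + E11 = Psi n b' := by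
  have hcol : ∀ t : List SemiInfWord,
      (columnPairs t).map Prod.fst = t.map SemiInfWord.negColumn ∧
      (columnPairs t).map Prod.snd = t.map SemiInfWord.posColumn := by
    intro t
    rw [columnPairs, List.map_map, List.map_map]
    exact ⟨rfl, rfl⟩
  obtain ⟨h1, h2⟩ := zero_main (Psi n b) (columnPairs b.1.1)
    (fun k => by rw [(hcol _).1, pTab_Psi, colAt_negPart b.1.2])
    (fun k => by rw [(hcol _).2, qTab_Psi, colAt_posPart b.1.2])
  have hom := columns_hom.map
  refine ⟨(hom.ep _).symm.trans h1, fun b' hb' => ?_⟩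
  obtain ⟨h3, h4⟩ := h2 (columnPairs b'.1.1) (by
    refine (hom.f _).trans ?_
    rw [show (fockX 0).word.f b.1.1 = some b'.1.1 from hb']
    rfl)
  have hmem := parts_mem b'.1.2
  refine eq_Psi (eq_of_colAt (isSST_tabOf _) hmem.1 fun k => ?_)
    (eq_of_colAt (isSST_tabOf _) hmem.2.1 fun k => ?_)
  · rw [← h3, (hcol _).1, ← colAt_negPart b'.1.2]
  · rw [← h4, (hcol _).2, ← colAt_posPart b'.1.2]

theorem eps_Psi {n : ℕ} (i : ℤ) (b : BnLam0 n × Unit) :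
    matCrystal.eps i (Psi n b) = (shiftedCrystal n).eps i b := by
  rw [show (shiftedCrystal n).eps i b = _ from tensor_t_eps _ i b, tabCrystal_eps]
  rcases colour_cases i with ⟨p, rfl⟩ | ⟨p, rfl⟩ | rfl
  · rw [(matCrystal_models_pos p).eps, ← (qTab_hom p).ep, qTab_Psi, (posPart_hom p).ep]
    rfl
  · rw [(matCrystal_models_neg p).eps, ← (pTab_hom p).ep, pTab_Psi, (negPart_hom p).ep]
    rfl
  · rw [(matCrystal_zero _).1, (zero_Psi b).1]

/-- Only non-zero values can be compared: for `i = 0` the operator `f` never vanishes on matrices,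
whereas it may vanish on tableaux with n columns. -/
theorem f_Psi {n : ℕ} {i : ℤ} {b b' : BnLam0 n × Unit} (h : (shiftedCrystal n).f i b = some b') :
    matCrystal.f i (Psi n b) = some (Psi n b') := by
  rw [shiftedCrystal, tensor_t_f _ (tabCrystal_isCrystal n)] at h
  obtain ⟨c, hc, rfl⟩ := Option.map_eq_some_iff.1 h
  rw [tabCrystal_f_iff] at hc
  rcases colour_cases i with ⟨p, rfl⟩ | ⟨p, rfl⟩ | rfl
  · have h1 := (posPart_hom p).f b.1.1
    rw [show (fockX p).word.f b.1.1 = some c.1 from hc, ← qTab_Psi, (qTab_hom p).f] at h1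
    obtain ⟨B, hB, hB'⟩ := Option.map_eq_some_iff.1 h1
    rw [(matCrystal_models_pos p).f, hB, Option.some_inj]
    exact eq_Psi (by rw [pTab_columnX hB, pTab_Psi, ← negPart_of_pos hc]) hB'
  · have h1 := (negPart_hom p).f b.1.1
    rw [show (fockX (-p)).word.f b.1.1 = some c.1 from hc, ← pTab_Psi, (pTab_hom p).f] at h1
    obtain ⟨B, hB, hB'⟩ := Option.map_eq_some_iff.1 h1
    rw [(matCrystal_models_neg p).f, hB, Option.some_inj]
    exact eq_Psi hB' (by rw [qTab_rowX hB, qTab_Psi, ← posPart_of_neg hc])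
  · rw [(matCrystal_zero _).2.2.2, (zero_Psi b).2 (c, b.2) hc]

theorem Psi_isEmbedding (n : ℕ) :
    IsEmbedding (shiftedCrystal n) matCrystal (Option.map (Psi n)) := by
  have hsh := shiftedCrystal_isCrystal n
  refine ⟨⟨rfl, fun b b' hb => ?_, fun i b _ hb => ?_, fun i b _ hb => ?_⟩,
    Option.map_injective (Psi_injective n)⟩
  · obtain rfl : Psi n b = b' := by simpa using hb
    refine ⟨matWt_Psi b, fun i => ⟨eps_Psi i b, ?_⟩⟩
    rw [matCrystal_isCrystal.phi_eq, hsh.phi_eq, eps_Psi]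
    rw [show matCrystal.wt (Psi n b) = _ from matWt_Psi b]
  · obtain ⟨b', hb'⟩ : ∃ b', (shiftedCrystal n).e i b = some b' :=
      Option.ne_none_iff_exists'.1 fun h => hb (by rw [h]; rfl)
    rw [hb']
    exact ((matCrystal_isCrystal.f_iff_e _ _ _).1 (f_Psi ((hsh.f_iff_e _ _ _).2 hb'))).symm
  · obtain ⟨b', hb'⟩ : ∃ b', (shiftedCrystal n).f i b = some b' :=
      Option.ne_none_iff_exists'.1 fun h => hb (by rw [h]; rfl)
    rw [hb']
    exact (f_Psi hb').symm

theorem range_Psi_subset (n : ℕ) : Set.range (Psi n) ⊆ Set.range (Psi (n + 1)) := by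
  rintro _ ⟨b, rfl⟩
  refine ⟨(⟨b.1.1 ++ [groundWord], append_groundWord_mem b.1.2⟩, ()), (eq_Psi ?_ ?_).symm⟩
  · rw [pTab_Psi, negPart_append, parts_groundWord.1, List.append_nil]
  · rw [qTab_Psi, posPart_append, parts_groundWord.2, List.append_nil]

theorem iUnion_range_Psi : (⋃ n : ℕ, ⋃ _ : 1 ≤ n, Set.range (Psi n)) = Set.univ := by
  refine Set.eq_univ_of_forall fun A => ?_
  have hA := kappa_mem A
  rw [kappa_eq] at hA
  obtain ⟨n, t, ht, h1, h2⟩ := exists_mem_BnLam0 hA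
  have hA' : A ∈ Set.range (Psi n) := ⟨(⟨t, ht⟩, ()), (eq_Psi h1.symm h2.symm).symm⟩
  simp only [Set.mem_iUnion]
  -- The empty pair of tableaux comes with `n = 0`, so one column of padding is added to reach `1 ≤
  -- n`.
  exact ⟨n + 1, by omega, range_Psi_subset n hA'⟩

theorem BnLam0_stable {n : ℕ} (i : ℤ) {t t' : List SemiInfWord} (ht : t ∈ BnLam0 n)
    (h : (wordCrystal fock).e i t = some t' ∨ (wordCrystal fock).f i t = some t') :
    t' ∈ BnLam0 n := by
  rw [(words_models i).e, (words_models i).f] at h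
  exact h.elim (mem_BnLam0_of_e ht) (mem_BnLam0_of_f ht)

end GlInf

end

theorem mainTheorem2 :
    -- `κ : ℳ → 𝒯` is a bijection and `ℳ` is a crystal
    Set.BijOn GlInf.kappa Set.univ GlInf.bitableaux ∧
    GlInf.matCrystal.IsCrystal ∧
    (∀ n : ℕ, 1 ≤ n →
      -- `𝐁(nΛ₀) ∪ {0}` is stable under the operators, and `𝐁(nΛ₀) ⊗ T_{-nΛ₀}` is a crystal
      (∀ (i : ℤ), ∀ t ∈ GlInf.BnLam0 n, ∀ t' : List GlInf.SemiInfWord,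
        (GlInf.wordCrystal GlInf.fock).e i t = some t' ∨
          (GlInf.wordCrystal GlInf.fock).f i t = some t' → t' ∈ GlInf.BnLam0 n) ∧
      (GlInf.tabCrystal n).IsCrystal ∧
      (GlInf.shiftedCrystal n).IsCrystal ∧
      -- `Ψ_n` is well defined
      (∀ t ∈ GlInf.BnLam0 n, (GlInf.negPart t, GlInf.posPart t) ∈ GlInf.bitableaux) ∧
      (∀ b, GlInf.kappa (GlInf.Psi n b) = (GlInf.negPart b.1, GlInf.posPart b.1)) ∧
      -- `Ψ_n` is an embedding of crystals
      GlInf.IsEmbedding (GlInf.shiftedCrystal n) GlInf.matCrystal (Option.map (GlInf.Psi n)) ∧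
      -- the images increase
      Set.range (GlInf.Psi n) ⊆ Set.range (GlInf.Psi (n + 1))) ∧
    -- the images exhaust `ℳ`
    (⋃ n : ℕ, ⋃ _ : 1 ≤ n, Set.range (GlInf.Psi n)) = Set.univ :=
  ⟨GlInf.kappa_bijOn, GlInf.matCrystal_isCrystal,
    fun n _ => ⟨fun i _ ht _ h => GlInf.BnLam0_stable i ht h, GlInf.tabCrystal_isCrystal n,
      GlInf.shiftedCrystal_isCrystal n, fun _ ht => GlInf.parts_mem ht, GlInf.kappa_Psi,
      GlInf.Psi_isEmbedding n, GlInf.range_Psi_subset n⟩,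
    GlInf.iUnion_range_Psi⟩
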